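/- Let $M$ be a smooth manifold (Hausdorff, second countable, finite-dimensional, without boundary) and let $L$ be a smooth Hermitian line bundle over $M$, with circle bundle $S=\{(p,\tau):p\in M,\ \tau\in L_p,\ |\tau|=1\}$. Let $\pi_L,\pi_R:M\times M\to M$ be the left and right projections, let $L^{-1}$ be the dual line bundle with the dual metric, and let $$Q=\{(p,p',\sigma):p,p'\in M,\ \sigma\in L_p\otimes L_{p'}^{-1},\ |\sigma|=1\}$$ be the circle bundle of the Hermitian line bundle $\pi_L^*L\otimes\pi_R^*L^{-1}$ over $M\times M$. The conjugation action of the circle $\mathbb S=\{z\in\mathbb C:|z|=1\}$ on $S\times S$ is $z\cdot(\tau,\tau')=(z\tau,z\tau')$. For $\tau'\in S$ over $p'$, let $(\tau')^{-1}\in L_{p'}^{-1}$ be the element with $(\tau')^{-1}(\tau')=1$. A distribution on a manifold $X$ is a continuous linear functional on the space $C_c^\infty(X;\Omega)$ of smooth compactly supported complex densities. The pull-back $f^*u$ of a distribution $u$ on $Y$ under a smooth fibration $f:X\to Y$ is defined by $\langle f^*u,\mu\rangle=\langle u,f_*\mu\rangle$ for $\mu\in C_c^\infty(X;\Omega)$,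 where $f_*\mu\in C_c^\infty(Y;\Omega)$ is the push-forward of $\mu$ (integration over the fibres). A distribution $v$ on $S\times S$ is invariant if $\langle v,(z\cdot)_*\mu\rangle=\langle v,\mu\rangle$ for all $z\in\mathbb S$ and all $\mu\in C_c^\infty(S\times S;\Omega)$. Then the map $$f:S\times S\to Q,\qquad f(p,\tau;p',\tau')=(p,p',\tau\otimes(\tau')^{-1}),$$ is a smooth principal circle bundle for the conjugation action (it has smooth equivariant local trivializations near every point of $Q$), and $u\mapsto f^*u$ is a linear isomorphism from the space of distributions on $Q$ onto the space of distributions on $S\times S$ that are invariant under the conjugation action. -/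

import Mathlib

open scoped Manifold ContDiff TensorProduct

namespace CircleDist

open Set MeasureTheory Bundle

noncomputable section

/-! ### Smooth compactly supported densities and distributions on a manifold -/

/-- Complex Borel measures on a topological space. -/
abbrev BorelMeasure (X : Type*) [TopologicalSpace X] : Type _ :=
  @VectorMeasure X (borel X) ℂ _ _

/-- The push-forward `f_* μ` of a complex Borel measure under a continuous map `f`. -/
def pushforward {X Y : Type*} [TopologicalSpace X] [TopologicalSpace Y] (f : X → Y)
    (μ : BorelMeasure X) : BorelMeasure Y :=
  @VectorMeasure.map X Y (borel X) (borel Y) ℂ _ _ μ f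

section Distributions

variable {E : Type*} [NormedAddCommGroup E] [NormedSpace ℝ E] [MeasureSpace E]
  {H : Type*} [TopologicalSpace H] (I : ModelWithCorners ℝ E H)
  (X : Type*) [TopologicalSpace X] [ChartedSpace H X]

variable {X} in
/-- In the chart `e` the measure `μ` is `g(y) dy`, where `dy` is Lebesgue measure. -/
def HasChartDensity (e : OpenPartialHomeomorph X H) (μ : BorelMeasure X) (g : E → ℂ) : Prop :=
  IntegrableOn g (e.extend I).target ∧
    ∀ A : Set X, MeasurableSet[borel X] A → A ⊆ e.source → μ A = ∫ y in e.extend I '' A, g y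

/-- The space `C_c^∞(X; Ω)` of smooth compactly supported complex densities on a manifold `X`
(without boundary). A density is regarded as the complex measure that it defines: it vanishes
off a compact set and in every chart of the smooth structure it is `g(y) dy` with `g` smooth. -/
def testDensities : Submodule ℂ (BorelMeasure X) where
  carrier := {μ |
    (∃ K : Set X, IsCompact K ∧ ∀ A : Set X, MeasurableSet[borel X] A → Disjoint A K → μ A = 0) ∧
    ∀ e ∈ IsManifold.maximalAtlas I ∞ X, ∃ g : E → ℂ,
      ContDiffOn ℝ ∞ g (e.extend I).target ∧ HasChartDensity I e μ g}
  zero_mem' := by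
    refine ⟨⟨∅, isCompact_empty, fun A _ _ => rfl⟩, fun e _ => ⟨0, contDiffOn_const, ?_, ?_⟩⟩
    · exact integrableOn_zero
    · intro A _ _
      simp
  add_mem' := by
    rintro μ ν ⟨⟨K, hK, hμ⟩, h1⟩ ⟨⟨K', hK', hν⟩, h2⟩
    refine ⟨⟨K ∪ K', hK.union hK', fun A hA hd => ?_⟩, fun e he => ?_⟩
    · rw [disjoint_union_right] at hd
      change μ A + ν A = 0
      rw [hμ A hA hd.1, hν A hA hd.2, add_zero]
    · obtain ⟨g, hg, hi, h⟩ := h1 e he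
      obtain ⟨g', hg', hi', h'⟩ := h2 e he
      refine ⟨g + g', hg.add hg', hi.add hi', fun A hA hs => ?_⟩
      have hsub : e.extend I '' A ⊆ (e.extend I).target := by
        rintro _ ⟨x, hx, rfl⟩
        exact (e.extend I).map_source (by rw [e.extend_source]; exact hs hx)
      change μ A + ν A = _
      rw [h A hA hs, h' A hA hs]
      exact (integral_add (hi.mono_set hsub) (hi'.mono_set hsub)).symm
  smul_mem' := by
    rintro c μ ⟨⟨K, hK, hμ⟩, h1⟩
    refine ⟨⟨K, hK, fun A hA hd => ?_⟩, fun e he => ?_⟩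
    · change c • μ A = 0
      rw [hμ A hA hd, smul_zero]
    · obtain ⟨g, hg, hi, h⟩ := h1 e he
      refine ⟨c • g, contDiffOn_const.smul hg, hi.smul c, fun A hA hs => ?_⟩
      change c • μ A = _
      rw [h A hA hs]
      exact (integral_smul c g).symm

/-- The space `C^{-∞}(X)` of distributions on `X`: the linear functionals `u` on the smooth
compactly supported densities that are continuous, i.e. for every chart and every compact set `K`
in its image there are `N` and `C` with `|u(g(y) dy)| ≤ C sup_{k ≤ N} sup |D^k g|` for all smooth
`g` supported in `K`. -/
def distributions : Submodule ℂ (testDensities I X →ₗ[ℂ] ℂ) where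
  carrier := {u | ∀ e ∈ IsManifold.maximalAtlas I ∞ X, ∀ K ⊆ (e.extend I).target, IsCompact K →
    ∃ (N : ℕ) (C : ℝ), ∀ (μ : testDensities I X) (g : E → ℂ) (r : ℝ),
      ContDiff ℝ ∞ g → tsupport g ⊆ K → HasChartDensity I e μ.1 g →
      (∀ A : Set X, MeasurableSet[borel X] A → Disjoint A e.source → μ.1 A = 0) →
      (∀ k ≤ N, ∀ y, ‖iteratedFDeriv ℝ k g y‖ ≤ r) → ‖u μ‖ ≤ C * r}
  zero_mem' := by
    intro e _ K _ _
    exact ⟨0, 0, fun μ g r _ _ _ _ _ => by simp⟩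
  add_mem' := by
    intro u v hu hv e he K hK hc
    obtain ⟨N, C, h⟩ := hu e he K hK hc
    obtain ⟨N', C', h'⟩ := hv e he K hK hc
    refine ⟨max N N', C + C', fun μ g r h1 h2 h3 h4 h5 => ?_⟩
    rw [add_mul]
    exact (norm_add_le _ _).trans (add_le_add
      (h μ g r h1 h2 h3 h4 fun k hk => h5 k (hk.trans (le_max_left _ _)))
      (h' μ g r h1 h2 h3 h4 fun k hk => h5 k (hk.trans (le_max_right _ _))))
  smul_mem' := by
    intro c u hu e he K hK hc
    obtain ⟨N, C, h⟩ := hu e he K hK hc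
    refine ⟨N, ‖c‖ * C, fun μ g r h1 h2 h3 h4 h5 => ?_⟩
    rw [LinearMap.smul_apply, norm_smul, mul_assoc]
    exact mul_le_mul_of_nonneg_left (h μ g r h1 h2 h3 h4 h5) (norm_nonneg c)

variable {X}
  {E' : Type*} [NormedAddCommGroup E'] [NormedSpace ℝ E'] [MeasureSpace E']
  {H' : Type*} [TopologicalSpace H'] (J : ModelWithCorners ℝ E' H')
  {Y : Type*} [TopologicalSpace Y] [ChartedSpace H' Y]

/-- `v` is the pull-back `f^* u` of the distribution `u` on `Y` under `f : X → Y`: the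
push-forward (integration over the fibres of `f`) of a smooth compactly supported density on `X`
is one on `Y`, and `⟨f^* u, μ⟩ = ⟨u, f_* μ⟩`. -/
def IsPullback (f : X → Y) (u : distributions J Y) (v : distributions I X) : Prop :=
  ∀ μ : testDensities I X, ∃ h : pushforward f μ.1 ∈ testDensities J Y,
    v.1 μ = u.1 ⟨pushforward f μ.1, h⟩

/-- The distributions `v` on `X` that are invariant under a family `a` of diffeomorphisms of `X`:
`⟨v, (a z)_* μ⟩ = ⟨v, μ⟩` for all `z` and `μ`. -/
def invariantDistributions {G : Type*} (a : G → X → X) : Submodule ℂ (distributions I X) where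
  carrier := {v | ∀ (z : G) (μ ν : testDensities I X),
    ν.1 = pushforward (a z) μ.1 → v.1 ν = v.1 μ}
  zero_mem' := fun _ _ _ _ => rfl
  add_mem' := fun {u v} hu hv z μ ν h => by
    change u.1 ν + v.1 ν = u.1 μ + v.1 μ
    rw [hu z μ ν h, hv z μ ν h]
  smul_mem' := fun c u hu z μ ν h => by
    change c • u.1 ν = c • u.1 μ
    rw [hu z μ ν h]

/-- `f : X → Y` is a smooth principal circle bundle for the action `a` of the circle on `X`:
near every point of `Y` there is a smooth equivariant trivialization. -/
def IsPrincipalCircleBundle (f : X → Y) (a : Circle → X → X) : Prop :=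
  ∀ y : Y, ∃ (U : Set Y) (Φ : OpenPartialHomeomorph (Y × Circle) X),
    IsOpen U ∧ y ∈ U ∧ Φ.source = U ×ˢ univ ∧ Φ.target = f ⁻¹' U ∧
    ContMDiffOn (J.prod (𝓡 1)) I ∞ Φ Φ.source ∧
    ContMDiffOn I (J.prod (𝓡 1)) ∞ Φ.symm Φ.target ∧
    ∀ y' ∈ U, ∀ z w : Circle, f (Φ (y', z)) = y' ∧ Φ (y', w * z) = a w (Φ (y', z))

end Distributions

/-! ### Circle bundles from local coordinates -/

/-- Local circle-valued coordinates on a family `P b`, `b ∈ B`, of circles: over `dom i` the circle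
`P b` is identified with the standard one, and the coordinate changes are multiplication by
continuous circle-valued functions. -/
structure CircleBundleCore {B : Type*} [TopologicalSpace B] (P : B → Type*) where
  ι : Type*
  dom : ι → Set B
  isOpen_dom : ∀ i, IsOpen (dom i)
  idx : B → ι
  mem_dom : ∀ b, b ∈ dom (idx b)
  coord : ∀ i b, b ∈ dom i → P b ≃ Circle
  trans : ι → ι → B → Circle
  continuousOn_trans : ∀ i j, ContinuousOn (trans i j) (dom i ∩ dom j)
  coord_symm : ∀ i j b (hi : b ∈ dom i) (hj : b ∈ dom j) (z : Circle),
    coord j b hj ((coord i b hi).symm z) = trans i j b * z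

namespace CircleBundleCore

variable {B : Type*} [TopologicalSpace B] {P : B → Type*} (c : CircleBundleCore P)

open scoped Classical in
/-- The local trivialization `x ↦ (π x, coord i x)` over `dom i`. -/
def triv (i : c.ι) : PartialEquiv (TotalSpace Circle P) (B × Circle) where
  toFun x := (x.proj, if h : x.proj ∈ c.dom i then c.coord i x.proj h x.2 else 1)
  invFun q := ⟨q.1, if h : q.1 ∈ c.dom i then (c.coord i q.1 h).symm q.2
    else (c.coord (c.idx q.1) q.1 (c.mem_dom q.1)).symm 1⟩
  source := {x | x.proj ∈ c.dom i}
  target := c.dom i ×ˢ univ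
  map_source' x hx := ⟨hx, mem_univ _⟩
  map_target' q hq := hq.1
  left_inv' := by
    rintro ⟨b, x⟩ hx
    have hb : b ∈ c.dom i := hx
    simp [hb]
  right_inv' := by
    rintro ⟨b, z⟩ hx
    have hb : b ∈ c.dom i := hx.1
    simp [hb]

open scoped Classical in
theorem triv_symm_apply (i : c.ι) {b : B} (hb : b ∈ c.dom i) (z : Circle) :
    (c.triv i).symm (b, z) = ⟨b, (c.coord i b hb).symm z⟩ := by
  change (⟨b, if h : b ∈ c.dom i then (c.coord i b h).symm z
    else (c.coord (c.idx b) b (c.mem_dom b)).symm 1⟩ : TotalSpace Circle P) = _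
  rw [dif_pos hb]

open scoped Classical in
theorem triv_apply (i : c.ι) {b : B} (hb : b ∈ c.dom i) (x : P b) :
    c.triv i ⟨b, x⟩ = (b, c.coord i b hb x) := by
  change (b, if h : b ∈ c.dom i then c.coord i b h x else 1) = _
  rw [dif_pos hb]

theorem triv_symm_trans_source (i j : c.ι) :
    ((c.triv i).symm.trans (c.triv j)).source = (c.dom i ∩ c.dom j) ×ˢ univ := by
  ext ⟨b, z⟩
  rw [PartialEquiv.trans_source]
  constructor
  · rintro ⟨⟨hi, -⟩, hj⟩
    exact ⟨⟨hi, hj⟩, mem_univ _⟩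
  · rintro ⟨⟨hi, hj⟩, -⟩
    exact ⟨⟨hi, mem_univ _⟩, hj⟩

theorem triv_triv_symm (i j : c.ι) {q : B × Circle} (hq : q ∈ (c.dom i ∩ c.dom j) ×ˢ univ) :
    c.triv j ((c.triv i).symm q) = (q.1, c.trans i j q.1 * q.2) := by
  obtain ⟨b, z⟩ := q
  obtain ⟨⟨hi, hj⟩, -⟩ := hq
  rw [triv_symm_apply c i hi, triv_apply c j hj, c.coord_symm i j b hi hj]

/-- The atlas of local trivializations. -/
def chartedSpaceCore : ChartedSpaceCore (B × Circle) (TotalSpace Circle P) where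
  atlas := range c.triv
  chartAt x := c.triv (c.idx x.proj)
  mem_chart_source x := c.mem_dom x.proj
  chart_mem_atlas x := mem_range_self _
  open_source := by
    rintro _ _ ⟨i, rfl⟩ ⟨j, rfl⟩
    rw [triv_symm_trans_source]
    exact ((c.isOpen_dom i).inter (c.isOpen_dom j)).prod isOpen_univ
  continuousOn_toFun := by
    rintro _ _ ⟨i, rfl⟩ ⟨j, rfl⟩
    rw [triv_symm_trans_source]
    have h : ContinuousOn (fun q : B × Circle => (q.1, c.trans i j q.1 * q.2))
        ((c.dom i ∩ c.dom j) ×ˢ univ) := by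
      refine continuousOn_fst.prodMk (ContinuousOn.mul ?_ continuousOn_snd)
      exact (c.continuousOn_trans i j).comp continuousOn_fst fun q hq => hq.1
    exact h.congr fun q hq => c.triv_triv_symm i j hq

/-- The topology on the total space for which the local trivializations are homeomorphisms. -/
@[reducible]
def topology : TopologicalSpace (TotalSpace Circle P) := c.chartedSpaceCore.toTopologicalSpace

/-- The charts of the total space: local trivializations followed by products of charts of `B` and
charts of the circle. -/
@[reducible]
def charted (HB : Type*) [TopologicalSpace HB] [ChartedSpace HB B] :
    @ChartedSpace (ModelProd HB (EuclideanSpace ℝ (Fin 1))) _ (TotalSpace Circle P) c.topology :=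
  letI := c.topology
  letI : ChartedSpace (B × Circle) (TotalSpace Circle P) := c.chartedSpaceCore.toChartedSpace
  ChartedSpace.comp _ (B × Circle) _

/-- If the transition functions are smooth then the total space is a smooth manifold. -/
theorem isManifold {EB : Type*} [NormedAddCommGroup EB] [NormedSpace ℝ EB]
    {HB : Type*} [TopologicalSpace HB] (IB : ModelWithCorners ℝ EB HB) [ChartedSpace HB B]
    [IsManifold IB ∞ B]
    (h : ∀ i j, ContMDiffOn IB (𝓡 1) ∞ (c.trans i j) (c.dom i ∩ c.dom j)) :
    letI := c.topology
    letI := c.charted HB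
    IsManifold (IB.prod (𝓡 1)) ∞ (TotalSpace Circle P) := by
  let := c.topology
  let := c.charted HB
  have : IsManifold (𝓡 1) ∞ Circle := IsManifold.of_le (n := ω) le_top
  refine isManifold_of_contDiffOn _ _ _ ?_
  rintro _ _ ⟨_, he, f, hf, rfl⟩ ⟨_, he', f', hf', rfl⟩
  replace he := mem_iUnion₂.1 he
  replace he' := mem_iUnion₂.1 he'
  obtain ⟨_, ⟨i, rfl⟩, he⟩ := he
  obtain ⟨_, ⟨j, rfl⟩, he'⟩ := he'
  rw [mem_singleton_iff] at he he'
  subst he he'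
  have hf1 := IsManifold.subset_maximalAtlas (I := IB.prod (𝓡 1)) (n := ∞) hf
  have hf2 := IsManifold.subset_maximalAtlas (I := IB.prod (𝓡 1)) (n := ∞) hf'
  have ht : ContMDiffOn (IB.prod (𝓡 1)) (IB.prod (𝓡 1)) ∞
      (fun q : B × Circle => (q.1, c.trans i j q.1 * q.2)) ((c.dom i ∩ c.dom j) ×ˢ univ) := by
    have : LieGroup (𝓡 1) ∞ Circle := LieGroup.of_le (n := ω) le_top
    refine contMDiffOn_fst.prodMk (ContMDiffOn.mul ?_ contMDiffOn_snd)
    exact (h i j).comp contMDiffOn_fst fun q hq => hq.1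
  have hA := contMDiffOn_extend_symm hf1
  have hB := f'.contMDiffOn_extend hf2
  rw [← contMDiffOn_iff_contDiffOn]
  have key := hB.comp' (ht.comp' hA)
  have hmem : ∀ y, y ∈ (IB.prod (𝓡 1)).symm ⁻¹'
      ((c.chartedSpaceCore.openPartialHomeomorph (c.triv i) (mem_range_self i) ≫ₕ f).symm ≫ₕ
        c.chartedSpaceCore.openPartialHomeomorph (c.triv j) (mem_range_self j) ≫ₕ f').source →
      (IB.prod (𝓡 1)).symm y ∈ f.target ∧
      f.symm ((IB.prod (𝓡 1)).symm y) ∈ (c.dom i ∩ c.dom j) ×ˢ univ ∧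
      c.triv j ((c.triv i).symm (f.symm ((IB.prod (𝓡 1)).symm y))) ∈ f'.source := by
    intro y hy
    rw [mem_preimage, OpenPartialHomeomorph.trans_source, OpenPartialHomeomorph.symm_source,
      OpenPartialHomeomorph.trans_target, OpenPartialHomeomorph.trans_source] at hy
    obtain ⟨⟨h1, h2⟩, h3, h4⟩ := hy
    exact ⟨h1, ⟨⟨h2.1, h3⟩, mem_univ _⟩, h4⟩
  refine ContMDiffOn.congr_mono key ?_ ?_
  · rintro y ⟨hy, hyr⟩
    obtain ⟨-, h2, -⟩ := hmem y hy
    change (IB.prod (𝓡 1)) (f' (c.triv j ((c.triv i).symm (f.symm ((IB.prod (𝓡 1)).symm y))))) = _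
    rw [c.triv_triv_symm i j h2]
    rfl
  · rintro y ⟨hy, hyr⟩
    obtain ⟨h1, h2, h3⟩ := hmem y hy
    rw [c.triv_triv_symm i j h2] at h3
    exact ⟨⟨⟨_, h1, (IB.prod (𝓡 1)).right_inv hyr⟩, h2⟩, h3⟩

end CircleBundleCore

/-! ### Hermitian lines -/

section Lines

/-- The phase `c / |c|` of a non-zero complex number `c`. -/
def phase (c : ℂ) : Circle :=
  if h : c = 0 then 1 else ⟨c / (‖c‖ : ℂ), mem_sphere_zero_iff_norm.2 (by simp [h])⟩

theorem coe_phase {c : ℂ} (h : c ≠ 0) : (phase c : ℂ) = c / (‖c‖ : ℂ) := by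
  exact congrArg (fun z : Circle => (z : ℂ)) (dif_neg h)

theorem contMDiffAt_phase {c : ℂ} (h : c ≠ 0) : ContMDiffAt 𝓘(ℝ, ℂ) (𝓡 1) ∞ phase c := by
  have : Fact (Module.finrank ℝ ℂ = 1 + 1) := Complex.finrank_real_complex_fact
  let U : TopologicalSpace.Opens ℂ := ⟨{0}ᶜ, isOpen_compl_singleton⟩
  have hU : ContMDiff 𝓘(ℝ, ℂ) 𝓘(ℝ, ℂ) ∞ (fun x : U => (x : ℂ) / (‖(x : ℂ)‖ : ℂ)) := by
    intro x
    have hx : (x : ℂ) ≠ 0 := x.2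
    refine (contMDiffAt_subtype_iff (f := fun y : ℂ => y / (‖y‖ : ℂ))).2 ?_
    rw [contMDiffAt_iff_contDiffAt]
    have hn : ContDiffAt ℝ ∞ (fun y : ℂ => (‖y‖ : ℂ)) (x : ℂ) :=
      Complex.ofRealCLM.contDiff.contDiffAt.comp (x : ℂ) (contDiffAt_norm ℝ hx)
    simp only [div_eq_mul_inv]
    exact contDiffAt_id.mul (hn.inv (Complex.ofReal_ne_zero.2 (norm_ne_zero_iff.2 hx)))
  have hm : ∀ x : U, (x : ℂ) / (‖(x : ℂ)‖ : ℂ) ∈ Metric.sphere (0 : ℂ) 1 := fun x =>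
    mem_sphere_zero_iff_norm.2 (by
      have hx : (x : ℂ) ≠ 0 := x.2
      simp [hx])
  have h1 : ContMDiff 𝓘(ℝ, ℂ) (𝓡 1) ∞
      (fun x : U => show Circle from ⟨(x : ℂ) / (‖(x : ℂ)‖ : ℂ), hm x⟩) :=
    hU.codRestrict_sphere (n := 1) hm
  have h2 : ContMDiff 𝓘(ℝ, ℂ) (𝓡 1) ∞ (fun x : U => phase x) :=
    h1.congr fun x => Circle.ext (coe_phase x.2)
  exact (contMDiffAt_subtype_iff (U := U) (x := ⟨c, h⟩)).1 (h2 _)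

variable {V W : Type*} [NormedAddCommGroup V] [InnerProductSpace ℂ V]
  [NormedAddCommGroup W] [InnerProductSpace ℂ W]

variable (V) in
/-- The unit circle `{v : |v| = 1}` of a Hermitian line `V`. -/
def UnitCircle : Type _ := {v : V // ‖v‖ = 1}

variable (V W) in
/-- The unit circle of the line `V ⊗ W⁻¹`, where `W⁻¹` is the dual of the Hermitian line `W`. The
Hermitian metrics are those with `|τ ⊗ ξ| = |τ| |ξ|` and `|ξ(w)| = |ξ| |w|`, so the vectors of
length one are the tensors of unit vectors. -/
def UnitTensor : Type _ :=
  {σ : V ⊗[ℂ] StrongDual ℂ W // ∃ (τ : V) (ξ : StrongDual ℂ W), ‖τ‖ = 1 ∧ ‖ξ‖ = 1 ∧ σ = τ ⊗ₜ ξ}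

theorem eq_inner_smul {u : V} (hu : ‖u‖ = 1) (hs : ∀ v : V, ∃ c : ℂ, v = c • u) (v : V) :
    v = inner ℂ u v • u := by
  obtain ⟨c, rfl⟩ := hs v
  rw [inner_smul_right, inner_self_eq_norm_sq_to_K, hu]
  simp

theorem norm_inner_eq {u : V} (hu : ‖u‖ = 1) (hs : ∀ v : V, ∃ c : ℂ, v = c • u) (v : V) :
    ‖(inner ℂ u v : ℂ)‖ = ‖v‖ := by
  conv_rhs => rw [eq_inner_smul hu hs v, norm_smul, hu, mul_one]

theorem dual_eq {u : W} (hu : ‖u‖ = 1) (hs : ∀ v : W, ∃ c : ℂ, v = c • u) (ξ : StrongDual ℂ W) :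
    ξ = ξ u • innerSL ℂ u := by
  ext w
  conv_lhs => rw [eq_inner_smul hu hs w]
  simp [mul_comm]

theorem norm_dual_eq {u : W} (hu : ‖u‖ = 1) (hs : ∀ v : W, ∃ c : ℂ, v = c • u)
    (ξ : StrongDual ℂ W) : ‖ξ u‖ = ‖ξ‖ := by
  conv_rhs => rw [dual_eq hu hs ξ, norm_smul, innerSL_apply_norm, hu, mul_one]

/-- A unit vector `u` identifies the unit circle of a line with the standard one, `z u ↦ z`. -/
def lineCoord (u : V) (hu : ‖u‖ = 1) (hs : ∀ v : V, ∃ c : ℂ, v = c • u) :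
    UnitCircle V ≃ Circle where
  toFun v := ⟨inner ℂ u v.1, mem_sphere_zero_iff_norm.2 ((norm_inner_eq hu hs v.1).trans v.2)⟩
  invFun z := ⟨(z : ℂ) • u, by rw [norm_smul, hu, Circle.norm_coe, mul_one]⟩
  left_inv v := Subtype.ext (eq_inner_smul hu hs v.1).symm
  right_inv z := Circle.ext (by
    change inner ℂ u ((z : ℂ) • u) = (z : ℂ)
    rw [inner_smul_right, inner_self_eq_norm_sq_to_K, hu]
    simp)

/-- The linear map `τ ⊗ ξ ↦ ⟨u, τ⟩ ξ(u')`. -/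
def contract (u : V) (u' : W) : V ⊗[ℂ] StrongDual ℂ W →ₗ[ℂ] ℂ :=
  TensorProduct.lift ((LinearMap.mul ℂ ℂ).compl₁₂ (innerSL ℂ u).toLinearMap
    (ContinuousLinearMap.apply ℂ ℂ u').toLinearMap)

theorem contract_tmul (u τ : V) (u' : W) (ξ : StrongDual ℂ W) :
    contract u u' (τ ⊗ₜ ξ) = inner ℂ u τ * ξ u' := by
  simp [contract]

/-- Unit vectors `u ∈ V`, `u' ∈ W` identify the unit circle of `V ⊗ W⁻¹` with the standard one,
`z u ⊗ u'⁻¹ ↦ z`. -/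
def tensorCoord (u : V) (hu : ‖u‖ = 1) (hs : ∀ v : V, ∃ c : ℂ, v = c • u)
    (u' : W) (hu' : ‖u'‖ = 1) (hs' : ∀ v : W, ∃ c : ℂ, v = c • u') :
    UnitTensor V W ≃ Circle where
  toFun σ := ⟨contract u u' σ.1, mem_sphere_zero_iff_norm.2 (by
    obtain ⟨_, τ, ξ, hτ, hξ, rfl⟩ := σ
    rw [contract_tmul, norm_mul, norm_inner_eq hu hs, norm_dual_eq hu' hs', hτ, hξ, mul_one])⟩
  invFun z := ⟨((z : ℂ) • u) ⊗ₜ innerSL ℂ u', (z : ℂ) • u, innerSL ℂ u',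
    by rw [norm_smul, hu, Circle.norm_coe, mul_one], by rw [innerSL_apply_norm, hu'], rfl⟩
  left_inv := by
    rintro ⟨_, τ, ξ, hτ, hξ, rfl⟩
    refine Subtype.ext ?_
    change (contract u u' (τ ⊗ₜ ξ) • u) ⊗ₜ innerSL ℂ u' = τ ⊗ₜ[ℂ] ξ
    conv_rhs => rw [eq_inner_smul hu hs τ, dual_eq hu' hs' ξ]
    rw [contract_tmul, TensorProduct.tmul_smul, TensorProduct.smul_tmul', smul_smul, mul_comm]
  right_inv z := Circle.ext (by
    change contract u u' (((z : ℂ) • u) ⊗ₜ innerSL ℂ u') = (z : ℂ)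
    rw [contract_tmul, inner_smul_right, innerSL_apply_apply, inner_self_eq_norm_sq_to_K,
      inner_self_eq_norm_sq_to_K, hu, hu']
    simp)

end Lines

/-! ### The circle bundles of `L` and of `π_L^* L ⊗ π_R^* L⁻¹` -/

section LineBundle

variable {M : Type*} [TopologicalSpace M] (L : M → Type*) [TopologicalSpace (TotalSpace ℂ L)]
  [∀ x, NormedAddCommGroup (L x)] [∀ x, InnerProductSpace ℂ (L x)]
  [FiberBundle ℂ L] [VectorBundle ℂ ℂ L]

/-- The Hermitian metric of `L` is smooth: `|v|²` is a smooth function on the total space of `L`.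
By polarization this says that `⟨s, t⟩` is smooth for all smooth local sections `s`, `t`. -/
def IsSmoothMetric {E : Type*} [NormedAddCommGroup E] [NormedSpace ℝ E]
    {H : Type*} [TopologicalSpace H] (I : ModelWithCorners ℝ E H) [ChartedSpace H M] : Prop :=
  ContMDiff (I.prod 𝓘(ℝ, ℂ)) 𝓘(ℝ, ℝ) ∞ (fun v : TotalSpace ℂ L => ‖v.2‖ ^ 2)

/-- The local trivializations of `L`. -/
abbrev Triv : Type _ := {e : Trivialization ℂ (π ℂ L) // MemTrivializationAtlas e}

variable {L}

instance (e : Triv L) : MemTrivializationAtlas e.1 := e.2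

/-- The local section of `L` of length one that is a positive multiple of the section which is `1`
in the local trivialization `e`. -/
def unitFrame (e : Triv L) (x : M) : L x := ((‖e.1.symm x 1‖⁻¹ : ℝ) : ℂ) • e.1.symm x 1

/-- The transition function between two local trivializations of the line bundle. -/
def cocycle (e e' : Triv L) (x : M) : ℂ := (e'.1 ⟨x, e.1.symm x 1⟩).2

theorem eq_smul_symm (e : Triv L) {x : M} (hx : x ∈ e.1.baseSet) (v : L x) :
    v = (e.1 ⟨x, v⟩).2 • e.1.symm x 1 := by
  apply (e.1.linearEquivAt ℂ x hx).injective
  rw [map_smul, ← Trivialization.linearEquivAt_symm_apply (R := ℂ) e.1 x hx, LinearEquiv.apply_symm_apply,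
    Trivialization.linearEquivAt_apply, smul_eq_mul, mul_one]

theorem symm_one_ne_zero (e : Triv L) {x : M} (hx : x ∈ e.1.baseSet) : e.1.symm x 1 ≠ 0 := by
  rw [← Trivialization.linearEquivAt_symm_apply (R := ℂ) e.1 x hx]
  exact (LinearEquiv.map_ne_zero_iff _).2 one_ne_zero

theorem norm_unitFrame (e : Triv L) {x : M} (hx : x ∈ e.1.baseSet) : ‖unitFrame e x‖ = 1 := by
  have h := norm_ne_zero_iff.2 (symm_one_ne_zero e hx)
  rw [unitFrame, norm_smul, Complex.norm_real, norm_inv, norm_norm, inv_mul_cancel₀ h]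

theorem unitFrame_spans (e : Triv L) {x : M} (hx : x ∈ e.1.baseSet) (v : L x) :
    ∃ c : ℂ, v = c • unitFrame e x := by
  have h : (‖e.1.symm x 1‖ : ℂ) ≠ 0 :=
    Complex.ofReal_ne_zero.2 (norm_ne_zero_iff.2 (symm_one_ne_zero e hx))
  refine ⟨(e.1 ⟨x, v⟩).2 * ‖e.1.symm x 1‖, ?_⟩
  rw [unitFrame, smul_smul, Complex.ofReal_inv, mul_assoc, mul_inv_cancel₀ h, mul_one]
  exact eq_smul_symm e hx v

theorem cocycle_ne_zero (e e' : Triv L) {x : M} (hx : x ∈ e.1.baseSet) (hx' : x ∈ e'.1.baseSet) :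
    cocycle e e' x ≠ 0 := by
  intro h
  apply symm_one_ne_zero e hx
  rw [eq_smul_symm e' hx' (e.1.symm x 1)]
  change cocycle e e' x • _ = 0
  rw [h, zero_smul]

theorem unitFrame_eq (e e' : Triv L) {x : M} (hx : x ∈ e.1.baseSet) (hx' : x ∈ e'.1.baseSet) :
    unitFrame e x = (phase (cocycle e e' x) : ℂ) • unitFrame e' x := by
  have h : e.1.symm x 1 = cocycle e e' x • e'.1.symm x 1 := eq_smul_symm e' hx' _
  rw [coe_phase (cocycle_ne_zero e e' hx hx'), unitFrame, unitFrame, h, norm_smul, smul_smul,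
    smul_smul]
  congr 1
  push_cast
  ring

theorem cocycle_eq_coordChangeL (e e' : Triv L) {x : M} (hx : x ∈ e.1.baseSet ∩ e'.1.baseSet) :
    cocycle e e' x = (e.1.coordChangeL ℂ e'.1 x : ℂ →L[ℂ] ℂ) 1 :=
  (Trivialization.coordChangeL_apply (R := ℂ) e.1 e'.1 hx 1).symm

theorem continuousOn_phase_cocycle (e e' : Triv L) :
    ContinuousOn (fun x => phase (cocycle e e' x)) (e.1.baseSet ∩ e'.1.baseSet) := by
  intro x hx
  have h : ContinuousOn (cocycle e e') (e.1.baseSet ∩ e'.1.baseSet) :=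
    ((continuousOn_coordChange ℂ e.1 e'.1).clm_apply continuousOn_const).congr
      fun y hy => cocycle_eq_coordChangeL e e' hy
  exact (contMDiffAt_phase (cocycle_ne_zero e e' hx.1 hx.2)).continuousAt.comp_continuousWithinAt
    (h x hx)

theorem contMDiffOn_phase_cocycle {E : Type*} [NormedAddCommGroup E] [NormedSpace ℝ E]
    {H : Type*} [TopologicalSpace H] (I : ModelWithCorners ℝ E H) [ChartedSpace H M]
    [VectorBundle ℝ ℂ L] [ContMDiffVectorBundle ∞ ℂ L I] (e e' : Triv L) :
    ContMDiffOn I (𝓡 1) ∞ (fun x => phase (cocycle e e' x)) (e.1.baseSet ∩ e'.1.baseSet) := by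
  intro x hx
  have h : ContMDiffOn I 𝓘(ℝ, ℂ) ∞ (cocycle e e') (e.1.baseSet ∩ e'.1.baseSet) :=
    ((ContMDiffVectorBundle.contMDiffOn_coordChangeL (IB := I) (n := ∞) e.1 e'.1).clm_apply
      contMDiffOn_const).congr fun y hy =>
        (Trivialization.coordChangeL_apply (R := ℝ) e.1 e'.1 hy 1).symm
  exact (contMDiffAt_phase (cocycle_ne_zero e e' hx.1 hx.2)).comp_contMDiffWithinAt x (h x hx)

variable (L)

/-- The coordinates on the circles of `L` given by the normalized local trivializations. -/
def circleCore : CircleBundleCore (fun x : M => UnitCircle (L x)) where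
  ι := Triv L
  dom e := e.1.baseSet
  isOpen_dom e := e.1.open_baseSet
  idx x := ⟨trivializationAt ℂ L x, inferInstance⟩
  mem_dom x := mem_baseSet_trivializationAt ℂ L x
  coord e x hx := lineCoord (unitFrame e x) (norm_unitFrame e hx) (unitFrame_spans e hx)
  trans e e' x := phase (cocycle e e' x)
  continuousOn_trans e e' := continuousOn_phase_cocycle e e'
  coord_symm e e' x hx hx' z := Circle.ext (by
    change inner ℂ (unitFrame e' x) ((z : ℂ) • unitFrame e x) = (phase (cocycle e e' x) * z : ℂ)
    rw [unitFrame_eq e e' hx hx', inner_smul_right, inner_smul_right, inner_self_eq_norm_sq_to_K,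
      norm_unitFrame e' hx', mul_comm]
    simp)

/-- The coordinates on the circles of `π_L^* L ⊗ π_R^* L⁻¹` given by pairs of normalized local
trivializations of `L`. -/
def tensorCore : CircleBundleCore (fun p : M × M => UnitTensor (L p.1) (L p.2)) where
  ι := Triv L × Triv L
  dom e := e.1.1.baseSet ×ˢ e.2.1.baseSet
  isOpen_dom e := e.1.1.open_baseSet.prod e.2.1.open_baseSet
  idx p := (⟨trivializationAt ℂ L p.1, inferInstance⟩, ⟨trivializationAt ℂ L p.2, inferInstance⟩)
  mem_dom p := ⟨mem_baseSet_trivializationAt ℂ L p.1, mem_baseSet_trivializationAt ℂ L p.2⟩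
  coord e p hp := tensorCoord (unitFrame e.1 p.1) (norm_unitFrame e.1 hp.1)
    (unitFrame_spans e.1 hp.1) (unitFrame e.2 p.2) (norm_unitFrame e.2 hp.2)
    (unitFrame_spans e.2 hp.2)
  trans e e' p := phase (cocycle e.1 e'.1 p.1) * (phase (cocycle e.2 e'.2 p.2))⁻¹
  continuousOn_trans e e' :=
    ((continuousOn_phase_cocycle e.1 e'.1).comp continuousOn_fst
      fun p hp => ⟨hp.1.1, hp.2.1⟩).mul
    ((continuousOn_phase_cocycle e.2 e'.2).comp continuousOn_snd
      fun p hp => ⟨hp.1.2, hp.2.2⟩).inv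
  coord_symm e e' p hp hp' z := Circle.ext (by
    change contract (unitFrame e'.1 p.1) (unitFrame e'.2 p.2)
      (((z : ℂ) • unitFrame e.1 p.1) ⊗ₜ innerSL ℂ (unitFrame e.2 p.2)) = _
    rw [contract_tmul, innerSL_apply_apply, unitFrame_eq e.1 e'.1 hp.1 hp'.1,
      unitFrame_eq e.2 e'.2 hp.2 hp'.2, inner_smul_right, inner_smul_right, inner_smul_left,
      inner_self_eq_norm_sq_to_K, inner_self_eq_norm_sq_to_K, norm_unitFrame e'.1 hp'.1,
      norm_unitFrame e'.2 hp'.2, Circle.coe_mul, Circle.coe_mul, Circle.coe_inv_eq_conj]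
    simp only [RCLike.ofReal_one, one_pow, mul_one]
    ring)

/-- The circle bundle `S = {(p, τ) : τ ∈ L_p, |τ| = 1}` of `L`. -/
def S : Type _ := TotalSpace Circle (fun x : M => UnitCircle (L x))

/-- The circle bundle `Q = {(p, p', σ) : σ ∈ L_p ⊗ L_{p'}⁻¹, |σ| = 1}` of
`π_L^* L ⊗ π_R^* L⁻¹` over `M × M`. -/
def Q : Type _ := TotalSpace Circle (fun p : M × M => UnitTensor (L p.1) (L p.2))

instance : TopologicalSpace (S L) := (circleCore L).topology

instance : TopologicalSpace (Q L) := (tensorCore L).topology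

instance {H : Type*} [TopologicalSpace H] [ChartedSpace H M] :
    ChartedSpace (ModelProd H (EuclideanSpace ℝ (Fin 1))) (S L) := (circleCore L).charted H

instance {H : Type*} [TopologicalSpace H] [ChartedSpace H M] :
    ChartedSpace (ModelProd (ModelProd H H) (EuclideanSpace ℝ (Fin 1))) (Q L) :=
  (tensorCore L).charted (ModelProd H H)

section Smooth

variable {E : Type*} [NormedAddCommGroup E] [NormedSpace ℝ E]
  {H : Type*} [TopologicalSpace H] (I : ModelWithCorners ℝ E H) [ChartedSpace H M]
  [IsManifold I ∞ M] [VectorBundle ℝ ℂ L] [ContMDiffVectorBundle ∞ ℂ L I]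

instance : IsManifold (I.prod (𝓡 1)) ∞ (S L) :=
  (circleCore L).isManifold I (contMDiffOn_phase_cocycle I)

instance : IsManifold ((I.prod I).prod (𝓡 1)) ∞ (Q L) := by
  refine (tensorCore L).isManifold (I.prod I) fun e e' => ?_
  have : LieGroup (𝓡 1) ∞ Circle := LieGroup.of_le (n := ω) le_top
  exact ((contMDiffOn_phase_cocycle I e.1 e'.1).comp contMDiffOn_fst
      fun p hp => ⟨hp.1.1, hp.2.1⟩).mul
    ((contMDiffOn_phase_cocycle I e.2 e'.2).comp contMDiffOn_snd
      fun p hp => ⟨hp.1.2, hp.2.2⟩).inv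

end Smooth

variable {L}

/-- The action of the circle on `S` by scalar multiplication in the fibres of `L`. -/
def rotate (z : Circle) (s : S L) : S L :=
  ⟨s.proj, ⟨(z : ℂ) • s.snd.1, by rw [norm_smul, Circle.norm_coe, one_mul]; exact s.snd.2⟩⟩

variable (L) in
/-- The conjugation action `z · (τ, τ') = (z τ, z τ')` of the circle on `S × S`. -/
def conjAction (z : Circle) (s : S L × S L) : S L × S L := (rotate z s.1, rotate z s.2)

variable (L) in
/-- The map `S × S → Q`, `(p, τ; p', τ') ↦ (p, p', τ ⊗ τ'⁻¹)`. Here `τ'⁻¹ = ⟨τ', ·⟩` is the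
element of `L_{p'}⁻¹` with `τ'⁻¹(τ') = 1`. -/
def toQ (s : S L × S L) : Q L :=
  ⟨(s.1.proj, s.2.proj), ⟨s.1.snd.1 ⊗ₜ innerSL ℂ s.2.snd.1, s.1.snd.1, innerSL ℂ s.2.snd.1,
    s.1.snd.2, (innerSL_apply_norm ℂ _).trans s.2.snd.2, rfl⟩⟩

end LineBundle

end

end CircleDist

/-!
Near every point of `Q` a pair of local trivializations of `L` gives circle coordinates `α`, `β` on
the fibres of `S × S` over `M × M` and a circle coordinate on the fibres of `Q` in which the map
`S × S → Q` is `(α, β) ↦ α β⁻¹`. The conjugation action multiplies `α` and `β` by the same number,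
so `(α β⁻¹, β)` is an equivariant local trivialization: this is `isPrincipalCircleBundle_toQ`.

The statement about distributions holds for every principal circle bundle `f : X → Y`. A local
trivialization, a chart of `Y` and the angle on the circle combine to a chart of `X` in which `f`
forgets the angle and the circle acts by translations of the angle (`IsFibreChart`). In such a
chart the push-forward of a density is the integral over the angle
(`IsFibreChart.pushforward_ofChart`), so `f_*` maps test densities to test densities, and the
pull-back is its transpose. It remains to see three things.

* `f_*` is surjective (`integrate_surjective`), hence the pull-back is injective. A density
  `G(y) dy` on `Y` supported in a chart is the push-forward of `χ(t) G(y) dy dt` for a bump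
  function `χ` with integral one.
* An invariant distribution `v` vanishes on the kernel of `f_*`
  (`apply_eq_zero_of_integrate_eq_zero`), hence descends to a functional on the test densities of
  `Y`. A density on `X` is cut into pieces by functions pulled back from `Y`, which keeps the
  push-forwards zero, and then into smaller pieces which rotations move into a single adapted chart
  (`apply_eq_zero_of_supportedOn`). In that chart the density `g` has vanishing integrals over the
  angle, so `g = ∂F/∂t` with `F` of compact support in the chart. The difference quotients of `F`
  converge to `g` in the topology of the test densities, and `v` vanishes on them because
  translates of `F` are rotations of `F` (`IsFibreChart.apply_eq_zero`).
* Continuity is preserved in both directions, because integration over the angle and multiplication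
  by `χ` are continuous for the `C^N` norms. It suffices to check the estimates in adapted charts,
  since continuity of a functional can be tested in charts that cover the manifold
  (`mem_distributions_of_cover`).

Test densities are complex measures here. The measure `g(y) dy` in a chart `e` is `ofChart I e g`,
and a test density supported in the domain of `e` is of that form (`exists_eq_ofChart`). Partitions
of unity act on densities through `weight φ μ`, the product of a function and a measure.
-/

open scoped Manifold ContDiff TensorProduct
namespace CircleDist
open Set MeasureTheory Bundle
noncomputable section
set_option linter.unusedSectionVars false

/-! ### Multiplying a complex measure by a bounded continuous function -/

section Weight

theorem integrable_simpleFunc_comp_smul {Ω : Type*} [MeasurableSpace Ω] {m : Measure Ω} {h : Ω → ℂ}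
    {φ : Ω → ℝ} (s : SimpleFunc ℝ ℝ) (hi : Integrable h m) (hm : Measurable φ) :
    Integrable (fun x => s (φ x) • h x) m := by
  obtain ⟨D, hD⟩ := s.exists_forall_norm_le
  exact hi.bdd_smul D ((s.measurable.comp hm).aestronglyMeasurable)
    (Filter.Eventually.of_forall fun x => hD _)

/-- Dominated convergence for the approximation of a bounded function by simple functions. -/
theorem tendsto_integral_approxBounded_smul {Ω : Type*} [MeasurableSpace Ω] {m : Measure Ω}
    {h : Ω → ℂ} {φ : Ω → ℝ} (hid : StronglyMeasurable (id : ℝ → ℝ)) (hi : Integrable h m)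
    (hm : Measurable φ) {C : ℝ} (hC : ∀ x, ‖φ x‖ ≤ C) :
    Filter.Tendsto (fun n => ∫ x, hid.approxBounded C n (φ x) • h x ∂m) Filter.atTop
      (nhds (∫ x, φ x • h x ∂m)) := by
  refine tendsto_integral_of_dominated_convergence (fun x => C * ‖h x‖)
    (fun n => (integrable_simpleFunc_comp_smul _ hi hm).aestronglyMeasurable)
    (hi.norm.const_mul C) (fun n => ?_) ?_
  · refine Filter.Eventually.of_forall fun x => ?_
    rw [norm_smul]
    exact mul_le_mul_of_nonneg_right
      (hid.norm_approxBounded_le ((norm_nonneg _).trans (hC x)) n _) (norm_nonneg _)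
  · refine Filter.Eventually.of_forall fun x => ?_
    exact (hid.tendsto_approxBounded_of_norm_le (hC x)).smul_const _

theorem integral_piecewise_comp_smul {Ω : Type*} [MeasurableSpace Ω] {m : Measure Ω} {h : Ω → ℂ}
    {φ : Ω → ℝ} (hm : Measurable φ) {B : Set ℝ} (hB : MeasurableSet B) (c : ℝ) :
    ∫ x, (SimpleFunc.piecewise B hB (SimpleFunc.const ℝ c) (SimpleFunc.const ℝ 0)) (φ x) • h x ∂m
      = c • ∫ x in φ ⁻¹' B, h x ∂m := by
  rw [← integral_smul, ← integral_indicator (hm hB)]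
  refine integral_congr_ae (Filter.Eventually.of_forall fun x => ?_)
  by_cases hx : φ x ∈ B
  · simp [hx]
  · simp [hx]

/-- The integral of a bounded function against a complex measure only depends on the image of the
measure under the function: if the images of `h₁ m₁` under `φ₁` and of `h₂ m₂` under `φ₂` are the
same complex measure on the line then `∫ φ₁ h₁ dm₁ = ∫ φ₂ h₂ dm₂`. -/
theorem integral_smul_eq_of_setIntegral_eq {Ω₁ Ω₂ : Type*} [MeasurableSpace Ω₁]
    [MeasurableSpace Ω₂] {m₁ : Measure Ω₁} {m₂ : Measure Ω₂} {h₁ : Ω₁ → ℂ} {h₂ : Ω₂ → ℂ}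
    (hi₁ : Integrable h₁ m₁) (hi₂ : Integrable h₂ m₂) {φ₁ : Ω₁ → ℝ} {φ₂ : Ω₂ → ℝ}
    (hm₁ : Measurable φ₁) (hm₂ : Measurable φ₂) {C : ℝ} (hC₁ : ∀ x, ‖φ₁ x‖ ≤ C)
    (hC₂ : ∀ x, ‖φ₂ x‖ ≤ C)
    (h : ∀ B : Set ℝ, MeasurableSet B →
      ∫ x in φ₁ ⁻¹' B, h₁ x ∂m₁ = ∫ x in φ₂ ⁻¹' B, h₂ x ∂m₂) :
    ∫ x, φ₁ x • h₁ x ∂m₁ = ∫ x, φ₂ x • h₂ x ∂m₂ := by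
  have simple : ∀ s : SimpleFunc ℝ ℝ,
      ∫ x, s (φ₁ x) • h₁ x ∂m₁ = ∫ x, s (φ₂ x) • h₂ x ∂m₂ := by
    intro s
    induction s using SimpleFunc.induction with
    | const c hs =>
      rw [integral_piecewise_comp_smul hm₁, integral_piecewise_comp_smul hm₂, h _ hs]
    | add hd hf hg =>
      simp only [SimpleFunc.coe_add, Pi.add_apply, add_smul]
      rw [integral_add (integrable_simpleFunc_comp_smul _ hi₁ hm₁)
        (integrable_simpleFunc_comp_smul _ hi₁ hm₁),
        integral_add (integrable_simpleFunc_comp_smul _ hi₂ hm₂)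
        (integrable_simpleFunc_comp_smul _ hi₂ hm₂), hf, hg]
  have hid : StronglyMeasurable (id : ℝ → ℝ) := stronglyMeasurable_id
  refine tendsto_nhds_unique (tendsto_integral_approxBounded_smul hid hi₁ hm₁ hC₁) ?_
  simp_rw [simple]
  exact tendsto_integral_approxBounded_smul hid hi₂ hm₂ hC₂

/-- Every complex measure has an integrable density with respect to a finite positive measure. -/
theorem exists_withDensityᵥ_eq {Ω : Type*} [MeasurableSpace Ω] (μ : VectorMeasure Ω ℂ) :
    ∃ (m : Measure Ω) (h : Ω → ℂ), Integrable h m ∧ m.withDensityᵥ h = μ := by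
  let s : SignedMeasure Ω := ComplexMeasure.re μ
  let t : SignedMeasure Ω := ComplexMeasure.im μ
  let m : Measure Ω := s.totalVariation + t.totalVariation
  have hfin : ∀ s : SignedMeasure Ω, IsFiniteMeasure s.totalVariation := fun s => by
    unfold SignedMeasure.totalVariation; infer_instance
  have := hfin s
  have := hfin t
  have hs : s ≪ᵥ m.toENNRealVectorMeasure := by
    rw [SignedMeasure.absolutelyContinuous_ennreal_iff,
      VectorMeasure.ennrealToMeasure_toENNRealVectorMeasure]
    exact Measure.AbsolutelyContinuous.rfl.add_right _
  have ht : t ≪ᵥ m.toENNRealVectorMeasure := by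
    rw [SignedMeasure.absolutelyContinuous_ennreal_iff,
      VectorMeasure.ennrealToMeasure_toENNRealVectorMeasure]
    exact (Measure.AbsolutelyContinuous.rfl (μ := t.totalVariation)).trans
      (Measure.absolutelyContinuous_of_le (Measure.le_add_left le_rfl))
  have hs' := SignedMeasure.withDensityᵥ_rnDeriv_eq s m hs
  have ht' := SignedMeasure.withDensityᵥ_rnDeriv_eq t m ht
  have is := SignedMeasure.integrable_rnDeriv s m
  have it := SignedMeasure.integrable_rnDeriv t m
  refine ⟨m, fun x => (s.rnDeriv m x : ℂ) + (t.rnDeriv m x : ℂ) * Complex.I,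
    is.ofReal.add (it.ofReal.mul_const _), ?_⟩
  ext A hA
  rw [withDensityᵥ_apply (is.ofReal.add (it.ofReal.mul_const _)) hA]
  have i1 : Integrable (fun x => (s.rnDeriv m x : ℂ)) (m.restrict A) := is.ofReal.integrableOn
  have i2 : Integrable (fun x => (t.rnDeriv m x : ℂ) * Complex.I) (m.restrict A) :=
    (it.ofReal.mul_const _).integrableOn
  rw [integral_add i1 i2, integral_mul_const, integral_complex_ofReal, integral_complex_ofReal,
    ← withDensityᵥ_apply is hA,
    ← withDensityᵥ_apply it hA, hs', ht']
  exact Complex.re_add_im (μ A)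

variable {X : Type*} [TopologicalSpace X]

/-- A positive measure with respect to which the complex measure `μ` has an integrable density. -/
def baseMeasure (μ : BorelMeasure X) : @Measure X (borel X) :=
  (@exists_withDensityᵥ_eq X (borel X) μ).choose

/-- The density of `μ` with respect to `baseMeasure μ`. -/
def baseDensity (μ : BorelMeasure X) : X → ℂ :=
  (@exists_withDensityᵥ_eq X (borel X) μ).choose_spec.choose

theorem integrable_baseDensity (μ : BorelMeasure X) : Integrable (baseDensity μ) (baseMeasure μ) :=
  (@exists_withDensityᵥ_eq X (borel X) μ).choose_spec.choose_spec.1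

theorem setIntegral_baseDensity (μ : BorelMeasure X) {A : Set X} (hA : MeasurableSet[borel X] A) :
    ∫ x in A, baseDensity μ x ∂(baseMeasure μ) = μ A := by
  let : MeasurableSpace X := borel X
  have h := (@exists_withDensityᵥ_eq X (borel X) μ).choose_spec.choose_spec.2
  rw [← withDensityᵥ_apply (integrable_baseDensity μ) hA]
  exact congrArg (fun ν : BorelMeasure X => ν A) h

/-- The product `φ μ` of a function and a complex measure, formed with a density of `μ` with
respect to a positive measure. It is `0` if `φ` times that density is not integrable; for bounded
continuous functions `φ`, the only ones that matter here, it is integrable and the result does not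
depend on the choices. -/
def weight (φ : X → ℝ) (μ : BorelMeasure X) : BorelMeasure X :=
  @Measure.withDensityᵥ X ℂ _ _ (borel X) (baseMeasure μ) fun x => φ x • baseDensity μ x

theorem integrable_smul_baseDensity {φ : X → ℝ} (hφ : Continuous φ) {C : ℝ}
    (hC : ∀ x, ‖φ x‖ ≤ C) (μ : BorelMeasure X) :
    Integrable (fun x => φ x • baseDensity μ x) (baseMeasure μ) := by
  let : MeasurableSpace X := borel X
  have : BorelSpace X := ⟨rfl⟩
  exact (integrable_baseDensity μ).bdd_smul C hφ.measurable.aestronglyMeasurable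
    (Filter.Eventually.of_forall hC)

theorem weight_apply {φ : X → ℝ} (hφ : Continuous φ) {C : ℝ} (hC : ∀ x, ‖φ x‖ ≤ C)
    (μ : BorelMeasure X) {A : Set X} (hA : MeasurableSet[borel X] A) :
    weight φ μ A = ∫ x in A, φ x • baseDensity μ x ∂(baseMeasure μ) :=
  @withDensityᵥ_apply X (borel X) (baseMeasure μ) ℂ _ _ _
    (integrable_smul_baseDensity hφ hC μ) A hA

/-- `φ μ` can be computed on `A` from any measure `h m` that has the same image under `ψ` as the
restriction of `μ` to `A` has under `φ`. In particular it does not depend on `baseMeasure μ`. -/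
theorem weight_apply_eq_integral {φ : X → ℝ} (hφ : Continuous φ) {C : ℝ} (hC : ∀ x, ‖φ x‖ ≤ C)
    (μ : BorelMeasure X) {A : Set X} (hA : MeasurableSet[borel X] A)
    {Ω : Type*} [MeasurableSpace Ω] {m : Measure Ω} {h : Ω → ℂ} (hi : Integrable h m)
    {ψ : Ω → ℝ} (hψ : Measurable ψ) (hC' : ∀ y, ‖ψ y‖ ≤ C)
    (H : ∀ B : Set ℝ, MeasurableSet B → μ (φ ⁻¹' B ∩ A) = ∫ y in ψ ⁻¹' B, h y ∂m) :
    weight φ μ A = ∫ y, ψ y • h y ∂m := by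
  let : MeasurableSpace X := borel X
  have : BorelSpace X := ⟨rfl⟩
  rw [weight_apply hφ hC μ hA]
  refine integral_smul_eq_of_setIntegral_eq (integrable_baseDensity μ).integrableOn hi
    hφ.measurable hψ hC hC' fun B hB => ?_
  rw [← H B hB, Measure.restrict_restrict (hφ.measurable hB)]
  exact setIntegral_baseDensity μ ((hφ.measurable hB).inter hA)

/-- `φ μ` vanishes on the preimage of a set if `μ` vanishes on the preimages of all its subsets and
`φ` is constant along the fibres. -/
theorem weight_comp_preimage_eq_zero {Y : Type*} [TopologicalSpace Y] {f : X → Y}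
    (hf : Continuous f) {φ : Y → ℝ} (hφ : Continuous φ) {C : ℝ} (hC : ∀ y, ‖φ y‖ ≤ C)
    {μ : BorelMeasure X} {A : Set Y} (hA : MeasurableSet[borel Y] A)
    (H : ∀ B : Set Y, MeasurableSet[borel Y] B → B ⊆ A → μ (f ⁻¹' B) = 0) :
    weight (φ ∘ f) μ (f ⁻¹' A) = 0 := by
  let : MeasurableSpace X := borel X
  have : BorelSpace X := ⟨rfl⟩
  let : MeasurableSpace Y := borel Y
  have : BorelSpace Y := ⟨rfl⟩
  have hA' : MeasurableSet (f ⁻¹' A) := hf.measurable hA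
  refine (weight_apply_eq_integral (hφ.comp hf) (C := C) (fun x => hC (f x)) μ hA'
    (Ω := X) (m := baseMeasure μ) (h := 0) (integrable_zero _ _ _) (hφ.comp hf).measurable
    (fun x => hC (f x)) fun B hB => ?_).trans (by simp)
  have := H (φ ⁻¹' B ∩ A) ((hφ.measurable hB).inter hA) inter_subset_right
  simpa [preimage_comp] using this

theorem weight_eq_zero_of_disjoint {φ : X → ℝ} (hφ : Continuous φ) {C : ℝ} (hC : ∀ x, ‖φ x‖ ≤ C)
    {μ : BorelMeasure X} {K : Set X}
    (hK : ∀ A : Set X, MeasurableSet[borel X] A → Disjoint A K → μ A = 0)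
    {A : Set X} (hA : MeasurableSet[borel X] A) (hd : Disjoint A K) : weight φ μ A = 0 :=
  weight_comp_preimage_eq_zero continuous_id hφ hC hA fun B hB hBA => hK B hB (hd.mono_left hBA)

theorem weight_eq_zero_of_disjoint_support {φ : X → ℝ} (hφ : Continuous φ) {C : ℝ}
    (hC : ∀ x, ‖φ x‖ ≤ C) {μ : BorelMeasure X}
    {A : Set X} (hA : MeasurableSet[borel X] A) (hd : Disjoint A (tsupport φ)) :
    weight φ μ A = 0 := by
  let : MeasurableSpace X := borel X
  rw [weight_apply hφ hC μ hA, setIntegral_eq_zero_of_forall_eq_zero]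
  intro x hx
  rw [image_eq_zero_of_notMem_tsupport (disjoint_left.1 hd hx), zero_smul]

theorem weight_finset_sum {ι : Type*} (s : Finset ι) {φ : ι → X → ℝ}
    (hφ : ∀ i, Continuous (φ i)) {C : ℝ} (hC : ∀ i x, ‖φ i x‖ ≤ C) (hC' : ∀ x, ‖∑ i ∈ s, φ i x‖ ≤ C)
    (μ : BorelMeasure X) :
    weight (fun x => ∑ i ∈ s, φ i x) μ = ∑ i ∈ s, weight (φ i) μ := by
  let : MeasurableSpace X := borel X
  ext A hA
  rw [weight_apply (continuous_finsetSum s fun i _ => hφ i) hC' μ hA]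
  simp only [Finset.sum_smul]
  rw [integral_finsetSum _ fun i _ => (integrable_smul_baseDensity (hφ i) (hC i) μ).integrableOn]
  have : (∑ i ∈ s, weight (φ i) μ) A = ∑ i ∈ s, weight (φ i) μ A := by
    simp
  rw [this]
  exact Finset.sum_congr rfl fun i _ => (weight_apply (hφ i) (hC i) μ hA).symm

/-- A weight which is `1` on the support of a measure does not change it. -/
theorem weight_eq_self {φ : X → ℝ} (hφ : Continuous φ) {C : ℝ} (hC : ∀ x, ‖φ x‖ ≤ C)
    {μ : BorelMeasure X} {K : Set X} (hKc : IsClosed K)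
    (hK : ∀ A : Set X, MeasurableSet[borel X] A → Disjoint A K → μ A = 0)
    (h1 : ∀ x ∈ K, φ x = 1) : weight φ μ = μ := by
  let : MeasurableSpace X := borel X
  have : BorelSpace X := ⟨rfl⟩
  ext A hA
  have hKm : MeasurableSet K := hKc.measurableSet
  rw [← VectorMeasure.of_add_of_sdiff (v := weight φ μ) (hA.inter hKm) hA inter_subset_left,
    ← VectorMeasure.of_add_of_sdiff (v := μ) (hA.inter hKm) hA inter_subset_left]
  have hd : Disjoint (A \ (A ∩ K)) K := by
    rw [sdiff_self_inter]; exact disjoint_sdiff_left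
  rw [weight_eq_zero_of_disjoint hφ hC hK (hA.diff (hA.inter hKm)) hd,
    hK _ (hA.diff (hA.inter hKm)) hd, weight_apply hφ hC μ (hA.inter hKm),
    ← setIntegral_baseDensity μ (hA.inter hKm)]
  congr 1
  refine setIntegral_congr_fun (hA.inter hKm) fun x hx => ?_
  simp [h1 x hx.2]

end Weight

/-! ### Measures with a smooth density in a chart -/

/-- The determinant is a polynomial in the matrix entries. -/
theorem contDiff_det {E : Type*} [NormedAddCommGroup E] [NormedSpace ℝ E] [FiniteDimensional ℝ E]
    {n : ℕ∞ω} : ContDiff ℝ n (fun f : E →L[ℝ] E => f.det) := by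
  let b := Module.finBasis ℝ E
  have h : (fun f : E →L[ℝ] E => f.det) = fun f => ∑ σ : Equiv.Perm (Fin (Module.finrank ℝ E)),
      Equiv.Perm.sign σ • ∏ i, b.coord (σ i) (f (b i)) := by
    ext f
    rw [ContinuousLinearMap.det, ← LinearMap.det_toMatrix b, Matrix.det_apply]
    simp [LinearMap.toMatrix_apply]
  rw [h]
  refine ContDiff.sum fun σ _ => ContDiff.const_smul _ (contDiff_prod fun i _ => ?_)
  exact (LinearMap.toContinuousLinearMap (b.coord (σ i))).contDiff.comp
    (contDiff_id.clm_apply contDiff_const)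

theorem measurableSet_inter_preimage_of_continuousOn {α β : Type*} [TopologicalSpace α]
    [MeasurableSpace α] [OpensMeasurableSpace α] [TopologicalSpace β] {f : α → β} {s : Set α}
    (hs : MeasurableSet s) (hf : ContinuousOn f s) {A : Set β} (hA : MeasurableSet[borel β] A) :
    MeasurableSet (s ∩ f ⁻¹' A) := by
  let : MeasurableSpace β := borel β
  have : BorelSpace β := ⟨rfl⟩
  rw [← Subtype.image_preimage_coe]
  exact hs.subtype_image ((continuousOn_iff_continuous_domRestrict.1 hf).measurable hA)

section Charts

variable {E : Type*} [NormedAddCommGroup E] [NormedSpace ℝ E] [FiniteDimensional ℝ E]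
  [MeasureSpace E] [BorelSpace E] [(volume : Measure E).IsAddHaarMeasure]
  {H : Type*} [TopologicalSpace H] (I : ModelWithCorners ℝ E H) [I.Boundaryless]
  {X : Type*} [TopologicalSpace X]

omit [FiniteDimensional ℝ E] [MeasureSpace E] [BorelSpace E]
  [(volume : Measure E).IsAddHaarMeasure] [I.Boundaryless] in
theorem image_extend_eq (e : OpenPartialHomeomorph X H) {A : Set X} (hA : A ⊆ e.source) :
    e.extend I '' A = (e.extend I).target ∩ (e.extend I).symm ⁻¹' A :=
  (e.extend I).image_eq_target_inter_inv_preimage (by rwa [e.extend_source])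

theorem measurableSet_target_inter (e : OpenPartialHomeomorph X H) {A : Set X}
    (hA : MeasurableSet[borel X] A) :
    MeasurableSet ((e.extend I).target ∩ (e.extend I).symm ⁻¹' A) :=
  measurableSet_inter_preimage_of_continuousOn (e.isOpen_extend_target).measurableSet
    e.continuousOn_extend_symm hA

theorem measurableSet_image_extend (e : OpenPartialHomeomorph X H) {A : Set X}
    (hA : MeasurableSet[borel X] A) (hs : A ⊆ e.source) : MeasurableSet (e.extend I '' A) := by
  rw [image_extend_eq I e hs]
  exact measurableSet_target_inter I e hA

theorem measurableSet_source_inter (e : OpenPartialHomeomorph X H) {B : Set E}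
    (hB : MeasurableSet B) : MeasurableSet[borel X] (e.source ∩ e.extend I ⁻¹' B) := by
  let : MeasurableSpace X := borel X
  have : BorelSpace X := ⟨rfl⟩
  refine measurableSet_inter_preimage_of_continuousOn e.open_source.measurableSet ?_ ?_
  · simpa using e.continuousOn_extend (I := I)
  · rwa [← BorelSpace.measurable_eq (α := E)]

theorem image_source_inter_eq (e : OpenPartialHomeomorph X H) {B : Set E}
    (hB : B ⊆ (e.extend I).target) : e.extend I '' (e.source ∩ e.extend I ⁻¹' B) = B := by
  ext y
  constructor
  · rintro ⟨x, hx, rfl⟩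
    exact hx.2
  · intro hy
    refine ⟨(e.extend I).symm y, ⟨?_, ?_⟩, (e.extend I).right_inv (hB hy)⟩
    · simpa using (e.extend I).map_target (hB hy)
    · rwa [mem_preimage, (e.extend I).right_inv (hB hy)]

open scoped Classical in
/-- The measure on `X` which is `g(y) dy` in the chart `e` and vanishes off the domain of `e`. It is
`0` if `g` is not integrable over the image of the chart. -/
def ofChart (e : OpenPartialHomeomorph X H) (g : E → ℂ) : BorelMeasure X :=
  letI : MeasurableSpace X := borel X
  if h : IntegrableOn g (e.extend I).target then
    { measureOf' A := if MeasurableSet[borel X] A then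
        ∫ y in (e.extend I).target ∩ (e.extend I).symm ⁻¹' A, g y else 0
      empty' := by simp
      not_measurable' A hA := if_neg hA
      m_iUnion' A hA hd := by
        have hU : MeasurableSet (⋃ i, A i) := MeasurableSet.iUnion hA
        simp only [hA, hU, if_true]
        rw [preimage_iUnion, inter_iUnion]
        refine hasSum_integral_iUnion (fun i => measurableSet_target_inter I e (hA i)) ?_
          (h.mono_set (iUnion_subset fun i => inter_subset_left))
        intro i j hij
        exact ((hd hij).preimage _).mono inter_subset_right inter_subset_right }
  else 0

variable {I}

theorem ofChart_apply {e : OpenPartialHomeomorph X H} {g : E → ℂ}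
    (hg : IntegrableOn g (e.extend I).target) {A : Set X} (hA : MeasurableSet[borel X] A) :
    ofChart I e g A = ∫ y in (e.extend I).target ∩ (e.extend I).symm ⁻¹' A, g y := by
  rw [ofChart, dif_pos hg]
  exact if_pos hA

theorem hasChartDensity_ofChart {e : OpenPartialHomeomorph X H} {g : E → ℂ}
    (hg : IntegrableOn g (e.extend I).target) : HasChartDensity I e (ofChart I e g) g :=
  ⟨hg, fun A hA hs => by rw [ofChart_apply hg hA, image_extend_eq I e hs]⟩

theorem ofChart_apply_eq_zero {e : OpenPartialHomeomorph X H} {g : E → ℂ}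
    (hg : IntegrableOn g (e.extend I).target) {A : Set X} (hA : MeasurableSet[borel X] A)
    (h : ∀ y ∈ (e.extend I).target, (e.extend I).symm y ∈ A → g y = 0) :
    ofChart I e g A = 0 := by
  rw [ofChart_apply hg hA]
  exact setIntegral_eq_zero_of_forall_eq_zero fun y hy => h y hy.1 hy.2

/-- A measure that vanishes off the domain of a chart is determined by its density there. -/
theorem ofChart_eq_of_hasChartDensity {e : OpenPartialHomeomorph X H} {g : E → ℂ}
    {μ : BorelMeasure X} (h : HasChartDensity I e μ g)
    (h0 : ∀ A : Set X, MeasurableSet[borel X] A → Disjoint A e.source → μ A = 0) :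
    μ = ofChart I e g := by
  let : MeasurableSpace X := borel X
  have : BorelSpace X := ⟨rfl⟩
  ext A hA
  have hs : MeasurableSet e.source := e.open_source.measurableSet
  rw [← VectorMeasure.of_add_of_sdiff (v := μ) (hA.inter hs) hA inter_subset_left,
    h0 (A \ (A ∩ e.source)) (hA.diff (hA.inter hs))
      (by rw [sdiff_self_inter]; exact disjoint_sdiff_left), add_zero,
    h.2 _ (hA.inter hs) inter_subset_right, image_extend_eq I e inter_subset_right,
    ofChart_apply h.1 hA]
  congr 2
  ext y
  refine and_congr_right fun hy => and_iff_left ?_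
  simpa using (e.extend I).map_target hy

theorem ofChart_congr {e : OpenPartialHomeomorph X H} {g g' : E → ℂ}
    (h : EqOn g g' (e.extend I).target) : ofChart I e g = ofChart I e g' := by
  have ht := (e.isOpen_extend_target (I := I)).measurableSet
  by_cases hg : IntegrableOn g (e.extend I).target
  · have hg' : IntegrableOn g' (e.extend I).target := hg.congr_fun h ht
    ext A hA
    rw [ofChart_apply hg hA, ofChart_apply hg' hA]
    exact setIntegral_congr_fun (measurableSet_target_inter I e hA) fun y hy => h hy.1
  · have hg' : ¬ IntegrableOn g' (e.extend I).target := fun h' => hg (h'.congr_fun h.symm ht)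
    rw [ofChart, ofChart, dif_neg hg, dif_neg hg']

theorem ofChart_add {e : OpenPartialHomeomorph X H} {g g' : E → ℂ}
    (hg : IntegrableOn g (e.extend I).target) (hg' : IntegrableOn g' (e.extend I).target) :
    ofChart I e (g + g') = ofChart I e g + ofChart I e g' := by
  ext A hA
  have := ofChart_apply (I := I) (hg.add hg') hA
  rw [this]
  change _ = ofChart I e g A + ofChart I e g' A
  rw [ofChart_apply hg hA, ofChart_apply hg' hA]
  exact integral_add (hg.mono_set inter_subset_left) (hg'.mono_set inter_subset_left)

theorem ofChart_zero (e : OpenPartialHomeomorph X H) : ofChart I e (0 : E → ℂ) = 0 := by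
  ext A hA
  have := ofChart_apply (I := I) (e := e) (g := 0) integrableOn_zero hA
  rw [this]
  simp

theorem ofChart_smul {e : OpenPartialHomeomorph X H} {g : E → ℂ} (c : ℂ)
    (hg : IntegrableOn g (e.extend I).target) :
    ofChart I e (c • g) = c • ofChart I e g := by
  ext A hA
  have := ofChart_apply (I := I) (hg.smul c) hA
  rw [this]
  change _ = c • ofChart I e g A
  rw [ofChart_apply hg hA]
  exact integral_smul c g

theorem ofChart_sum {e : OpenPartialHomeomorph X H} {ι : Type*} (s : Finset ι) {g : ι → E → ℂ}
    (hg : ∀ i, IntegrableOn (g i) (e.extend I).target) :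
    ofChart I e (∑ i ∈ s, g i) = ∑ i ∈ s, ofChart I e (g i) := by
  classical
  induction s using Finset.induction_on with
  | empty => simp [ofChart_zero]
  | insert i s hi ih =>
    rw [Finset.sum_insert hi, Finset.sum_insert hi, ofChart_add (hg i), ih]
    exact integrable_finsetSum' s fun j _ => hg j

/-- A continuous function on an open set vanishes if its integrals over all measurable subsets
do. -/
theorem eqOn_zero_of_setIntegral_eq_zero {U : Set E} (hU : IsOpen U) {g : E → ℂ}
    (hg : ContinuousOn g U) (hi : IntegrableOn g U)
    (h : ∀ B : Set E, MeasurableSet B → B ⊆ U → ∫ y in B, g y = 0) : EqOn g 0 U := by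
  refine Measure.eqOn_open_of_ae_eq (μ := volume) ?_ hU hg continuousOn_const
  refine Integrable.ae_eq_zero_of_forall_setIntegral_eq_zero hi fun B hB _ => ?_
  rw [Measure.restrict_restrict hB]
  exact h _ (hB.inter hU.measurableSet) inter_subset_right

/-- The continuous density of a measure vanishes over the open sets on which the measure
vanishes. -/
theorem HasChartDensity.eqOn_zero {e : OpenPartialHomeomorph X H} {g : E → ℂ} {μ : BorelMeasure X}
    (h : HasChartDensity I e μ g) {W : Set X} (hW : IsOpen W)
    (hg : ContinuousOn g (e.extend I).target)
    (h0 : ∀ A : Set X, MeasurableSet[borel X] A → A ⊆ W → μ A = 0) :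
    EqOn g 0 ((e.extend I).target ∩ (e.extend I).symm ⁻¹' W) := by
  refine eqOn_zero_of_setIntegral_eq_zero
    (e.continuousOn_extend_symm.isOpen_inter_preimage e.isOpen_extend_target hW)
    (hg.mono inter_subset_left) (h.1.mono_set inter_subset_left) fun B hB hBs => ?_
  have hBt : B ⊆ (e.extend I).target := fun y hy => (hBs hy).1
  have := h.2 _ (measurableSet_source_inter I e hB) inter_subset_left
  rw [image_source_inter_eq I e hBt] at this
  rw [← this]
  refine h0 _ (measurableSet_source_inter I e hB) fun x hx => ?_
  have hx' := (hBs hx.2).2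
  rwa [mem_preimage, (e.extend I).left_inv (by rw [e.extend_source]; exact hx.1)] at hx'

theorem ofChart_eq_zero_iff {e : OpenPartialHomeomorph X H} {g : E → ℂ}
    (hg : ContinuousOn g (e.extend I).target) (hi : IntegrableOn g (e.extend I).target)
    (h : ofChart I e g = 0) : EqOn g 0 (e.extend I).target := by
  have := (hasChartDensity_ofChart hi).eqOn_zero isOpen_univ hg fun A _ _ => by rw [h]; rfl
  simpa using this

end Charts

/-! ### Change of charts -/

section ChangeOfCharts

variable {E : Type*} [NormedAddCommGroup E] [NormedSpace ℝ E] [FiniteDimensional ℝ E]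
  [MeasureSpace E] [BorelSpace E] [(volume : Measure E).IsAddHaarMeasure]
  {H : Type*} [TopologicalSpace H] (I : ModelWithCorners ℝ E H) [I.Boundaryless]
  {X : Type*} [TopologicalSpace X]

/-- The image in the chart `e'` of the overlap of the domains of the charts `e` and `e'`. -/
abbrev overlap (e e' : OpenPartialHomeomorph X H) : Set E := (I.extendCoordChange e' e).source

theorem mem_overlap {e e' : OpenPartialHomeomorph X H} {y : E} :
    y ∈ overlap I e e' ↔ y ∈ (e'.extend I).target ∧ (e'.extend I).symm y ∈ e.source := by
  rw [overlap, PartialEquiv.trans_source, PartialEquiv.symm_source, mem_inter_iff, mem_preimage,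
    e.extend_source]

theorem isOpen_overlap (e e' : OpenPartialHomeomorph X H) : IsOpen (overlap I e e') := by
  have := (e'.continuousOn_extend_symm (I := I)).isOpen_inter_preimage e'.isOpen_extend_target
    e.open_source
  convert! this using 1
  ext y
  exact mem_overlap I

/-- The absolute value of the Jacobian determinant of the change of coordinates from `e'` to `e`. -/
def jacobian (e e' : OpenPartialHomeomorph X H) (y : E) : ℝ :=
  |(fderivWithin ℝ (I.extendCoordChange e' e) (overlap I e e') y).det|

/-- The density in the chart `e'` of the measure with density `g` in the chart `e`, extended by zero
from the overlap of the charts. -/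
def transfer (e e' : OpenPartialHomeomorph X H) (g : E → ℂ) : E → ℂ :=
  indicator (overlap I e e') fun y => jacobian I e e' y • g (I.extendCoordChange e' e y)

variable {I} [ChartedSpace H X]

/-- The Jacobian determinant of a diffeomorphism has no zeros, so its absolute value is smooth. -/
theorem contDiffOn_jacobian {e e' : OpenPartialHomeomorph X H}
    (he : e ∈ IsManifold.maximalAtlas I ∞ X) (he' : e' ∈ IsManifold.maximalAtlas I ∞ X) :
    ContDiffOn ℝ ∞ (jacobian I e e') (overlap I e e') := by
  intro y hy
  have h1 : ContDiffOn ℝ ∞ (fderivWithin ℝ (I.extendCoordChange e' e) (overlap I e e'))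
      (overlap I e e') :=
    (I.contDiffOn_extendCoordChange he' he).fderivWithin I.uniqueDiffOn_extendCoordChange_source
      (by simp)
  have h2 : ContDiffWithinAt ℝ ∞
      (fun y => (fderivWithin ℝ (I.extendCoordChange e' e) (overlap I e e') y).det)
      (overlap I e e') y := contDiff_det.contDiffAt.comp_contDiffWithinAt y (h1 y hy)
  refine ContDiffAt.comp_contDiffWithinAt y (contDiffAt_abs ?_) h2
  obtain ⟨A, hA⟩ := I.isInvertible_fderivWithin_extendCoordChange (n := ∞) (by simp) he' he hy
  rw [← hA]
  exact A.toLinearEquiv.isUnit_det'.ne_zero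

theorem contDiffOn_transfer {e e' : OpenPartialHomeomorph X H}
    (he : e ∈ IsManifold.maximalAtlas I ∞ X) (he' : e' ∈ IsManifold.maximalAtlas I ∞ X)
    {g : E → ℂ} (hg : ContDiffOn ℝ ∞ g (e.extend I).target) :
    ContDiffOn ℝ ∞ (transfer I e e' g) (overlap I e e') := by
  refine ((contDiffOn_jacobian he he').smul
    (hg.comp (I.contDiffOn_extendCoordChange he' he) fun y hy => ?_)).congr
      fun y hy => indicator_of_mem hy _
  exact (e.extend I).map_source hy.2

theorem extend_symm_extendCoordChange {e e' : OpenPartialHomeomorph X H} {y : E}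
    (hy : y ∈ overlap I e e') :
    (e.extend I).symm (I.extendCoordChange e' e y) = (e'.extend I).symm y :=
  (e.extend I).left_inv hy.2

theorem image_extendCoordChange {e e' : OpenPartialHomeomorph X H} {A : Set X}
    (hA' : A ⊆ e'.source) :
    I.extendCoordChange e' e '' (e'.extend I '' A) = e.extend I '' A := by
  rw [image_image]
  refine image_congr fun x hx => ?_
  change e.extend I ((e'.extend I).symm (e'.extend I x)) = _
  rw [(e'.extend I).left_inv (by rw [e'.extend_source]; exact hA' hx)]

/-- The change of variables formula. -/
theorem setIntegral_image_extend {e e' : OpenPartialHomeomorph X H}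
    (he : e ∈ IsManifold.maximalAtlas I ∞ X) (he' : e' ∈ IsManifold.maximalAtlas I ∞ X)
    {A : Set X} (hA : A ⊆ e.source) (hA' : A ⊆ e'.source) (hm : MeasurableSet[borel X] A)
    (g : E → ℂ) :
    ∫ y in e.extend I '' A, g y =
      ∫ y in e'.extend I '' A, jacobian I e e' y • g (I.extendCoordChange e' e y) := by
  have hsub : e'.extend I '' A ⊆ overlap I e e' := by
    rintro _ ⟨x, hx, rfl⟩
    rw [mem_overlap, (e'.extend I).left_inv (by rw [e'.extend_source]; exact hA' hx)]
    exact ⟨(e'.extend I).map_source (by rw [e'.extend_source]; exact hA' hx), hA hx⟩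
  rw [← image_extendCoordChange hA']
  refine integral_image_eq_integral_abs_det_fderiv_smul volume
    (measurableSet_image_extend I e' hm hA')
    (f' := fderivWithin ℝ (I.extendCoordChange e' e) (overlap I e e')) (fun y hy => ?_)
    ((I.extendCoordChange e' e).injOn.mono hsub) g
  exact (((I.contDiffOn_extendCoordChange he' he).differentiableOn (by simp) y
    (hsub hy)).hasFDerivWithinAt).mono hsub

theorem hasChartDensity_transfer {e e' : OpenPartialHomeomorph X H}
    (he : e ∈ IsManifold.maximalAtlas I ∞ X) (he' : e' ∈ IsManifold.maximalAtlas I ∞ X)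
    {g : E → ℂ} (hg : IntegrableOn g (e.extend I).target) :
    HasChartDensity I e' (ofChart I e g) (transfer I e e' g) := by
  have hov := (isOpen_overlap I e e').measurableSet
  constructor
  · refine IntegrableOn.mono_set ?_ (subset_univ _)
    rw [integrableOn_univ, transfer, integrable_indicator_iff hov]
    refine (integrableOn_image_iff_integrableOn_abs_det_fderiv_smul volume hov
      (f' := fderivWithin ℝ (I.extendCoordChange e' e) (overlap I e e')) (fun y hy => ?_)
      (I.extendCoordChange e' e).injOn g).1 (hg.mono_set ?_)
    · exact ((I.contDiffOn_extendCoordChange he' he).differentiableOn (by simp) y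
        hy).hasFDerivWithinAt
    · rintro _ ⟨y, hy, rfl⟩
      exact (e.extend I).map_source hy.2
  · intro A hA hs
    let : MeasurableSpace X := borel X
    have : BorelSpace X := ⟨rfl⟩
    have hm : MeasurableSet (A ∩ e.source) := hA.inter e.open_source.measurableSet
    have h1 : (e.extend I).target ∩ (e.extend I).symm ⁻¹' A = e.extend I '' (A ∩ e.source) := by
      rw [image_extend_eq I e inter_subset_right]
      ext y
      refine and_congr_right fun hy => ⟨fun h => ⟨h, ?_⟩, fun h => h.1⟩
      simpa using (e.extend I).map_target hy
    have h2 : e'.extend I '' (A ∩ e.source) = e'.extend I '' A ∩ overlap I e e' := by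
      rw [image_extend_eq I e' hs, image_extend_eq I e' (inter_subset_left.trans hs)]
      ext y
      simp only [mem_inter_iff, mem_preimage, mem_overlap]
      tauto
    rw [ofChart_apply hg hA, h1, setIntegral_image_extend he he' inter_subset_right
      (inter_subset_left.trans hs) hm, h2, transfer, setIntegral_indicator hov]

theorem integrableOn_of_tsupport {g : E → ℂ} (hg : Continuous g) (hc : HasCompactSupport g)
    (s : Set E) : IntegrableOn g s :=
  (hg.integrable_of_hasCompactSupport hc).integrableOn

/-- The measure `g(y) dy` vanishes off the image of the closed support of `g` in the manifold. -/
theorem ofChart_eq_zero_of_disjoint {e : OpenPartialHomeomorph X H} {g : E → ℂ}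
    (hg : Continuous g) (hc : HasCompactSupport g) {A : Set X} (hA : MeasurableSet[borel X] A)
    (hd : Disjoint A ((e.extend I).symm '' tsupport g)) : ofChart I e g A = 0 := by
  refine ofChart_apply_eq_zero (integrableOn_of_tsupport hg hc _) hA fun y _ hyA => ?_
  by_contra h
  exact disjoint_left.1 hd hyA ⟨y, subset_tsupport _ h, rfl⟩

variable [T2Space X]

theorem isClosed_image_symm {e : OpenPartialHomeomorph X H} {K : Set E} (hK : IsCompact K)
    (ht : K ⊆ (e.extend I).target) : IsClosed ((e.extend I).symm '' K) :=
  (hK.image_of_continuousOn (e.continuousOn_extend_symm.mono ht)).isClosed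

theorem isOpen_target_diff {e e' : OpenPartialHomeomorph X H} {K : Set E} (hK : IsCompact K)
    (ht : K ⊆ (e.extend I).target) :
    IsOpen ((e'.extend I).target ∩ (e'.extend I).symm ⁻¹' ((e.extend I).symm '' K)ᶜ) :=
  e'.continuousOn_extend_symm.isOpen_inter_preimage e'.isOpen_extend_target
    (isClosed_image_symm hK ht).isOpen_compl

theorem transfer_eqOn_zero {e e' : OpenPartialHomeomorph X H} {g : E → ℂ} {K : Set E}
    (hK : tsupport g ⊆ K) :
    EqOn (transfer I e e' g) 0
      ((e'.extend I).target ∩ (e'.extend I).symm ⁻¹' ((e.extend I).symm '' K)ᶜ) := by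
  rintro y ⟨_, hy⟩
  by_cases hov : y ∈ overlap I e e'
  · have hz : g (I.extendCoordChange e' e y) = 0 := image_eq_zero_of_notMem_tsupport fun h =>
      hy ⟨_, hK h, extend_symm_extendCoordChange hov⟩
    rw [transfer, indicator_of_mem hov, hz, smul_zero]
    rfl
  · rw [transfer, indicator_of_notMem hov]
    rfl

/-- If `g` has compact support in the image of its chart then the transferred density is smooth on
the whole image of the other chart: the support of `g` is closed in the manifold, so that the
transferred density vanishes near the points which do not belong to the overlap. -/
theorem contDiffOn_transfer_target {e e' : OpenPartialHomeomorph X H}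
    (he : e ∈ IsManifold.maximalAtlas I ∞ X) (he' : e' ∈ IsManifold.maximalAtlas I ∞ X)
    {g : E → ℂ} (hg : ContDiff ℝ ∞ g) (hc : HasCompactSupport g)
    (ht : tsupport g ⊆ (e.extend I).target) :
    ContDiffOn ℝ ∞ (transfer I e e' g) (e'.extend I).target := by
  intro y hy
  refine ContDiffAt.contDiffWithinAt ?_
  by_cases hK : (e'.extend I).symm y ∈ (e.extend I).symm '' tsupport g
  · have hov : y ∈ overlap I e e' := by
      rw [mem_overlap]
      refine ⟨hy, ?_⟩
      obtain ⟨z, hz, hzy⟩ := hK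
      rw [← hzy]
      simpa using (e.extend I).map_target (ht hz)
    exact (contDiffOn_transfer he he' hg.contDiffOn).contDiffAt
      ((isOpen_overlap I e e').mem_nhds hov)
  · have hmem := (isOpen_target_diff (e' := e') hc.isCompact ht).mem_nhds ⟨hy, hK⟩
    have : transfer I e e' g =ᶠ[nhds y] fun _ => 0 :=
      Filter.eventuallyEq_of_mem hmem (transfer_eqOn_zero (subset_refl _))
    exact contDiffAt_const.congr_of_eventuallyEq this

/-- A smooth function with compact support in the image of a chart defines a smooth compactly
supported density. -/
theorem ofChart_mem_testDensities {e : OpenPartialHomeomorph X H}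
    (he : e ∈ IsManifold.maximalAtlas I ∞ X) {g : E → ℂ} (hg : ContDiff ℝ ∞ g)
    (hc : HasCompactSupport g) (ht : tsupport g ⊆ (e.extend I).target) :
    ofChart I e g ∈ testDensities I X := by
  refine ⟨⟨(e.extend I).symm '' tsupport g,
    hc.isCompact.image_of_continuousOn (e.continuousOn_extend_symm.mono ht),
    fun A hA hd => ofChart_eq_zero_of_disjoint hg.continuous hc hA hd⟩, fun e' he' => ?_⟩
  exact ⟨transfer I e e' g, contDiffOn_transfer_target he he' hg hc ht,
    hasChartDensity_transfer he he' (integrableOn_of_tsupport hg.continuous hc _)⟩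

/-- A smooth density supported in a compact subset of the domain of a chart is given by a smooth
function with compact support in the image of that chart. -/
theorem exists_eq_ofChart {e : OpenPartialHomeomorph X H}
    (he : e ∈ IsManifold.maximalAtlas I ∞ X) {μ : BorelMeasure X} (hμ : μ ∈ testDensities I X)
    {K : Set X} (hK : IsCompact K) (hKe : K ⊆ e.source)
    (h0 : ∀ A : Set X, MeasurableSet[borel X] A → Disjoint A K → μ A = 0) :
    ∃ g : E → ℂ, ContDiff ℝ ∞ g ∧ HasCompactSupport g ∧ tsupport g ⊆ e.extend I '' K ∧
      μ = ofChart I e g := by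
  obtain ⟨g₀, hg₀, hd⟩ := hμ.2 e he
  have hKt : e.extend I '' K ⊆ (e.extend I).target := by
    rintro _ ⟨x, hx, rfl⟩
    exact (e.extend I).map_source (by rw [e.extend_source]; exact hKe hx)
  have hKc : IsCompact (e.extend I '' K) :=
    hK.image_of_continuousOn (e.continuousOn_extend.mono (by rwa [e.extend_source]))
  let g : E → ℂ := indicator (e.extend I).target g₀
  have hz : ∀ y, y ∉ e.extend I '' K → g y = 0 := by
    intro y hy
    by_cases hyt : y ∈ (e.extend I).target
    · rw [show g y = g₀ y from indicator_of_mem hyt _]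
      refine hd.eqOn_zero hK.isClosed.isOpen_compl hg₀.continuousOn (fun A hA hAK => h0 A hA ?_)
        ⟨hyt, fun h => hy ⟨_, h, (e.extend I).right_inv hyt⟩⟩
      exact disjoint_left.2 fun x hx => hAK hx
    · exact indicator_of_notMem hyt _
  have hsupp : tsupport g ⊆ e.extend I '' K := by
    refine closure_minimal (fun y hy => ?_) hKc.isClosed
    by_contra h
    exact hy (hz y h)
  refine ⟨g, ?_, HasCompactSupport.of_support_subset_isCompact hKc
    ((subset_tsupport g).trans hsupp), hsupp, ?_⟩
  · rw [contDiff_iff_contDiffAt]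
    intro y
    by_cases hy : y ∈ e.extend I '' K
    · have hmem := (e.isOpen_extend_target (I := I)).mem_nhds (hKt hy)
      refine (hg₀.contDiffAt hmem).congr_of_eventuallyEq
        (Filter.eventuallyEq_of_mem hmem fun z hz => indicator_of_mem hz _)
    · have : g =ᶠ[nhds y] fun _ => 0 :=
        Filter.eventuallyEq_of_mem (hKc.isClosed.isOpen_compl.mem_nhds hy) fun z hz' => hz z hz'
      exact contDiffAt_const.congr_of_eventuallyEq this
  · rw [ofChart_eq_of_hasChartDensity hd fun A hA hAe => h0 A hA (hAe.mono_right hKe)]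
    exact ofChart_congr fun y hy => (indicator_of_mem hy _).symm

end ChangeOfCharts

section WeightChart

variable {E : Type*} [NormedAddCommGroup E] [NormedSpace ℝ E] [FiniteDimensional ℝ E]
  [MeasureSpace E] [BorelSpace E] [(volume : Measure E).IsAddHaarMeasure]
  {H : Type*} [TopologicalSpace H] {I : ModelWithCorners ℝ E H} [I.Boundaryless]
  {X : Type*} [TopologicalSpace X]

/-- Multiplying a measure by `φ` multiplies its density in a chart by `φ`. -/
theorem HasChartDensity.weight {e : OpenPartialHomeomorph X H} {μ : BorelMeasure X} {g : E → ℂ}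
    (h : HasChartDensity I e μ g) {φ : X → ℝ} (hφ : Continuous φ) {C : ℝ} (hC : ∀ x, ‖φ x‖ ≤ C) :
    HasChartDensity I e (weight φ μ) fun y => φ ((e.extend I).symm y) • g y := by
  classical
  have ht := (e.isOpen_extend_target (I := I)).measurableSet
  -- The inverse chart is only continuous on the image of the chart, so `φ` is extended by zero to
  -- obtain a function that is measurable on all of `E`.
  let ψ : E → ℝ := (e.extend I).target.piecewise (φ ∘ (e.extend I).symm) fun _ => 0
  have hψ : Measurable ψ :=
    ContinuousOn.measurable_piecewise (hφ.comp_continuousOn e.continuousOn_extend_symm)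
      continuousOn_const ht
  have hψt : ∀ y ∈ (e.extend I).target, ψ y = φ ((e.extend I).symm y) := fun y hy =>
    piecewise_eq_of_mem _ _ _ hy
  have hψC : ∀ y, ‖ψ y‖ ≤ C := by
    intro y
    by_cases hy : y ∈ (e.extend I).target
    · rw [hψt y hy]
      exact hC _
    · rw [show ψ y = 0 from piecewise_eq_of_notMem _ _ _ hy, norm_zero]
      exact (norm_nonneg _).trans (hC ((e.extend I).symm y))
  constructor
  · have : IntegrableOn (fun y => ψ y • g y) (e.extend I).target :=
      h.1.bdd_smul C hψ.aestronglyMeasurable (Filter.Eventually.of_forall hψC)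
    exact this.congr_fun (fun y hy => congrArg (· • g y) (hψt y hy)) ht
  · intro A hA hs
    have hsub : e.extend I '' A ⊆ (e.extend I).target := by
      rw [image_extend_eq I e hs]; exact inter_subset_left
    have hAm := measurableSet_image_extend I e hA hs
    rw [weight_apply_eq_integral hφ hC μ hA (m := volume.restrict (e.extend I '' A)) (h := g)
      (h.1.mono_set hsub) hψ hψC fun B hB => ?_]
    · exact setIntegral_congr_fun hAm fun y hy => by rw [hψt y (hsub hy)]
    · let : MeasurableSpace X := borel X
      have : BorelSpace X := ⟨rfl⟩
      rw [Measure.restrict_restrict (hψ hB), h.2 _ ((hφ.measurable hB).inter hA)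
        (inter_subset_right.trans hs)]
      congr 2
      rw [image_extend_eq I e hs, image_extend_eq I e (inter_subset_right.trans hs)]
      ext y
      constructor
      · rintro ⟨h1, h2, h3⟩
        refine ⟨?_, h1, h3⟩
        rw [mem_preimage, hψt y h1]
        exact h2
      · rintro ⟨h1, h2, h3⟩
        rw [mem_preimage, hψt y h2] at h1
        exact ⟨h2, h1, h3⟩

variable [ChartedSpace H X] [IsManifold I ∞ X]

theorem weight_mem_testDensities {μ : BorelMeasure X} (hμ : μ ∈ testDensities I X) {φ : X → ℝ}
    (hφ : ContMDiff I 𝓘(ℝ, ℝ) ∞ φ) {C : ℝ} (hC : ∀ x, ‖φ x‖ ≤ C) :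
    weight φ μ ∈ testDensities I X := by
  obtain ⟨⟨K, hK, h0⟩, h⟩ := hμ
  refine ⟨⟨K, hK, fun A hA hd => weight_eq_zero_of_disjoint hφ.continuous hC h0 hA hd⟩,
    fun e he => ?_⟩
  obtain ⟨g, hg, hd⟩ := h e he
  refine ⟨fun y => φ ((e.extend I).symm y) • g y, ContDiffOn.fun_smul ?_ hg,
    hd.weight hφ.continuous hC⟩
  rw [← contMDiffOn_iff_contDiffOn]
  rw [e.extend_target']
  exact hφ.comp_contMDiffOn (contMDiffOn_extend_symm he)

end WeightChart

/-! ### Estimates for derivatives -/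

section Calculus

theorem natCast_le_infty (k : ℕ) : (k : WithTop ℕ∞) ≤ ∞ := by
  exact_mod_cast (le_top : ((k : ℕ∞) : ℕ∞) ≤ ⊤)

/-- The derivatives of order at most `N` of a smooth function are bounded on compact sets. The
bound is taken to be at least `1`, so that its powers are monotone in the exponent. -/
theorem exists_norm_iteratedFDeriv_le {E F : Type*} [NormedAddCommGroup E] [NormedSpace ℝ E]
    [NormedAddCommGroup F] [NormedSpace ℝ F] {V K : Set E} (hV : IsOpen V) {f : E → F}
    (hf : ContDiffOn ℝ ∞ f V) (hK : IsCompact K) (hKV : K ⊆ V) (N : ℕ) :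
    ∃ A : ℝ, 1 ≤ A ∧ ∀ i ≤ N, ∀ x ∈ K, ‖iteratedFDerivWithin ℝ i f V x‖ ≤ A := by
  have h1 : ∀ i : ℕ, ∃ A : ℝ, ∀ x ∈ K, ‖iteratedFDerivWithin ℝ i f V x‖ ≤ A := fun i =>
    hK.exists_bound_of_continuousOn
      ((hf.continuousOn_iteratedFDerivWithin (by exact_mod_cast le_top) hV.uniqueDiffOn).mono hKV)
  choose A hA using h1
  refine ⟨1 + ∑ i ∈ Finset.range (N + 1), |A i|,
    le_add_of_nonneg_right (Finset.sum_nonneg fun i _ => abs_nonneg _), fun i hi x hx => ?_⟩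
  refine ((hA i x hx).trans (le_abs_self _)).trans ?_
  refine (Finset.single_le_sum (f := fun i => |A i|) (fun i _ => abs_nonneg _)
    (Finset.mem_range.2 (Nat.lt_succ_of_le hi))).trans ?_
  exact le_add_of_nonneg_left zero_le_one

/-- On compact sets the derivatives of order at most `N` of `J • (g ∘ ψ)` are controlled by those
of `g`, uniformly in `g`. -/
theorem exists_norm_iteratedFDeriv_smul_comp_le {E F : Type*} [NormedAddCommGroup E]
    [NormedSpace ℝ E] [NormedAddCommGroup F] [NormedSpace ℝ F] {V K : Set E} (hV : IsOpen V)
    {J : E → ℝ} {ψ : E → F} (hJ : ContDiffOn ℝ ∞ J V) (hψ : ContDiffOn ℝ ∞ ψ V)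
    (hK : IsCompact K) (hKV : K ⊆ V) (N : ℕ) :
    ∃ C : ℝ, 0 ≤ C ∧ ∀ (g : F → ℂ) (r : ℝ), ContDiff ℝ ∞ g →
      (∀ k ≤ N, ∀ y, ‖iteratedFDeriv ℝ k g y‖ ≤ r) →
      ∀ k ≤ N, ∀ x ∈ K, ‖iteratedFDeriv ℝ k (fun x => J x • g (ψ x)) x‖ ≤ C * r := by
  obtain ⟨A, hA1, hA⟩ := exists_norm_iteratedFDeriv_le hV hJ hK hKV N
  obtain ⟨D, hD1, hD⟩ := exists_norm_iteratedFDeriv_le hV hψ hK hKV N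
  have hA0 : 0 ≤ A := zero_le_one.trans hA1
  have hD0 : 0 ≤ D := zero_le_one.trans hD1
  let c : ℕ → ℝ := fun k =>
    ∑ i ∈ Finset.range (k + 1), (k.choose i : ℝ) * A * (((k - i).factorial : ℝ) * D ^ (k - i))
  have hc : ∀ k, 0 ≤ c k := fun k => Finset.sum_nonneg fun i _ => by positivity
  refine ⟨∑ k ∈ Finset.range (N + 1), c k, Finset.sum_nonneg fun k _ => hc k,
    fun g r hg hr k hk x hx => ?_⟩
  have hr0 : 0 ≤ r := (norm_nonneg _).trans (hr 0 (Nat.zero_le _) (ψ x))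
  have hxV := hKV hx
  rw [← iteratedFDerivWithin_of_isOpen k hV hxV]
  have hgψ : ContDiffOn ℝ ∞ (g ∘ ψ) V := hg.comp_contDiffOn hψ
  have h1 := norm_iteratedFDerivWithin_smul_le hJ hgψ hV.uniqueDiffOn hxV (n := k)
    (by exact_mod_cast le_top)
  refine h1.trans (le_trans ?_ (mul_le_mul_of_nonneg_right
    (Finset.single_le_sum (f := c) (fun i _ => hc i)
    (Finset.mem_range.2 (Nat.lt_succ_of_le hk))) hr0))
  rw [Finset.sum_mul]
  refine Finset.sum_le_sum fun i hi => ?_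
  have hik : i ≤ k := Nat.lt_succ_iff.1 (Finset.mem_range.1 hi)
  have h2 : ‖iteratedFDerivWithin ℝ (k - i) (g ∘ ψ) V x‖ ≤ (k - i).factorial * r * D ^ (k - i) := by
    refine norm_iteratedFDerivWithin_comp_le (N := ∞) hg.contDiffOn hψ
      (natCast_le_infty _)
      uniqueDiffOn_univ hV.uniqueDiffOn (mapsTo_univ _ _) hxV (fun j hj => ?_) fun j hj1 hj => ?_
    · rw [iteratedFDerivWithin_univ]
      exact hr j (by omega) _
    · exact (hD j (by omega) x hx).trans (le_self_pow₀ hD1 (by omega))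
  calc _ ≤ (k.choose i : ℝ) * A * ((k - i).factorial * r * D ^ (k - i)) := by
        gcongr
        exact hA i (hik.trans hk) x hx
    _ = _ := by ring

/-- Differentiation under the integral sign over a compact interval. -/
theorem hasFDerivAt_setIntegral_Icc {P F : Type*} [NormedAddCommGroup P] [NormedSpace ℝ P]
    [FiniteDimensional ℝ P] [NormedAddCommGroup F] [NormedSpace ℝ F] [CompleteSpace F]
    {f : P × ℝ → F} (hf : ContDiff ℝ ∞ f) (a b : ℝ) (p : P) :
    HasFDerivAt (fun p => ∫ t in Icc a b, f (p, t))
      (∫ t in Icc a b, (fderiv ℝ f (p, t)).comp (ContinuousLinearMap.inl ℝ P ℝ)) p := by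
  have hcont : Continuous fun q : P × ℝ =>
      (fderiv ℝ f q).comp (ContinuousLinearMap.inl ℝ P ℝ) :=
    (hf.continuous_fderiv (by simp)).clm_comp continuous_const
  have hK : IsCompact (Metric.closedBall p 1 ×ˢ Icc a b) :=
    (isCompact_closedBall p 1).prod isCompact_Icc
  obtain ⟨C, hC⟩ := hK.exists_bound_of_continuousOn hcont.continuousOn
  refine hasFDerivAt_integral_of_dominated_of_fderiv_le (bound := fun _ => C)
    (F := fun p t => f (p, t))
    (F' := fun p t => (fderiv ℝ f (p, t)).comp (ContinuousLinearMap.inl ℝ P ℝ))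
    (Metric.closedBall_mem_nhds p zero_lt_one) ?_ ?_ ?_ ?_ ?_ ?_
  · exact Filter.Eventually.of_forall fun q =>
      (hf.continuous.comp (by fun_prop : Continuous fun t : ℝ => (q, t))).aestronglyMeasurable
  · exact (hf.continuous.comp
      (by fun_prop : Continuous fun t : ℝ => (p, t))).continuousOn.integrableOn_Icc
  · exact (hcont.comp (by fun_prop : Continuous fun t : ℝ => (p, t))).aestronglyMeasurable
  · refine (ae_restrict_iff' measurableSet_Icc).2 (Filter.Eventually.of_forall fun t ht q hq => ?_)
    exact hC (q, t) ⟨hq, ht⟩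
  · exact continuousOn_const.integrableOn_Icc
  · refine Filter.Eventually.of_forall fun t q _ => ?_
    have h1 := (hf.differentiable (by simp) (q, t)).hasFDerivAt
    exact h1.comp q (hasFDerivAt_prodMk_left q t)

theorem fderiv_setIntegral_Icc {P F : Type*} [NormedAddCommGroup P] [NormedSpace ℝ P]
    [FiniteDimensional ℝ P] [NormedAddCommGroup F] [NormedSpace ℝ F] [CompleteSpace F]
    {f : P × ℝ → F} (hf : ContDiff ℝ ∞ f) (a b : ℝ) :
    fderiv ℝ (fun p => ∫ t in Icc a b, f (p, t)) = fun p =>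
      ∫ t in Icc a b, (fderiv ℝ f (p, t)).comp (ContinuousLinearMap.inl ℝ P ℝ) :=
  funext fun p => (hasFDerivAt_setIntegral_Icc hf a b p).fderiv

theorem contDiff_fderiv_comp_inl {P F : Type*} [NormedAddCommGroup P] [NormedSpace ℝ P]
    [NormedAddCommGroup F] [NormedSpace ℝ F] {f : P × ℝ → F} (hf : ContDiff ℝ ∞ f) :
    ContDiff ℝ ∞ fun q => (fderiv ℝ f q).comp (ContinuousLinearMap.inl ℝ P ℝ) :=
  (hf.fderiv_right (by simp)).clm_comp contDiff_const

/-- The integral of a smooth function over a compact interval depends smoothly on the parameters. -/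
theorem contDiff_setIntegral_Icc {P F : Type} [NormedAddCommGroup P] [NormedSpace ℝ P]
    [FiniteDimensional ℝ P] [NormedAddCommGroup F] [NormedSpace ℝ F] [CompleteSpace F]
    {f : P × ℝ → F} (hf : ContDiff ℝ ∞ f) (a b : ℝ) :
    ContDiff ℝ ∞ fun p => ∫ t in Icc a b, f (p, t) := by
  rw [contDiff_infty]
  intro n
  induction n generalizing F with
  | zero =>
    exact contDiff_zero.2 (continuous_iff_continuousAt.2 fun p =>
      (hasFDerivAt_setIntegral_Icc hf a b p).continuousAt)
  | succ n ih =>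
    rw [Nat.cast_succ, contDiff_succ_iff_fderiv]
    refine ⟨fun p => (hasFDerivAt_setIntegral_Icc hf a b p).differentiableAt, by simp, ?_⟩
    rw [fderiv_setIntegral_Icc hf]
    exact ih (contDiff_fderiv_comp_inl hf)

theorem norm_iteratedFDeriv_comp_le_of_opNorm_le_one {E F G : Type*} [NormedAddCommGroup E]
    [NormedSpace ℝ E] [NormedAddCommGroup F] [NormedSpace ℝ F] [NormedAddCommGroup G]
    [NormedSpace ℝ G] {f : E → F} (hf : ContDiff ℝ ∞ f) (L : F →L[ℝ] G) (hL : ‖L‖ ≤ 1) (k : ℕ)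
    (x : E) : ‖iteratedFDeriv ℝ k (fun x => L (f x)) x‖ ≤ ‖iteratedFDeriv ℝ k f x‖ :=
  (ContinuousLinearMap.norm_iteratedFDeriv_comp_left (𝕜 := ℝ) (f := f) L hf.contDiffAt
    (natCast_le_infty k)).trans
    (mul_le_of_le_one_left (norm_nonneg _) hL)

/-- Restriction of linear forms on `P × ℝ` to `P`. -/
def precompInl (P F : Type*) [NormedAddCommGroup P] [NormedSpace ℝ P]
    [NormedAddCommGroup F] [NormedSpace ℝ F] : ((P × ℝ) →L[ℝ] F) →L[ℝ] (P →L[ℝ] F) :=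
  (ContinuousLinearMap.compL ℝ P (P × ℝ) F).flip (ContinuousLinearMap.inl ℝ P ℝ)

theorem opNorm_precomp_inl_le_one (P F : Type*) [NormedAddCommGroup P] [NormedSpace ℝ P]
    [NormedAddCommGroup F] [NormedSpace ℝ F] :
    ‖precompInl P F‖ ≤ 1 := by
  refine ContinuousLinearMap.opNorm_le_bound _ zero_le_one fun A => ?_
  rw [one_mul]
  refine (ContinuousLinearMap.opNorm_comp_le A _).trans ?_
  exact mul_le_of_le_one_right (norm_nonneg _) (ContinuousLinearMap.norm_inl_le_one ℝ P ℝ)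

theorem norm_iteratedFDeriv_setIntegral_Icc_le {P F : Type} [NormedAddCommGroup P]
    [NormedSpace ℝ P] [FiniteDimensional ℝ P] [NormedAddCommGroup F] [NormedSpace ℝ F]
    [CompleteSpace F] {f : P × ℝ → F} (hf : ContDiff ℝ ∞ f) {a b : ℝ} (hab : a ≤ b) {r : ℝ} (k : ℕ)
    (hr : ∀ q, ‖iteratedFDeriv ℝ k f q‖ ≤ r) (p : P) :
    ‖iteratedFDeriv ℝ k (fun p => ∫ t in Icc a b, f (p, t)) p‖ ≤ (b - a) * r := by
  induction k generalizing F with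
  | zero =>
    rw [norm_iteratedFDeriv_zero]
    have h := norm_setIntegral_le_of_norm_le_const (μ := volume) (s := Icc a b)
      (f := fun t => f (p, t)) (C := r) (by simp)
      (fun t _ => by simpa using hr (p, t))
    rw [Real.volume_real_Icc_of_le hab] at h
    linarith
  | succ k ih =>
    have h : (fun q : P × ℝ => (fderiv ℝ f q).comp (ContinuousLinearMap.inl ℝ P ℝ)) =
        fun q => precompInl P F (fderiv ℝ f q) := rfl
    have hr' (q : P × ℝ) : ‖iteratedFDeriv ℝ k
        (fun q : P × ℝ => (fderiv ℝ f q).comp (ContinuousLinearMap.inl ℝ P ℝ)) q‖ ≤ r := by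
      refine le_trans ?_ (hr q)
      rw [← norm_iteratedFDeriv_fderiv, h]
      exact norm_iteratedFDeriv_comp_le_of_opNorm_le_one (hf.fderiv_right (by simp))
        (precompInl P F) (opNorm_precomp_inl_le_one P F) k q
    have h2 := ih (F := P →L[ℝ] F) (contDiff_fderiv_comp_inl hf) hr'
    rw [← norm_iteratedFDeriv_fderiv, fderiv_setIntegral_Icc hf]
    exact h2

/-- A smooth function has a smooth antiderivative in the last variable. -/
theorem exists_antideriv {P : Type} [NormedAddCommGroup P] [NormedSpace ℝ P]
    [FiniteDimensional ℝ P] {f : P × ℝ → ℂ} (hf : ContDiff ℝ ∞ f) (a : ℝ) :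
    ∃ F : P × ℝ → ℂ, ContDiff ℝ ∞ F ∧ (∀ p t, F (p, t) = ∫ s in a..t, f (p, s)) ∧
      ∀ q, fderiv ℝ F q (0, 1) = f q := by
  -- Rescaling to a fixed interval makes the antiderivative jointly smooth by differentiation under
  -- the integral sign.
  let F : P × ℝ → ℂ := fun q => (q.2 - a) • ∫ σ in Icc (0 : ℝ) 1, f (q.1, a + (q.2 - a) * σ)
  have hF : ContDiff ℝ ∞ F := by
    refine ContDiff.smul (contDiff_snd.sub contDiff_const) ?_
    have : ContDiff ℝ ∞ (fun q : (P × ℝ) × ℝ => f (q.1.1, a + (q.1.2 - a) * q.2)) :=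
      hf.comp (by fun_prop)
    exact contDiff_setIntegral_Icc this 0 1
  have hFi : ∀ p t, F (p, t) = ∫ s in a..t, f (p, s) := by
    intro p t
    have h := intervalIntegral.smul_integral_comp_add_mul (fun s => f (p, s)) (t - a) a
      (a := 0) (b := 1)
    simp only [mul_zero, add_zero, mul_one, add_sub_cancel] at h
    rw [← h, intervalIntegral.integral_of_le zero_le_one, ← integral_Icc_eq_integral_Ioc]
  refine ⟨F, hF, hFi, fun q => ?_⟩
  obtain ⟨p, t⟩ := q
  have h1 : HasDerivAt (fun t => F (p, t)) (fderiv ℝ F (p, t) (0, 1)) t := by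
    have hd := (hF.differentiable (by simp) (p, t)).hasFDerivAt
    have hl : HasDerivAt (fun t : ℝ => (p, t)) ((0 : P), (1 : ℝ)) t :=
      (hasDerivAt_const t p).prodMk (hasDerivAt_id t)
    exact hd.comp_hasDerivAt t hl
  have hc : Continuous fun s : ℝ => f (p, s) := hf.continuous.comp (by fun_prop)
  have h2 : HasDerivAt (fun t => F (p, t)) (f (p, t)) t := by
    simp only [hFi]
    exact intervalIntegral.integral_hasDerivAt_right (hc.intervalIntegrable _ _)
      (hc.stronglyMeasurableAtFilter _ _) hc.continuousAt
  exact h1.unique h2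

set_option synthInstance.maxHeartbeats 100000 in
/-- The difference quotients of a smooth function with bounded derivatives converge to its
directional derivative, together with all derivatives. -/
theorem norm_iteratedFDeriv_fderiv_sub_le {E F : Type} [NormedAddCommGroup E] [NormedSpace ℝ E]
    [NormedAddCommGroup F] [NormedSpace ℝ F] {h : E → F} (hh : ContDiff ℝ ∞ h) (v : E) {B : ℝ}
    (k : ℕ) (hB : ∀ j ≤ k + 2, ∀ x, ‖iteratedFDeriv ℝ j h x‖ ≤ B) {s : ℝ} (hs : s ≠ 0) (x : E) :
    ‖iteratedFDeriv ℝ k (fun x => fderiv ℝ h x v - s⁻¹ • (h (x + s • v) - h x)) x‖ ≤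
      |s| * (B * ‖v‖ ^ 2) := by
  have hd : Differentiable ℝ h := hh.differentiable (by simp)
  have hh' : ContDiff ℝ ∞ (fderiv ℝ h) := hh.fderiv_right (by simp)
  have hd' : Differentiable ℝ (fderiv ℝ h) := hh'.differentiable (by simp)
  induction k generalizing F with
  | zero =>
    rw [norm_iteratedFDeriv_zero]
    have h2 : ∀ y, ‖fderiv ℝ (fderiv ℝ h) y‖ ≤ B := fun y => by
      rw [← norm_iteratedFDeriv_one (𝕜 := ℝ), norm_iteratedFDeriv_fderiv]
      exact hB 2 (by omega) y
    have hB0 : 0 ≤ B := (norm_nonneg (fderiv ℝ (fderiv ℝ h) x)).trans (h2 x)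
    have h3 : ∀ y ∈ segment ℝ x (x + s • v), ‖fderiv ℝ h y - fderiv ℝ h x‖ ≤ B * ‖s • v‖ := by
      intro y hy
      refine (convex_univ.norm_image_sub_le_of_norm_fderiv_le (fun z _ => hd' z)
        (fun z _ => h2 z) (mem_univ x) (mem_univ y)).trans ?_
      refine mul_le_mul_of_nonneg_left ?_ hB0
      simpa using norm_sub_le_of_mem_segment hy
    have h4 := (convex_segment x (x + s • v)).norm_image_sub_le_of_norm_hasFDerivWithin_le'
      (φ := fderiv ℝ h x) (fun y _ => (hd y).hasFDerivAt.hasFDerivWithinAt) h3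
      (left_mem_segment ℝ _ _) (right_mem_segment ℝ _ _)
    rw [add_sub_cancel_left, map_smul] at h4
    have h5 : fderiv ℝ h x v - s⁻¹ • (h (x + s • v) - h x) =
        -(s⁻¹ • (h (x + s • v) - h x - s • fderiv ℝ h x v)) := by
      rw [smul_sub s⁻¹ (h (x + s • v) - h x), smul_smul, inv_mul_cancel₀ hs, one_smul, neg_sub]
    rw [h5, norm_neg, norm_smul, norm_inv, Real.norm_eq_abs]
    rw [norm_smul, Real.norm_eq_abs] at h4
    rw [inv_mul_le_iff₀ (abs_pos.2 hs)]
    refine h4.trans (le_of_eq ?_)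
    ring
  | succ k ih =>
    rw [← norm_iteratedFDeriv_fderiv]
    have hfd : fderiv ℝ (fun x => fderiv ℝ h x v - s⁻¹ • (h (x + s • v) - h x)) =
        fun x => fderiv ℝ (fderiv ℝ h) x v - s⁻¹ • (fderiv ℝ h (x + s • v) - fderiv ℝ h x) := by
      funext y
      have e1 : HasFDerivAt (fun x => fderiv ℝ h x v)
          ((fderiv ℝ (fderiv ℝ h) y).flip v) y := by
        simpa using (hd' y).hasFDerivAt.clm_apply (hasFDerivAt_const v y)
      have e2 : HasFDerivAt (fun x => h (x + s • v)) (fderiv ℝ h (y + s • v)) y := by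
        have := (hd (y + s • v)).hasFDerivAt.comp y ((hasFDerivAt_id y).add_const (s • v))
        simpa [Function.comp_def] using this
      have e3 := e1.fun_sub ((e2.fun_sub (hd y).hasFDerivAt).fun_const_smul s⁻¹)
      rw [e3.fderiv]
      congr 1
      ext w
      -- The second derivative is symmetric, so `v` may be moved to the first argument.
      exact ((hh.contDiffAt.isSymmSndFDerivAt
        (by simpa using natCast_le_infty 2)) w v)
    rw [hfd]
    refine ih hh' (fun j hj y => ?_) (hh'.differentiable (by simp)) (hh'.fderiv_right (by simp))
      ((hh'.fderiv_right (m := ∞) (by simp)).differentiable (by simp))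
    rw [norm_iteratedFDeriv_fderiv]
    exact hB _ (by omega) y

end Calculus

/-! ### Partitions of unity and the continuity of functionals on densities -/

section Partition

variable {E : Type*} [NormedAddCommGroup E] [NormedSpace ℝ E] [FiniteDimensional ℝ E]
  {H : Type*} [TopologicalSpace H] (I : ModelWithCorners ℝ E H)
  {X : Type*} [TopologicalSpace X]

/-- The complex measure `μ` vanishes off the set `K`. -/
abbrev SupportedOn (μ : BorelMeasure X) (K : Set X) : Prop :=
  ∀ A : Set X, MeasurableSet[borel X] A → Disjoint A K → μ A = 0

theorem SupportedOn.weight {μ : BorelMeasure X} {K : Set X} (h : SupportedOn μ K) {φ : X → ℝ}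
    (hφ : Continuous φ) {C : ℝ} (hC : ∀ x, ‖φ x‖ ≤ C) :
    SupportedOn (weight φ μ) (K ∩ tsupport φ) := by
  intro A hA hd
  let : MeasurableSpace X := borel X
  have : BorelSpace X := ⟨rfl⟩
  have ht : MeasurableSet (tsupport φ) := (isClosed_tsupport φ).measurableSet
  rw [← VectorMeasure.of_add_of_sdiff (hA.inter ht) hA inter_subset_left]
  rw [weight_eq_zero_of_disjoint hφ hC h (hA.inter ht), weight_eq_zero_of_disjoint_support hφ hC
    (hA.diff (hA.inter ht)), add_zero]
  · rw [sdiff_self_inter]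
    exact disjoint_sdiff_left
  · rw [disjoint_iff_inter_eq_empty] at hd ⊢
    rwa [inter_assoc, inter_comm (tsupport φ)]

variable [ChartedSpace H X] [IsManifold I ∞ X] [T2Space X] [SigmaCompactSpace X]

/-- A finite smooth partition of unity on a compact set. -/
theorem exists_partition {ι : Type*} {K : Set X} (hK : IsCompact K) {U : ι → Set X}
    (hU : ∀ i, IsOpen (U i)) (hKU : K ⊆ ⋃ i, U i) :
    ∃ (s : Finset ι) (ρ : ι → X → ℝ), (∀ i, ContMDiff I 𝓘(ℝ, ℝ) ∞ (ρ i)) ∧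
      (∀ i x, ‖ρ i x‖ ≤ 1) ∧ (∀ x, ‖∑ i ∈ s, ρ i x‖ ≤ 1) ∧ (∀ i, tsupport (ρ i) ⊆ U i) ∧
      ∀ x ∈ K, ∑ i ∈ s, ρ i x = 1 := by
  classical
  obtain ⟨s, hs⟩ := hK.elim_finite_subcover U hU hKU
  -- Emptying the sets outside a finite subcover makes the partition of unity finite.
  let U' : ι → Set X := fun i => if i ∈ s then U i else ∅
  have hU' : ∀ i, IsOpen (U' i) := by
    intro i
    by_cases h : i ∈ s <;> simp [U', h, hU i]
  have hcov : K ⊆ ⋃ i, U' i := by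
    intro x hx
    obtain ⟨i, hi, hxi⟩ := mem_iUnion₂.1 (hs hx)
    exact mem_iUnion.2 ⟨i, by simpa [U', hi] using hxi⟩
  obtain ⟨f, hf⟩ := SmoothPartitionOfUnity.exists_isSubordinate I hK.isClosed U' hU' hcov
  have hsum : ∀ x, ∑ᶠ i, f i x = ∑ i ∈ s, f i x := by
    intro x
    refine finsum_eq_sum_of_support_subset _ fun i hi => ?_
    by_contra h
    have h2 := hf i (subset_tsupport _ hi)
    simp only [U', if_neg (show i ∉ s from h)] at h2
    exact h2
  refine ⟨s, fun i => f i, fun i => (f i).contMDiff, fun i x => ?_, fun x => ?_, fun i => ?_,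
    fun x hx => ?_⟩
  · rw [Real.norm_of_nonneg (f.nonneg i x)]
    exact f.le_one i x
  · rw [Real.norm_of_nonneg (Finset.sum_nonneg fun i _ => f.nonneg i x), ← hsum]
    exact f.sum_le_one x
  · refine (hf i).trans ?_
    by_cases h : i ∈ s <;> simp [U', h]
  · rw [← hsum]
    exact f.sum_eq_one hx

variable {I}

/-- Decomposition of a measure by a partition of unity on its support. -/
theorem eq_sum_weight {ι : Type*} {s : Finset ι} {ρ : ι → X → ℝ} {K : Set X} (hK : IsClosed K)
    (hρ : ∀ i, Continuous (ρ i)) (h1 : ∀ i x, ‖ρ i x‖ ≤ 1) (h2 : ∀ x, ‖∑ i ∈ s, ρ i x‖ ≤ 1)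
    (h3 : ∀ x ∈ K, ∑ i ∈ s, ρ i x = 1) {μ : BorelMeasure X} (hμ : SupportedOn μ K) :
    μ = ∑ i ∈ s, weight (ρ i) μ := by
  rw [← weight_finset_sum s hρ h1 h2 μ]
  exact (weight_eq_self (continuous_finsetSum s fun i _ => hρ i) h2 hK hμ h3).symm

end Partition

section Continuity

variable {E : Type*} [NormedAddCommGroup E] [NormedSpace ℝ E] [FiniteDimensional ℝ E]
  [MeasureSpace E] [BorelSpace E] [(volume : Measure E).IsAddHaarMeasure]
  {H : Type*} [TopologicalSpace H] {I : ModelWithCorners ℝ E H} [I.Boundaryless]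
  {X : Type*} [TopologicalSpace X]

/-- The continuous density of a measure in a chart is unique. -/
theorem HasChartDensity.eqOn {e : OpenPartialHomeomorph X H} {μ : BorelMeasure X} {g g' : E → ℂ}
    (h : HasChartDensity I e μ g) (h' : HasChartDensity I e μ g')
    (hg : ContinuousOn g (e.extend I).target) (hg' : ContinuousOn g' (e.extend I).target) :
    EqOn g g' (e.extend I).target := by
  have hd : HasChartDensity I e (0 : BorelMeasure X) (g - g') := by
    refine ⟨h.1.sub h'.1, fun A hA hs => ?_⟩
    have hsub : e.extend I '' A ⊆ (e.extend I).target := by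
      rw [image_extend_eq I e hs]; exact inter_subset_left
    refine Eq.trans ?_ (integral_sub (h.1.mono_set hsub) (h'.1.mono_set hsub)).symm
    rw [← h.2 A hA hs, ← h'.2 A hA hs, sub_self]
    rfl
  have := hd.eqOn_zero isOpen_univ (hg.sub hg') (fun _ _ _ => rfl)
  rw [preimage_univ, inter_univ] at this
  exact fun y hy => sub_eq_zero.1 (this hy)

variable [ChartedSpace H X] [T2Space X]

theorem supportedOn_ofChart {e : OpenPartialHomeomorph X H} {g : E → ℂ}
    (hg : ContDiff ℝ ∞ g) (hc : HasCompactSupport g) {K : Set E} (hK : tsupport g ⊆ K) :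
    SupportedOn (ofChart I e g) ((e.extend I).symm '' K) := fun _ hA hd =>
  ofChart_eq_zero_of_disjoint hg.continuous hc hA (hd.mono_right (image_mono hK))

variable [IsManifold I ∞ X] [SigmaCompactSpace X]

/-- The derivatives of order at most `N` of the function representing `ρ μ` in one chart are
controlled by those of the function representing `μ` in another. -/
theorem exists_norm_iteratedFDeriv_weight_le {e e' : OpenPartialHomeomorph X H}
    (he : e ∈ IsManifold.maximalAtlas I ∞ X) (he' : e' ∈ IsManifold.maximalAtlas I ∞ X)
    {K : Set E} (hK : IsCompact K) (hKe : K ⊆ (e.extend I).target) {ρ : X → ℝ}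
    (hρ : ContMDiff I 𝓘(ℝ, ℝ) ∞ ρ) (hρ1 : ∀ x, ‖ρ x‖ ≤ 1) (hρe : tsupport ρ ⊆ e'.source) (N : ℕ) :
    ∃ D : ℝ, 0 ≤ D ∧ ∀ (g : E → ℂ) (r : ℝ), ContDiff ℝ ∞ g → tsupport g ⊆ K →
      (∀ k ≤ N, ∀ y, ‖iteratedFDeriv ℝ k g y‖ ≤ r) →
      ∃ g' : E → ℂ, ContDiff ℝ ∞ g' ∧ HasCompactSupport g' ∧
        tsupport g' ⊆ e'.extend I '' ((e.extend I).symm '' K ∩ tsupport ρ) ∧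
        weight ρ (ofChart I e g) = ofChart I e' g' ∧
        ∀ k ≤ N, ∀ y, ‖iteratedFDeriv ℝ k g' y‖ ≤ D * r := by
  have hK1 : IsCompact ((e.extend I).symm '' K) :=
    hK.image_of_continuousOn (e.continuousOn_extend_symm.mono hKe)
  have hK1e : (e.extend I).symm '' K ⊆ e.source := by
    rintro _ ⟨y, hy, rfl⟩
    have := (e.extend I).map_target (hKe hy)
    rwa [e.extend_source] at this
  have hK2 : IsCompact ((e.extend I).symm '' K ∩ tsupport ρ) :=
    hK1.inter_right (isClosed_tsupport ρ)
  have hK2e : (e.extend I).symm '' K ∩ tsupport ρ ⊆ e'.source := inter_subset_right.trans hρe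
  have hK3 : IsCompact (e'.extend I '' ((e.extend I).symm '' K ∩ tsupport ρ)) :=
    hK2.image_of_continuousOn (e'.continuousOn_extend.mono (by rwa [e'.extend_source]))
  have hV := isOpen_overlap I e e'
  have hK3V : e'.extend I '' ((e.extend I).symm '' K ∩ tsupport ρ) ⊆ overlap I e e' := by
    rintro _ ⟨x, hx, rfl⟩
    have hx' : x ∈ (e'.extend I).source := by rw [e'.extend_source]; exact hK2e hx
    rw [mem_overlap, (e'.extend I).left_inv hx']
    exact ⟨(e'.extend I).map_source hx', hK1e hx.1⟩
  have hρs : ContDiffOn ℝ ∞ (fun y => ρ ((e'.extend I).symm y)) (e'.extend I).target := by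
    rw [← contMDiffOn_iff_contDiffOn, e'.extend_target']
    exact hρ.comp_contMDiffOn (contMDiffOn_extend_symm he')
  have hVt : overlap I e e' ⊆ (e'.extend I).target := fun y hy => ((mem_overlap I).1 hy).1
  have hψ : ContDiffOn ℝ ∞ (I.extendCoordChange e' e) (overlap I e e') :=
    ModelWithCorners.contDiffOn_extendCoordChange he' he
  obtain ⟨D, hD0, hD⟩ := exists_norm_iteratedFDeriv_smul_comp_le hV
    ((hρs.mono hVt).mul (contDiffOn_jacobian he he')) hψ hK3 hK3V N
  refine ⟨D, hD0, fun g r hg hgK hr => ?_⟩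
  have hgc : HasCompactSupport g := hK.of_isClosed_subset (isClosed_tsupport g) hgK
  have hμ : ofChart I e g ∈ testDensities I X :=
    ofChart_mem_testDensities he hg hgc (hgK.trans hKe)
  have hgi := integrableOn_of_tsupport hg.continuous hgc (e.extend I).target
  obtain ⟨g', hg', hgc', hgt', heq⟩ := exists_eq_ofChart he' (weight_mem_testDensities hμ hρ hρ1)
    hK2 hK2e ((supportedOn_ofChart hg hgc hgK).weight hρ.continuous hρ1)
  refine ⟨g', hg', hgc', hgt', heq, fun k hk y => ?_⟩
  by_cases hy : y ∈ e'.extend I '' ((e.extend I).symm '' K ∩ tsupport ρ)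
  · have hyV := hK3V hy
    have h1 := (hasChartDensity_transfer he he' hgi).weight hρ.continuous hρ1
    have h2 : HasChartDensity I e' (weight ρ (ofChart I e g)) g' :=
      heq ▸ hasChartDensity_ofChart (integrableOn_of_tsupport hg'.continuous hgc' _)
    have h3 := h2.eqOn h1 hg'.continuous.continuousOn (ContDiffOn.fun_smul hρs
      (contDiffOn_transfer_target he he' hg hgc (hgK.trans hKe))).continuousOn
    have h4 : g' =ᶠ[nhds y] fun x => (ρ ((e'.extend I).symm x) * jacobian I e e' x) •
        g (I.extendCoordChange e' e x) := by
      filter_upwards [hV.mem_nhds hyV] with x hx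
      rw [h3 (hVt hx)]
      beta_reduce
      rw [transfer, indicator_of_mem hx, mul_smul]
    rw [(h4.iteratedFDeriv ℝ k).eq_of_nhds]
    exact hD g r hg hr k hk y hy
  · have h1 : iteratedFDeriv ℝ k g' y = 0 := by
      by_contra h
      exact hy (hgt' (support_iteratedFDeriv_subset k h))
    rw [h1, norm_zero]
    exact mul_nonneg hD0 ((norm_nonneg _).trans (hr k hk y))

/-- A functional on the test densities has order at most `N` on the densities that are represented
in the chart `e` by functions supported in `K`. -/
def BoundedOn (u : testDensities I X →ₗ[ℂ] ℂ) (e : OpenPartialHomeomorph X H) (K : Set E) : Prop :=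
  ∃ (N : ℕ) (C : ℝ), ∀ (μ : testDensities I X) (g : E → ℂ) (r : ℝ), ContDiff ℝ ∞ g →
    tsupport g ⊆ K → μ.1 = ofChart I e g → (∀ k ≤ N, ∀ y, ‖iteratedFDeriv ℝ k g y‖ ≤ r) →
    ‖u μ‖ ≤ C * r

/-- The continuity of a functional on the test densities can be checked in charts that cover the
manifold: a density in any other chart is cut into pieces by a partition of unity, and the
derivatives of the pieces in the covering charts are controlled by those of the density. -/
theorem mem_distributions_of_cover {u : testDensities I X →ₗ[ℂ] ℂ} {ι : Type*}
    {c : ι → OpenPartialHomeomorph X H} (hc : ∀ i, c i ∈ IsManifold.maximalAtlas I ∞ X)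
    (hcov : ∀ x, ∃ i, x ∈ (c i).source)
    (h : ∀ i, ∀ K ⊆ ((c i).extend I).target, IsCompact K → BoundedOn u (c i) K) :
    u ∈ distributions I X := by
  intro e he K hKe hK
  have hK1 : IsCompact ((e.extend I).symm '' K) :=
    hK.image_of_continuousOn (e.continuousOn_extend_symm.mono hKe)
  obtain ⟨s, ρ, hρ, hρ1, hρ2, hρt, hρs⟩ := exists_partition I hK1 (fun i => (c i).open_source)
    fun x _ => mem_iUnion.2 (hcov x)
  have hK' : ∀ i, IsCompact ((c i).extend I '' ((e.extend I).symm '' K ∩ tsupport (ρ i))) :=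
    fun i => (hK1.inter_right (isClosed_tsupport _)).image_of_continuousOn
      ((c i).continuousOn_extend.mono (by
        rw [(c i).extend_source]; exact inter_subset_right.trans (hρt i)))
  have hKt' : ∀ i, (c i).extend I '' ((e.extend I).symm '' K ∩ tsupport (ρ i)) ⊆
      ((c i).extend I).target := by
    rintro i _ ⟨x, hx, rfl⟩
    exact ((c i).extend I).map_source (by rw [(c i).extend_source]; exact hρt i hx.2)
  choose N C hNC using fun i => h i _ (hKt' i) (hK' i)
  choose D hD0 hD using fun i => exists_norm_iteratedFDeriv_weight_le he (hc i) hK hKe (hρ i)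
    (hρ1 i) (hρt i) (N i)
  refine ⟨s.sup N, ∑ i ∈ s, C i * D i, fun μ g r hg hgK hd h0 hr => ?_⟩
  have hgc : HasCompactSupport g := hK.of_isClosed_subset (isClosed_tsupport g) hgK
  have hμ : μ.1 = ofChart I e g := ofChart_eq_of_hasChartDensity hd h0
  have hμs : SupportedOn μ.1 ((e.extend I).symm '' K) := hμ ▸ supportedOn_ofChart hg hgc hgK
  have hsum := eq_sum_weight hK1.isClosed (fun i => (hρ i).continuous) hρ1 hρ2 hρs hμs
  let ν : ι → testDensities I X := fun i =>
    ⟨weight (ρ i) μ.1, weight_mem_testDensities μ.2 (hρ i) (hρ1 i)⟩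
  have hμν : μ = ∑ i ∈ s, ν i := by
    refine Subtype.ext ?_
    rw [AddSubmonoidClass.coe_finsetSum]
    exact hsum
  rw [hμν, map_sum, Finset.sum_mul]
  refine (norm_sum_le _ _).trans (Finset.sum_le_sum fun i hi => ?_)
  obtain ⟨g', hg', -, hgt', heq, hb⟩ := hD i g r hg hgK fun k hk =>
    hr k (hk.trans (Finset.le_sup hi))
  rw [mul_assoc]
  refine hNC i (ν i) g' _ hg' hgt' ?_ hb
  rw [← heq, ← hμ]

/-- The estimate in the definition of a distribution, for densities written as `ofChart e g`. -/
theorem boundedOn_of_mem_distributions {u : testDensities I X →ₗ[ℂ] ℂ}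
    (hu : u ∈ distributions I X) {e : OpenPartialHomeomorph X H}
    (he : e ∈ IsManifold.maximalAtlas I ∞ X) {K : Set E} (hKe : K ⊆ (e.extend I).target)
    (hK : IsCompact K) : BoundedOn u e K := by
  obtain ⟨N, C, h⟩ := hu e he K hKe hK
  refine ⟨N, C, fun μ g r hg hgK hμ hr => ?_⟩
  have hgc : HasCompactSupport g := hK.of_isClosed_subset (isClosed_tsupport g) hgK
  have hgi := integrableOn_of_tsupport hg.continuous hgc (e.extend I).target
  refine h μ g r hg hgK (hμ ▸ hasChartDensity_ofChart hgi) (fun A hA hd => ?_) hr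
  rw [hμ]
  refine ofChart_apply_eq_zero hgi hA fun y hy hyA => ?_
  have := (e.extend I).map_target hy
  rw [e.extend_source] at this
  exact (disjoint_left.1 hd hyA this).elim

end Continuity

/-! ### Charts and diffeomorphisms -/

section MaximalAtlas

variable {E : Type*} [NormedAddCommGroup E] [NormedSpace ℝ E]
  {H : Type*} [TopologicalSpace H] {I : ModelWithCorners ℝ E H}
  {X : Type*} [TopologicalSpace X] [ChartedSpace H X] [IsManifold I ∞ X]

/-- A homeomorphism of an open set with an open subset of the model space which is smooth in both
directions is a chart of the smooth structure. -/
theorem mem_maximalAtlas_of_contMDiffOn {e : OpenPartialHomeomorph X H}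
    (h1 : ContMDiffOn I 𝓘(ℝ, E) ∞ (e.extend I) e.source)
    (h2 : ContMDiffOn 𝓘(ℝ, E) I ∞ (e.extend I).symm (e.extend I).target) :
    e ∈ IsManifold.maximalAtlas I ∞ X := by
  have key : ∀ e' ∈ IsManifold.maximalAtlas I ∞ X,
      ContDiffOn ℝ ∞ (I ∘ (e.symm ≫ₕ e') ∘ I.symm)
        (I.symm ⁻¹' (e.symm ≫ₕ e').source ∩ range I) ∧
      ContDiffOn ℝ ∞ (I ∘ (e'.symm ≫ₕ e) ∘ I.symm)
        (I.symm ⁻¹' (e'.symm ≫ₕ e).source ∩ range I) := by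
    intro e' he'
    rw [← contMDiffOn_iff_contDiffOn, ← contMDiffOn_iff_contDiffOn]
    constructor
    · refine ContMDiffOn.mono ((e'.contMDiffOn_extend he').comp' h2) ?_
      rintro y ⟨hy, hyr⟩
      rw [mem_preimage, OpenPartialHomeomorph.trans_source] at hy
      refine ⟨?_, hy.2⟩
      rw [e.extend_target]
      exact ⟨hy.1, hyr⟩
    · have h3 := contMDiffOn_extend_symm he'
      rw [← e'.extend_target'] at h3
      refine ContMDiffOn.mono (h1.comp' h3) ?_
      rintro y ⟨hy, hyr⟩
      rw [mem_preimage, OpenPartialHomeomorph.trans_source] at hy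
      refine ⟨?_, hy.2⟩
      rw [e'.extend_target]
      exact ⟨hy.1, hyr⟩
  rw [IsManifold.maximalAtlas, mem_maximalAtlas_iff]
  intro e' he'
  obtain ⟨ha, hb⟩ := key e' (IsManifold.subset_maximalAtlas he')
  refine ⟨?_, ?_⟩
  · exact mem_groupoid_of_pregroupoid.2 ⟨ha, hb⟩
  · exact mem_groupoid_of_pregroupoid.2 ⟨hb, ha⟩

/-- The composition of a diffeomorphism and a chart is a chart. -/
theorem transOpenPartialHomeomorph_mem_maximalAtlas {e : OpenPartialHomeomorph X H}
    (he : e ∈ IsManifold.maximalAtlas I ∞ X) {φ : X ≃ₜ X} (h1 : ContMDiff I I ∞ φ)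
    (h2 : ContMDiff I I ∞ φ.symm) :
    φ.transOpenPartialHomeomorph e ∈ IsManifold.maximalAtlas I ∞ X := by
  refine mem_maximalAtlas_of_contMDiffOn ?_ ?_
  · exact (e.contMDiffOn_extend he).comp h1.contMDiffOn fun x hx => hx
  · have h3 := contMDiffOn_extend_symm he
    rw [← e.extend_target'] at h3
    exact h2.comp_contMDiffOn h3

end MaximalAtlas

section Pushforward

variable {X Y Z : Type*} [TopologicalSpace X] [TopologicalSpace Y] [TopologicalSpace Z]

theorem pushforward_apply {f : X → Y} (hf : Continuous f) (μ : BorelMeasure X) {A : Set Y}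
    (hA : MeasurableSet[borel Y] A) : pushforward f μ A = μ (f ⁻¹' A) := by
  let : MeasurableSpace X := borel X
  have : BorelSpace X := ⟨rfl⟩
  let : MeasurableSpace Y := borel Y
  have : BorelSpace Y := ⟨rfl⟩
  exact VectorMeasure.map_apply μ hf.measurable hA

theorem measurableSet_preimage {f : X → Y} (hf : Continuous f) {A : Set Y}
    (hA : MeasurableSet[borel Y] A) : MeasurableSet[borel X] (f ⁻¹' A) := by
  let : MeasurableSpace X := borel X
  have : BorelSpace X := ⟨rfl⟩
  let : MeasurableSpace Y := borel Y
  have : BorelSpace Y := ⟨rfl⟩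
  exact hf.measurable hA

/-- The push-forward of complex measures as a linear map. -/
def pushforwardₗ (f : X → Y) : BorelMeasure X →ₗ[ℂ] BorelMeasure Y :=
  let _ : MeasurableSpace X := borel X
  let _ : MeasurableSpace Y := borel Y
  VectorMeasure.mapₗ f

theorem pushforwardₗ_apply (f : X → Y) (μ : BorelMeasure X) :
    pushforwardₗ f μ = pushforward f μ := rfl

theorem pushforward_pushforward {f : X → Y} {g : Y → Z} (hf : Continuous f) (hg : Continuous g)
    (μ : BorelMeasure X) : pushforward g (pushforward f μ) = pushforward (g ∘ f) μ := by
  refine VectorMeasure.ext fun A hA => ?_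
  rw [pushforward_apply hg _ hA, pushforward_apply hf _ (measurableSet_preimage hg hA),
    pushforward_apply (hg.comp hf) _ hA]
  rfl

theorem SupportedOn.pushforward {f : X → Y} (hf : Continuous f) {μ : BorelMeasure X} {K : Set X}
    (h : SupportedOn μ K) : SupportedOn (pushforward f μ) (f '' K) := by
  intro A hA hd
  rw [pushforward_apply hf _ hA]
  refine h _ (measurableSet_preimage hf hA) ?_
  rw [disjoint_left] at hd ⊢
  exact fun x hx hxK => hd hx ⟨x, hxK, rfl⟩

end Pushforward

section Diffeo

variable {E : Type*} [NormedAddCommGroup E] [NormedSpace ℝ E] [MeasureSpace E]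
  {H : Type*} [TopologicalSpace H] {I : ModelWithCorners ℝ E H}
  {X : Type*} [TopologicalSpace X] [ChartedSpace H X] [IsManifold I ∞ X]

/-- Diffeomorphisms preserve the smooth compactly supported densities: the density of `φ_* μ` in the
chart `e` is the density of `μ` in the chart `e ∘ φ`. -/
theorem pushforward_mem_testDensities_of_diffeo {μ : BorelMeasure X} (hμ : μ ∈ testDensities I X)
    {φ : X ≃ₜ X} (h1 : ContMDiff I I ∞ φ) (h2 : ContMDiff I I ∞ φ.symm) :
    pushforward φ μ ∈ testDensities I X := by
  obtain ⟨⟨K, hK, h0⟩, h⟩ := hμ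
  refine ⟨⟨φ '' K, hK.image φ.continuous, SupportedOn.pushforward φ.continuous h0⟩, fun e he => ?_⟩
  obtain ⟨g, hg, hi, hd⟩ := h _ (transOpenPartialHomeomorph_mem_maximalAtlas he h1 h2)
  refine ⟨g, hg, hi, fun A hA hs => ?_⟩
  rw [pushforward_apply φ.continuous _ hA, hd _ (measurableSet_preimage φ.continuous hA)
    (preimage_mono hs)]
  congr 2
  ext y
  constructor
  · rintro ⟨x, hx, rfl⟩
    exact ⟨φ x, hx, rfl⟩
  · rintro ⟨x, hx, rfl⟩
    refine ⟨φ.symm x, ?_, ?_⟩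
    · rw [mem_preimage, φ.apply_symm_apply]
      exact hx
    · change e.extend I (φ (φ.symm x)) = _
      rw [φ.apply_symm_apply]

end Diffeo

/-! ### Integration over the fibres in adapted charts -/

section FibreIntegral

variable {E E' : Type} [NormedAddCommGroup E] [NormedSpace ℝ E] [FiniteDimensional ℝ E]
  [NormedAddCommGroup E'] [NormedSpace ℝ E'] [FiniteDimensional ℝ E']

/-- The integral of `g` over the segment `ℓ ({y} × [-π, π])`. Here `ℓ` splits the coordinate space
`E` into the coordinates of the base and the angle along the fibre. -/
def fibreIntegral (ℓ : (E' × ℝ) ≃L[ℝ] E) (g : E → ℂ) (y : E') : ℂ :=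
  ∫ t in Icc (-Real.pi) Real.pi, g (ℓ (y, t))

variable {ℓ : (E' × ℝ) ≃L[ℝ] E}

theorem contDiff_fibreIntegral {g : E → ℂ} (hg : ContDiff ℝ ∞ g) :
    ContDiff ℝ ∞ (fibreIntegral ℓ g) :=
  contDiff_setIntegral_Icc (f := fun q => g (ℓ q)) (hg.comp ℓ.contDiff) _ _

/-- The projection `ℓ (y, t) ↦ y`. -/
def baseCoord (ℓ : (E' × ℝ) ≃L[ℝ] E) (x : E) : E' := (ℓ.symm x).1

theorem continuous_baseCoord : Continuous (baseCoord ℓ) :=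
  continuous_fst.comp ℓ.symm.continuous

theorem baseCoord_apply (y : E') (t : ℝ) : baseCoord ℓ (ℓ (y, t)) = y := by
  rw [baseCoord, ℓ.symm_apply_apply]

theorem tsupport_fibreIntegral_subset {g : E → ℂ} {K : Set E} (hK : IsCompact K)
    (hg : tsupport g ⊆ K) : tsupport (fibreIntegral ℓ g) ⊆ baseCoord ℓ '' K := by
  refine closure_minimal (fun y hy => ?_) (hK.image continuous_baseCoord).isClosed
  by_contra h
  refine hy ?_
  rw [fibreIntegral]
  have h0 : ∀ t : ℝ, g (ℓ (y, t)) = 0 := fun t => by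
    refine image_eq_zero_of_notMem_tsupport fun ht => h ⟨ℓ (y, t), hg ht, baseCoord_apply y t⟩
  simp [h0]

/-- The derivatives of order at most `N` of `g ∘ L` are controlled by those of `g`, with a constant
that does not depend on the order. -/
theorem norm_iteratedFDeriv_comp_continuousLinearMap_le {F G W : Type*} [NormedAddCommGroup F]
    [NormedSpace ℝ F] [NormedAddCommGroup G] [NormedSpace ℝ G] [NormedAddCommGroup W]
    [NormedSpace ℝ W] {g : G → W} (hg : ContDiff ℝ ∞ g) (L : F →L[ℝ] G) {N k : ℕ} (hk : k ≤ N)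
    {r : ℝ} (hr : ∀ y, ‖iteratedFDeriv ℝ k g y‖ ≤ r) (x : F) :
    ‖iteratedFDeriv ℝ k (fun x => g (L x)) x‖ ≤ (1 + ‖L‖) ^ N * r := by
  have h : iteratedFDeriv ℝ k (fun x => g (L x)) x =
      (iteratedFDeriv ℝ k g (L x)).compContinuousLinearMap fun _ => L :=
    L.iteratedFDeriv_comp_right hg x (natCast_le_infty k)
  rw [h, mul_comm]
  refine (ContinuousMultilinearMap.norm_compContinuousLinearMap_le _ _).trans ?_
  rw [Finset.prod_const, Finset.card_univ, Fintype.card_fin]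
  have h1 : (1 : ℝ) ≤ 1 + ‖L‖ := le_add_of_nonneg_right (norm_nonneg L)
  refine mul_le_mul (hr _) ?_ (by positivity) ((norm_nonneg _).trans (hr (L x)))
  exact (pow_le_pow_left₀ (norm_nonneg L) (le_add_of_nonneg_left zero_le_one) k).trans
    (pow_le_pow_right₀ h1 hk)

theorem norm_iteratedFDeriv_fibreIntegral_le {g : E → ℂ} (hg : ContDiff ℝ ∞ g) {N k : ℕ}
    (hk : k ≤ N) {r : ℝ} (hr : ∀ y, ‖iteratedFDeriv ℝ k g y‖ ≤ r) (y : E') :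
    ‖iteratedFDeriv ℝ k (fibreIntegral ℓ g) y‖ ≤
      2 * Real.pi * ((1 + ‖(ℓ : (E' × ℝ) →L[ℝ] E)‖) ^ N * r) := by
  have h := norm_iteratedFDeriv_setIntegral_Icc_le (f := fun q => g (ℓ q)) (hg.comp ℓ.contDiff)
    (a := -Real.pi) (b := Real.pi) (by linarith [Real.pi_pos]) k
    (fun q => norm_iteratedFDeriv_comp_continuousLinearMap_le hg (ℓ : (E' × ℝ) →L[ℝ] E) hk hr q) y
  refine h.trans (le_of_eq ?_)
  ring

/-- The profile with which densities on the base are spread over the fibres. -/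
theorem exists_bump : ∃ χ : ℝ → ℝ, ContDiff ℝ ∞ χ ∧ HasCompactSupport χ ∧
    tsupport χ ⊆ Ioo (-Real.pi) Real.pi ∧ ∫ t in Icc (-Real.pi) Real.pi, χ t = 1 := by
  let f : ContDiffBump (0 : ℝ) := ⟨1, 2, one_pos, one_lt_two⟩
  have ht : tsupport (f.normed volume) ⊆ Ioo (-Real.pi) Real.pi := by
    rw [f.tsupport_normed_eq, Real.closedBall_eq_Icc]
    intro t ht
    have := Real.pi_gt_three
    have h1 : (0 : ℝ) - 2 ≤ t := ht.1
    have h2 : t ≤ 0 + 2 := ht.2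
    constructor <;> linarith
  refine ⟨f.normed volume, f.contDiff_normed, f.hasCompactSupport_normed, ht, ?_⟩
  rw [← f.integral_normed (μ := volume)]
  refine setIntegral_eq_integral_of_forall_compl_eq_zero fun t htn => ?_
  exact image_eq_zero_of_notMem_tsupport fun h => htn (Ioo_subset_Icc_self (ht h))

/-- The function `ℓ (y, t) ↦ χ t G y`. For `χ` with integral `1` its integrals over the fibres give
`G` back. -/
def lift (ℓ : (E' × ℝ) ≃L[ℝ] E) (χ : ℝ → ℝ) (G : E' → ℂ) (x : E) : ℂ :=
  χ (ℓ.symm x).2 • G (baseCoord ℓ x)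

theorem contDiff_lift {χ : ℝ → ℝ} (hχ : ContDiff ℝ ∞ χ) {G : E' → ℂ} (hG : ContDiff ℝ ∞ G) :
    ContDiff ℝ ∞ (lift ℓ χ G) :=
  ContDiff.smul (hχ.comp (contDiff_snd.comp ℓ.symm.contDiff))
    (hG.comp (contDiff_fst.comp ℓ.symm.contDiff))

theorem tsupport_lift_subset {χ : ℝ → ℝ} {G : E' → ℂ} (hχc : HasCompactSupport χ) {K : Set E'}
    (hK : IsCompact K) (hG : tsupport G ⊆ K) :
    tsupport (lift ℓ χ G) ⊆ ℓ '' (K ×ˢ tsupport χ) := by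
  refine closure_minimal (fun x hx => ?_) ((hK.prod hχc).image ℓ.continuous).isClosed
  refine ⟨ℓ.symm x, ⟨hG (subset_tsupport G ?_), subset_tsupport χ ?_⟩, ℓ.apply_symm_apply x⟩
  · exact fun h => hx (by change _ • G (ℓ.symm x).1 = 0; rw [h, smul_zero])
  · exact fun h => hx (by change χ (ℓ.symm x).2 • _ = (0 : ℂ); rw [h, zero_smul])

theorem fibreIntegral_lift {χ : ℝ → ℝ} (h1 : ∫ t in Icc (-Real.pi) Real.pi, χ t = 1) (G : E' → ℂ) :
    fibreIntegral ℓ (lift ℓ χ G) = G := by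
  funext y
  simp only [fibreIntegral, lift, baseCoord, ℓ.symm_apply_apply]
  rw [integral_smul_const, h1, one_smul]

theorem exists_norm_iteratedFDeriv_lift_le {χ : ℝ → ℝ} (hχ : ContDiff ℝ ∞ χ)
    (hχc : HasCompactSupport χ) {K : Set E'} (hK : IsCompact K) (N : ℕ) :
    ∃ D : ℝ, 0 ≤ D ∧ ∀ (G : E' → ℂ) (r : ℝ), ContDiff ℝ ∞ G → tsupport G ⊆ K →
      (∀ k ≤ N, ∀ y, ‖iteratedFDeriv ℝ k G y‖ ≤ r) →
      ∀ k ≤ N, ∀ x, ‖iteratedFDeriv ℝ k (lift ℓ χ G) x‖ ≤ D * r := by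
  obtain ⟨D, hD0, hD⟩ := exists_norm_iteratedFDeriv_smul_comp_le (V := (univ : Set E)) isOpen_univ
    (J := fun x => χ (ℓ.symm x).2) (ψ := baseCoord ℓ)
    (hχ.comp (contDiff_snd.comp ℓ.symm.contDiff)).contDiffOn
    (contDiff_fst.comp ℓ.symm.contDiff).contDiffOn
    ((hK.prod hχc).image ℓ.continuous) (subset_univ _) N
  refine ⟨D, hD0, fun G r hG hGK hr k hk x => ?_⟩
  by_cases hx : x ∈ ℓ '' (K ×ˢ tsupport χ)
  · exact hD G r hG hr k hk x hx
  · have h1 : iteratedFDeriv ℝ k (lift ℓ χ G) x = 0 := by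
      by_contra h
      exact hx (tsupport_lift_subset hχc hK hGK (support_iteratedFDeriv_subset k h))
    rw [h1, norm_zero]
    exact mul_nonneg hD0 ((norm_nonneg _).trans (hr k hk (baseCoord ℓ x)))

/-- A smooth compactly supported function whose integrals over the fibres vanish is the derivative,
in the direction of the fibres, of a smooth function whose support stays over a compact set of the
base and at a positive distance `π - b` from the ends of the fibres. -/
theorem exists_fderiv_eq_of_fibreIntegral_eq_zero {h : E → ℂ} (hh : ContDiff ℝ ∞ h)
    (hc : HasCompactSupport h) {T : Set E'}
    (ht : tsupport h ⊆ ℓ '' (T ×ˢ Ioo (-Real.pi) Real.pi)) (h0 : ∀ y, fibreIntegral ℓ h y = 0) :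
    ∃ (H : E → ℂ) (K : Set E') (b : ℝ), ContDiff ℝ ∞ H ∧ IsCompact K ∧ K ⊆ T ∧ b < Real.pi ∧
      (∀ x, H x ≠ 0 → (ℓ.symm x).1 ∈ K ∧ |(ℓ.symm x).2| ≤ b) ∧
      ∀ x, fderiv ℝ H x (ℓ (0, 1)) = h x := by
  have hπ := Real.pi_pos
  obtain ⟨F, hF, hFi, hFd⟩ := exists_antideriv (f := fun q => h (ℓ q)) (hh.comp ℓ.contDiff)
    (-Real.pi)
  have hKc : IsCompact (ℓ.symm '' tsupport h) := hc.image ℓ.symm.continuous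
  have hKs : ∀ q ∈ ℓ.symm '' tsupport h, q.1 ∈ T ∧ q.2 ∈ Ioo (-Real.pi) Real.pi := by
    rintro _ ⟨x, hx, rfl⟩
    obtain ⟨q, hq, rfl⟩ := ht hx
    rw [ℓ.symm_apply_apply]
    exact hq
  have hsup : ∀ q, h (ℓ q) ≠ 0 → q ∈ ℓ.symm '' tsupport h := fun q hq =>
    ⟨ℓ q, subset_tsupport h hq, ℓ.symm_apply_apply q⟩
  obtain ⟨b, hb, hbK⟩ : ∃ b < Real.pi, ∀ q ∈ ℓ.symm '' tsupport h, |q.2| ≤ b := by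
    rcases (ℓ.symm '' tsupport h).eq_empty_or_nonempty with he | hne
    · exact ⟨0, hπ, fun q hq => by rw [he] at hq; exact hq.elim⟩
    · obtain ⟨q0, hq0, hm⟩ := hKc.exists_isMaxOn hne
        (continuous_snd.abs.continuousOn : ContinuousOn (fun q : E' × ℝ => |q.2|) _)
      exact ⟨|q0.2|, abs_lt.2 (hKs q0 hq0).2, fun q hq => hm hq⟩
  refine ⟨fun x => F (ℓ.symm x), Prod.fst '' (ℓ.symm '' tsupport h), b, hF.comp ℓ.symm.contDiff,
    hKc.image continuous_fst, ?_, hb, fun x hx => ?_, fun x => ?_⟩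
  · rintro _ ⟨q, hq, rfl⟩
    exact (hKs q hq).1
  · obtain ⟨⟨p, t⟩, rfl⟩ := ℓ.surjective x
    beta_reduce at hx
    rw [ℓ.symm_apply_apply] at hx ⊢
    have hint : ∀ a c : ℝ, IntervalIntegrable (fun s => h (ℓ (p, s))) volume a c := fun a c =>
      (hh.continuous.comp (ℓ.continuous.comp (by fun_prop))).intervalIntegrable a c
    have hz : ∀ s, b < |s| → h (ℓ (p, s)) = 0 := fun s hs => by
      by_contra hne
      exact absurd (hbK _ (hsup _ hne)) (not_le.2 hs)
    have hfull : ∫ s in (-Real.pi)..Real.pi, h (ℓ (p, s)) = 0 := by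
      rw [intervalIntegral.integral_of_le (by linarith), ← integral_Icc_eq_integral_Ioc]
      exact h0 p
    rw [hFi] at hx
    refine ⟨?_, ?_⟩
    · by_contra hp
      refine hx (intervalIntegral.integral_zero_ae (Filter.Eventually.of_forall fun s _ => ?_))
      by_contra hne
      exact hp ⟨_, hsup _ hne, rfl⟩
    · by_contra hbt
      rw [not_le, lt_abs] at hbt
      rcases hbt with hbt | hbt
      · refine hx ?_
        rw [← intervalIntegral.integral_add_adjacent_intervals (hint _ _) (hint Real.pi t), hfull,
          zero_add]
        refine intervalIntegral.integral_zero_ae (Filter.Eventually.of_forall fun s hs => hz s ?_)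
        have : min Real.pi t < s := hs.1
        exact (lt_min hb hbt).trans (this.trans_le (le_abs_self s))
      · refine hx ?_
        refine intervalIntegral.integral_zero_ae (Filter.Eventually.of_forall fun s hs => ?_)
        rcases lt_or_ge b |s| with h1 | h1
        · exact hz s h1
        · have h2 : s ≤ max (-Real.pi) t := hs.2
          have h3 := (abs_le.1 h1).1
          rcases le_max_iff.1 h2 with h4 | h4 <;> linarith
  · have h1 := ((hF.differentiable (by simp) (ℓ.symm x)).hasFDerivAt.comp x
      (ℓ.symm : E →L[ℝ] E' × ℝ).hasFDerivAt).fderiv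
    have h2 : fderiv ℝ (fun x => F (ℓ.symm x)) x =
      (fderiv ℝ F (ℓ.symm x)).comp (ℓ.symm : E →L[ℝ] E' × ℝ) := h1
    rw [h2]
    change fderiv ℝ F (ℓ.symm x) (ℓ.symm (ℓ (0, 1))) = _
    rw [ℓ.symm_apply_apply, hFd, ℓ.apply_symm_apply]

end FibreIntegral

/-! ### Push-forward and rotation in adapted charts -/

section FibreChart

variable {E E' : Type} [NormedAddCommGroup E] [NormedSpace ℝ E] [FiniteDimensional ℝ E]
  [MeasureSpace E] [BorelSpace E] [(volume : Measure E).IsAddHaarMeasure]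
  [NormedAddCommGroup E'] [NormedSpace ℝ E'] [FiniteDimensional ℝ E']
  [MeasureSpace E'] [BorelSpace E'] [(volume : Measure E').IsAddHaarMeasure]
  {H : Type*} [TopologicalSpace H] (I : ModelWithCorners ℝ E H) [I.Boundaryless]
  {H' : Type*} [TopologicalSpace H'] (J : ModelWithCorners ℝ E' H') [J.Boundaryless]
  {X : Type*} [TopologicalSpace X] [ChartedSpace H X]
  {Y : Type*} [TopologicalSpace Y] [ChartedSpace H' Y]

/-- The chart `e` of `X` and the chart `e'` of `Y` are adapted to the map `f` and the circle action
`a`: after the linear change of coordinates `ℓ` the map `f` is the projection off the last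
coordinate `t ∈ (-π, π)`, and the circle acts by translations of `t`. -/
structure IsFibreChart (ℓ : (E' × ℝ) ≃L[ℝ] E) (f : X → Y) (a : Circle → X → X)
    (e : OpenPartialHomeomorph X H) (e' : OpenPartialHomeomorph Y H') : Prop where
  mem : e ∈ IsManifold.maximalAtlas I ∞ X
  mem' : e' ∈ IsManifold.maximalAtlas J ∞ Y
  target_eq : (e.extend I).target = ℓ '' ((e'.extend J).target ×ˢ Ioo (-Real.pi) Real.pi)
  map_symm : ∀ y ∈ (e'.extend J).target, ∀ t ∈ Ioo (-Real.pi) Real.pi,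
    f ((e.extend I).symm (ℓ (y, t))) = (e'.extend J).symm y
  act_symm : ∀ y ∈ (e'.extend J).target, ∀ t s : ℝ, t ∈ Ioo (-Real.pi) Real.pi →
    t + s ∈ Ioo (-Real.pi) Real.pi →
    a (Circle.exp s) ((e.extend I).symm (ℓ (y, t))) = (e.extend I).symm (ℓ (y, t + s))

variable {I J} {ℓ : (E' × ℝ) ≃L[ℝ] E} {f : X → Y} {a : Circle → X → X}
  {e : OpenPartialHomeomorph X H} {e' : OpenPartialHomeomorph Y H'}

namespace IsFibreChart

theorem mem_target (h : IsFibreChart I J ℓ f a e e') {y : E'} {t : ℝ} :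
    ℓ (y, t) ∈ (e.extend I).target ↔
      y ∈ (e'.extend J).target ∧ t ∈ Ioo (-Real.pi) Real.pi := by
  rw [h.target_eq, ℓ.injective.mem_set_image, mem_prod]

/-- In adapted coordinates the preimage of a subset of the base is a product. -/
theorem target_inter (h : IsFibreChart I J ℓ f a e e') (B : Set Y) :
    ℓ ⁻¹' ((e.extend I).target ∩ (e.extend I).symm ⁻¹' (f ⁻¹' B)) =
      ((e'.extend J).target ∩ (e'.extend J).symm ⁻¹' B) ×ˢ Ioo (-Real.pi) Real.pi := by
  ext ⟨y, t⟩
  constructor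
  · rintro ⟨h1, h2⟩
    obtain ⟨hy, ht⟩ := h.mem_target.1 h1
    rw [mem_preimage, mem_preimage, h.map_symm y hy t ht] at h2
    exact ⟨⟨hy, h2⟩, ht⟩
  · rintro ⟨⟨hy, h2⟩, ht⟩
    refine ⟨h.mem_target.2 ⟨hy, ht⟩, ?_⟩
    rw [mem_preimage, mem_preimage, h.map_symm y hy t ht]
    exact h2

theorem baseCoord_image_subset (h : IsFibreChart I J ℓ f a e e') {K : Set E}
    (hK : K ⊆ (e.extend I).target) : baseCoord ℓ '' K ⊆ (e'.extend J).target := by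
  rintro _ ⟨x, hx, rfl⟩
  obtain ⟨⟨y, t⟩, rfl⟩ := ℓ.surjective x
  rw [baseCoord_apply]
  exact (h.mem_target.1 (hK hx)).1

theorem map_mem_source (h : IsFibreChart I J ℓ f a e e') {x : X} (hx : x ∈ e.source) :
    f x ∈ e'.source := by
  have hx' : x ∈ (e.extend I).source := by rwa [e.extend_source]
  obtain ⟨⟨y, t⟩, hyt⟩ := ℓ.surjective (e.extend I x)
  have h1 := h.mem_target.1 (hyt ▸ (e.extend I).map_source hx')
  have h2 := h.map_symm y h1.1 t h1.2
  rw [hyt, (e.extend I).left_inv hx'] at h2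
  rw [h2, ← e'.extend_source (I := J)]
  exact (e'.extend J).map_target h1.1

theorem exists_mem_source (h : IsFibreChart I J ℓ f a e e') {y : Y} (hy : y ∈ e'.source) :
    ∃ x ∈ e.source, f x = y := by
  have hy' : y ∈ (e'.extend J).source := by rwa [e'.extend_source]
  have h0 : (0 : ℝ) ∈ Ioo (-Real.pi) Real.pi := by simp [Real.pi_pos]
  have h1 := (e'.extend J).map_source hy'
  refine ⟨(e.extend I).symm (ℓ (e'.extend J y, 0)), ?_, ?_⟩
  · rw [← e.extend_source (I := I)]
    exact (e.extend I).map_target (h.mem_target.2 ⟨h1, h0⟩)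
  · rw [h.map_symm _ h1 _ h0, (e'.extend J).left_inv hy']

/-- In adapted charts the push-forward is the integration over the fibres. -/
theorem pushforward_ofChart (h : IsFibreChart I J ℓ f a e e') (hℓ : MeasurePreserving ℓ)
    (hf : Continuous f) {g : E → ℂ} (hg : ContDiff ℝ ∞ g) (hc : HasCompactSupport g) :
    pushforward f (ofChart I e g) = ofChart J e' (fibreIntegral ℓ g) := by
  refine VectorMeasure.ext fun B hB => ?_
  have hci : HasCompactSupport (fibreIntegral ℓ g) :=
    (hc.image continuous_baseCoord).of_isClosed_subset (isClosed_tsupport _)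
      (tsupport_fibreIntegral_subset hc subset_rfl)
  rw [pushforward_apply hf _ hB,
    ofChart_apply (integrableOn_of_tsupport hg.continuous hc _) (measurableSet_preimage hf hB),
    ofChart_apply (integrableOn_of_tsupport (contDiff_fibreIntegral hg).continuous hci _) hB,
    ← hℓ.setIntegral_preimage_emb ℓ.toHomeomorph.measurableEmbedding, h.target_inter]
  have hi : Integrable (fun q => g (ℓ q)) (volume : Measure (E' × ℝ)) :=
    (hℓ.integrable_comp_emb ℓ.toHomeomorph.measurableEmbedding).2
      (hg.continuous.integrable_of_hasCompactSupport hc)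
  rw [Measure.volume_eq_prod] at hi ⊢
  rw [setIntegral_prod _ hi.integrableOn]
  simp only [fibreIntegral, integral_Icc_eq_integral_Ioo]

theorem fibreIntegral_mem (h : IsFibreChart I J ℓ f a e e') [T2Space Y] {g : E → ℂ}
    (hg : ContDiff ℝ ∞ g) (hc : HasCompactSupport g) (ht : tsupport g ⊆ (e.extend I).target) :
    ofChart J e' (fibreIntegral ℓ g) ∈ testDensities J Y := by
  have h1 := tsupport_fibreIntegral_subset (ℓ := ℓ) hc subset_rfl
  exact ofChart_mem_testDensities h.mem' (contDiff_fibreIntegral hg)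
    ((hc.image continuous_baseCoord).of_isClosed_subset (isClosed_tsupport _) h1)
    (h1.trans (h.baseCoord_image_subset ht))

theorem tsupport_lift_subset_target (h : IsFibreChart I J ℓ f a e e') {χ : ℝ → ℝ}
    (hχc : HasCompactSupport χ) (hχt : tsupport χ ⊆ Ioo (-Real.pi) Real.pi) {K : Set E'}
    (hK : IsCompact K) (hKt : K ⊆ (e'.extend J).target) {G : E' → ℂ} (hG : tsupport G ⊆ K) :
    tsupport (lift ℓ χ G) ⊆ (e.extend I).target := by
  rw [h.target_eq]
  exact (tsupport_lift_subset hχc hK hG).trans (image_mono (prod_mono hKt hχt))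

/-- In adapted charts rotations act on densities by translations, as long as the supports do not
leave the chart. -/
theorem pushforward_act_ofChart (h : IsFibreChart I J ℓ f a e e') (ha : ∀ z, Continuous (a z))
    {g : E → ℂ} (hg : ContDiff ℝ ∞ g) {K : Set E'} (hK : IsCompact K)
    (hKt : K ⊆ (e'.extend J).target) {b s : ℝ} (hb : b + |s| < Real.pi)
    (hgs : ∀ x, g x ≠ 0 → (ℓ.symm x).1 ∈ K ∧ |(ℓ.symm x).2| ≤ b) :
    pushforward (a (Circle.exp (-s))) (ofChart I e g) =
      ofChart I e fun x => g (x + s • ℓ (0, 1)) := by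
  have hc : HasCompactSupport g := by
    refine HasCompactSupport.intro ((hK.prod isCompact_Icc).image ℓ.continuous)
      (K := ℓ '' (K ×ˢ Icc (-b) b)) fun x hx => ?_
    by_contra hne
    exact hx ⟨ℓ.symm x, ⟨(hgs x hne).1, abs_le.1 (hgs x hne).2⟩, ℓ.apply_symm_apply x⟩
  have hc' : HasCompactSupport fun x => g (x + s • ℓ (0, 1)) :=
    hc.comp_homeomorph (Homeomorph.addRight (s • ℓ (0, 1)))
  have hg' : Continuous fun x => g (x + s • ℓ (0, 1)) := hg.continuous.comp (by fun_prop)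
  refine VectorMeasure.ext fun A hA => ?_
  have hA' := measurableSet_preimage (ha (Circle.exp (-s))) hA
  rw [pushforward_apply (ha _) _ hA,
    ofChart_apply (integrableOn_of_tsupport hg.continuous hc _) hA',
    ofChart_apply (integrableOn_of_tsupport hg' hc' _) hA,
    ← integral_indicator (measurableSet_target_inter I e hA'),
    ← integral_indicator (measurableSet_target_inter I e hA),
    ← integral_sub_right_eq_self
      (((e.extend I).target ∩ (e.extend I).symm ⁻¹' A).indicator _) (s • ℓ (0, 1))]
  refine integral_congr_ae (Filter.Eventually.of_forall fun x => ?_)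
  by_cases hx : g x = 0
  · refine (indicator_apply_eq_zero.2 fun _ => hx).trans
      (indicator_apply_eq_zero.2 fun _ => ?_).symm
    rw [sub_add_cancel, hx]
  · obtain ⟨⟨y, t⟩, rfl⟩ := ℓ.surjective x
    have hsx := hgs _ hx
    rw [ℓ.symm_apply_apply] at hsx
    obtain ⟨hy, ht⟩ := hsx
    replace ht := abs_le.1 ht
    have h1 : ℓ (y, t) - s • ℓ (0, 1) = ℓ (y, t + -s) := by
      rw [← map_smul, ← map_sub]
      simp [sub_eq_add_neg]
    have hs := abs_le.1 (le_refl |s|)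
    have ht1 : t ∈ Ioo (-Real.pi) Real.pi := by
      constructor <;> linarith [abs_nonneg s]
    have ht2 : t + -s ∈ Ioo (-Real.pi) Real.pi := by
      constructor <;> linarith
    have hiff : ℓ (y, t) ∈ (e.extend I).target ∩
        (e.extend I).symm ⁻¹' (a (Circle.exp (-s)) ⁻¹' A) ↔
        ℓ (y, t + -s) ∈ (e.extend I).target ∩ (e.extend I).symm ⁻¹' A := by
      rw [mem_inter_iff, mem_inter_iff, h.mem_target, h.mem_target, mem_preimage, mem_preimage,
        mem_preimage, h.act_symm y (hKt hy) t (-s) ht1 ht2]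
      simp only [ht1, ht2, and_true]
    beta_reduce
    by_cases hm : ℓ (y, t + -s) ∈ (e.extend I).target ∩ (e.extend I).symm ⁻¹' A
    · rw [indicator_of_mem (hiff.2 hm), indicator_of_mem (h1 ▸ hm), sub_add_cancel]
    · rw [indicator_of_notMem (mt hiff.1 hm), indicator_of_notMem (h1 ▸ hm)]

end IsFibreChart

end FibreChart

/-! ### Distributions on the total space of a circle fibration -/

section CircleFibration

variable {E E' : Type} [NormedAddCommGroup E] [NormedSpace ℝ E] [FiniteDimensional ℝ E]
  [MeasureSpace E] [BorelSpace E] [(volume : Measure E).IsAddHaarMeasure]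
  [NormedAddCommGroup E'] [NormedSpace ℝ E'] [FiniteDimensional ℝ E']
  [MeasureSpace E'] [BorelSpace E'] [(volume : Measure E').IsAddHaarMeasure]
  {H : Type*} [TopologicalSpace H] (I : ModelWithCorners ℝ E H) [I.Boundaryless]
  {H' : Type*} [TopologicalSpace H'] (J : ModelWithCorners ℝ E' H') [J.Boundaryless]
  {X : Type*} [TopologicalSpace X] [ChartedSpace H X]
  {Y : Type*} [TopologicalSpace Y] [ChartedSpace H' Y]

/-- The fibres of the smooth surjective map `f` are the orbits of the smooth circle action `a`, and
there are adapted charts near every point. One linear change of coordinates `ℓ` serves all charts;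
it preserves Lebesgue measure, so that integrals in `E` are iterated integrals over base and
fibre. -/
structure IsCircleFibration (ℓ : (E' × ℝ) ≃L[ℝ] E) (f : X → Y) (a : Circle → X → X) : Prop where
  measurePreserving : MeasurePreserving ℓ
  contMDiff : ContMDiff I J ∞ f
  contMDiff_act : ∀ z, ContMDiff I I ∞ (a z)
  act_act : ∀ z w x, a z (a w x) = a (z * w) x
  one_act : ∀ x, a 1 x = x
  map_act : ∀ z x, f (a z x) = f x
  exists_act_eq : ∀ x x', f x = f x' → ∃ z, a z x = x'
  surjective : Function.Surjective f
  exists_chart : ∀ x, ∃ e e', IsFibreChart I J ℓ f a e e' ∧ x ∈ e.source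

variable {I J} {ℓ : (E' × ℝ) ≃L[ℝ] E} {f : X → Y} {a : Circle → X → X}

/-- An invariant distribution vanishes on `h dy` if the integrals of `h` over the fibres vanish:
such an `h` is the derivative of a compactly supported function along the orbits, hence the limit
of difference quotients, on which the distribution vanishes. -/
theorem IsFibreChart.apply_eq_zero [IsManifold I ∞ X] [T2Space X] [SigmaCompactSpace X]
    {e : OpenPartialHomeomorph X H} {e' : OpenPartialHomeomorph Y H'}
    (h : IsFibreChart I J ℓ f a e e') (ha : ∀ z, Continuous (a z)) {v : distributions I X}
    (hv : v ∈ invariantDistributions I a) {g : E → ℂ} (hg : ContDiff ℝ ∞ g)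
    (hc : HasCompactSupport g) (ht : tsupport g ⊆ (e.extend I).target)
    (h0 : ∀ y, fibreIntegral ℓ g y = 0) {μ : testDensities I X} (hμ : μ.1 = ofChart I e g) :
    v.1 μ = 0 := by
  obtain ⟨F, K, b, hF, hK, hKt, hb, hFs, hFd⟩ :=
    exists_fderiv_eq_of_fibreIntegral_eq_zero hg hc (h.target_eq ▸ ht) h0
  set w : E := ℓ (0, 1) with hw
  -- For `|s| ≤ δ` the translates of `F` by `s • w` have support in a fixed compact set `Q` inside
  -- the chart, so that one seminorm estimate for `v` applies to all of them.
  let δ : ℝ := (Real.pi - b) / 2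
  have hδ : 0 < δ := half_pos (sub_pos.2 hb)
  have hbδ : b + δ < Real.pi := by
    have : δ = (Real.pi - b) / 2 := rfl
    linarith
  let Q : Set E := ℓ '' (K ×ˢ Icc (-(b + δ)) (b + δ))
  have hQ : IsCompact Q := (hK.prod isCompact_Icc).image ℓ.continuous
  have hQt : Q ⊆ (e.extend I).target := by
    rw [h.target_eq]
    refine image_mono (prod_mono hKt fun t ht => ?_)
    exact ⟨by linarith [ht.1], by linarith [ht.2]⟩
  have hFQ : ∀ s, |s| ≤ δ → tsupport (fun x => F (x + s • w)) ⊆ Q := by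
    intro s hs
    refine closure_minimal (fun x hx => ?_) hQ.isClosed
    obtain ⟨h1, h2⟩ := hFs _ hx
    have h3 : ℓ.symm (x + s • w) = ((ℓ.symm x).1, (ℓ.symm x).2 + s) := by
      rw [hw, map_add, map_smul, ℓ.symm_apply_apply]
      ext <;> simp
    rw [h3] at h1 h2
    refine ⟨ℓ.symm x, ⟨h1, ?_⟩, ℓ.apply_symm_apply x⟩
    have h4 := abs_le.1 h2
    have h5 := abs_le.1 hs
    dsimp only at h4
    constructor <;> linarith
  have hFs' : ∀ s : ℝ, ContDiff ℝ ∞ fun x => F (x + s • w) := fun s => hF.comp (by fun_prop)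
  have hcs : ∀ s, |s| ≤ δ → HasCompactSupport fun x => F (x + s • w) := fun s hs =>
    hQ.of_isClosed_subset (isClosed_tsupport _) (hFQ s hs)
  have hmem : ∀ s, |s| ≤ δ → ofChart I e (fun x => F (x + s • w)) ∈ testDensities I X :=
    fun s hs => ofChart_mem_testDensities h.mem (hFs' s) (hcs s hs) ((hFQ s hs).trans hQt)
  have hδ0 : |(0 : ℝ)| ≤ δ := by rw [abs_zero]; exact hδ.le
  have hF0 : (fun x => F (x + (0 : ℝ) • w)) = F := by simp
  have hm0 := hmem 0 hδ0
  have hFc := hcs 0 hδ0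
  have hFQ0 := hFQ 0 hδ0
  rw [hF0] at hm0 hFc hFQ0
  -- The translates are rotations of each other, hence `v` takes the same value on them.
  have hinv : ∀ s (hs : |s| ≤ δ), v.1 ⟨_, hmem s hs⟩ = v.1 ⟨_, hm0⟩ := fun s hs =>
    hv (Circle.exp (-s)) ⟨_, hm0⟩ ⟨_, hmem s hs⟩
      (h.pushforward_act_ofChart ha hF hK hKt (by linarith) hFs).symm
  obtain ⟨N, C, hNC⟩ := boundedOn_of_mem_distributions v.2 h.mem hQt hQ
  -- Two derivatives more than the order of `v` control the error of the difference quotients.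
  obtain ⟨B, hB⟩ : ∃ B, ∀ j ≤ N + 2, ∀ x, ‖iteratedFDeriv ℝ j F x‖ ≤ B := by
    have h1 : ∀ j : ℕ, ∃ B, ∀ x, ‖iteratedFDeriv ℝ j F x‖ ≤ B := fun j =>
      (hF.continuous_iteratedFDeriv (natCast_le_infty j)).bounded_above_of_compact_support
        (hFc.iteratedFDeriv j)
    choose B hB using h1
    refine ⟨∑ j ∈ Finset.range (N + 3), B j, fun j hj x => (hB j x).trans ?_⟩
    exact Finset.single_le_sum (f := B) (fun i _ => (norm_nonneg _).trans (hB i x))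
      (Finset.mem_range.2 (by omega))
  have key : ∀ s : ℝ, s ≠ 0 → |s| ≤ δ → ‖v.1 μ‖ ≤ C * (|s| * (B * ‖w‖ ^ 2)) := by
    intro s hs0 hs
    have hd : (fun x => fderiv ℝ F x w - s⁻¹ • (F (x + s • w) - F x)) =
        g - (s⁻¹ : ℂ) • ((fun x => F (x + s • w)) - F) := by
      funext x
      simp [hFd]
    have hi := integrableOn_of_tsupport hg.continuous hc (e.extend I).target
    have hi0 := integrableOn_of_tsupport hF.continuous hFc (e.extend I).target
    have his := integrableOn_of_tsupport (hFs' s).continuous (hcs s hs) (e.extend I).target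
    -- `v` vanishes on the difference quotient, so it takes the same value on `μ` and on the
    -- error `ν`.
    let ν : testDensities I X := μ + (-(s⁻¹ : ℂ)) •
      (⟨_, hmem s hs⟩ + (-1 : ℂ) • ⟨_, hm0⟩)
    have hν : ν.1 = ofChart I e (fun x => fderiv ℝ F x w - s⁻¹ • (F (x + s • w) - F x)) := by
      have e1 : g - (s⁻¹ : ℂ) • ((fun x => F (x + s • w)) - F) =
          g + (-(s⁻¹ : ℂ)) • ((fun x => F (x + s • w)) + (-1 : ℂ) • F) := by
        funext x
        simp only [Pi.sub_apply, Pi.add_apply, Pi.smul_apply, smul_eq_mul]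
        ring
      rw [hd, e1, ofChart_add hi ((his.add (hi0.smul (-1 : ℂ))).smul _),
        ofChart_smul _ (his.add (hi0.smul (-1 : ℂ))), ofChart_add his (hi0.smul (-1 : ℂ)),
        ofChart_smul _ hi0, ← hμ]
      rfl
    have hvν : v.1 ν = v.1 μ := by
      have e1 : v.1 ν = v.1 μ + (-(s⁻¹ : ℂ)) •
          (v.1 ⟨_, hmem s hs⟩ + (-1 : ℂ) • v.1 ⟨_, hm0⟩) := by
        rw [← map_smul v.1, ← map_add v.1, ← map_smul v.1, ← map_add v.1]
      rw [e1, hinv s hs, neg_one_smul, add_neg_cancel, smul_zero, add_zero]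
    rw [← hvν]
    refine hNC ν _ _ ?_ ?_ hν fun k hk x => ?_
    · exact ((hF.fderiv_right (by simp)).clm_apply contDiff_const).sub
        (((hFs' s).sub hF).const_smul s⁻¹)
    · rw [hd]
      have hgQ : tsupport g ⊆ Q := by
        refine closure_minimal (fun x hx => ?_) hQ.isClosed
        by_contra hxQ
        have hx0 : x ∉ tsupport (fderiv ℝ F) := fun hx' =>
          hxQ (hFQ0 (tsupport_fderiv_subset ℝ hx'))
        refine hx ?_
        rw [← hFd, image_eq_zero_of_notMem_tsupport hx0, _root_.zero_apply]
      refine closure_minimal (fun x hx => ?_) hQ.isClosed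
      by_contra hxQ
      refine hx ?_
      have e1 := image_eq_zero_of_notMem_tsupport (mt (@hgQ x) hxQ)
      have e2 := image_eq_zero_of_notMem_tsupport (mt (@hFQ0 x) hxQ)
      have e3 := image_eq_zero_of_notMem_tsupport (mt (@hFQ s hs x) hxQ)
      beta_reduce at e3
      simp [e1, e2, e3]
    · exact norm_iteratedFDeriv_fderiv_sub_le hF w k (fun j hj => hB j (by omega)) hs0 x
  by_contra hne
  have hpos : 0 < ‖v.1 μ‖ := norm_pos_iff.2 hne
  have hlim : Filter.Tendsto (fun s : ℝ => C * (|s| * (B * ‖w‖ ^ 2))) (nhds 0) (nhds 0) := by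
    have : Continuous fun s : ℝ => C * (|s| * (B * ‖w‖ ^ 2)) := by fun_prop
    simpa using this.tendsto 0
  have hev : ∀ᶠ s : ℝ in nhdsWithin 0 {0}ᶜ, C * (|s| * (B * ‖w‖ ^ 2)) < ‖v.1 μ‖ :=
    (hlim.mono_left nhdsWithin_le_nhds).eventually_lt_const hpos
  have hev2 : ∀ᶠ s : ℝ in nhdsWithin 0 {0}ᶜ, |s| ≤ δ := by
    refine nhdsWithin_le_nhds (Filter.mem_of_superset (Metric.closedBall_mem_nhds 0 hδ) ?_)
    intro s hs
    simpa using hs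
  obtain ⟨s, ⟨h1, h2⟩, h3⟩ := ((hev.and hev2).and self_mem_nhdsWithin).exists
  exact absurd (key s h3 h2) (not_le.2 h1)

end CircleFibration

section CircleFibration

variable {E E' : Type} [NormedAddCommGroup E] [NormedSpace ℝ E] [FiniteDimensional ℝ E]
  [MeasureSpace E] [BorelSpace E] [(volume : Measure E).IsAddHaarMeasure]
  [NormedAddCommGroup E'] [NormedSpace ℝ E'] [FiniteDimensional ℝ E']
  [MeasureSpace E'] [BorelSpace E'] [(volume : Measure E').IsAddHaarMeasure]
  {H : Type*} [TopologicalSpace H] {I : ModelWithCorners ℝ E H} [I.Boundaryless]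
  {H' : Type*} [TopologicalSpace H'] {J : ModelWithCorners ℝ E' H'} [J.Boundaryless]
  {X : Type*} [TopologicalSpace X] [ChartedSpace H X] [IsManifold I ∞ X] [T2Space X]
  [SigmaCompactSpace X]
  {Y : Type*} [TopologicalSpace Y] [ChartedSpace H' Y] [IsManifold J ∞ Y] [T2Space Y]
  [SigmaCompactSpace Y]
  {ℓ : (E' × ℝ) ≃L[ℝ] E} {f : X → Y} {a : Circle → X → X}

namespace IsCircleFibration

theorem exists_charts (h : IsCircleFibration I J ℓ f a) :
    ∃ (c : X → OpenPartialHomeomorph X H) (c' : X → OpenPartialHomeomorph Y H'),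
      (∀ x, IsFibreChart I J ℓ f a (c x) (c' x)) ∧ ∀ x, x ∈ (c x).source := by
  choose c c' hc hx using h.exists_chart
  exact ⟨c, c', hc, hx⟩

/-- The action of one element of the circle as a homeomorphism. -/
def actHomeomorph (h : IsCircleFibration I J ℓ f a) (z : Circle) : X ≃ₜ X where
  toFun := a z
  invFun := a z⁻¹
  left_inv x := by rw [h.act_act, inv_mul_cancel, h.one_act]
  right_inv x := by rw [h.act_act, mul_inv_cancel, h.one_act]
  continuous_toFun := (h.contMDiff_act z).continuous
  continuous_invFun := (h.contMDiff_act z⁻¹).continuous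

theorem pushforward_act_mem (h : IsCircleFibration I J ℓ f a) {μ : BorelMeasure X}
    (hμ : μ ∈ testDensities I X) (z : Circle) : pushforward (a z) μ ∈ testDensities I X :=
  pushforward_mem_testDensities_of_diffeo (φ := h.actHomeomorph z) hμ (h.contMDiff_act z)
    (h.contMDiff_act z⁻¹)

theorem pushforward_pushforward_act (h : IsCircleFibration I J ℓ f a) (μ : BorelMeasure X)
    (z : Circle) : pushforward f (pushforward (a z) μ) = pushforward f μ := by
  rw [pushforward_pushforward (h.contMDiff_act z).continuous h.contMDiff.continuous]
  congr 1
  exact funext fun x => h.map_act z x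

/-- Integration over the fibres preserves smooth compactly supported densities. -/
theorem pushforward_mem (h : IsCircleFibration I J ℓ f a) {μ : BorelMeasure X}
    (hμ : μ ∈ testDensities I X) : pushforward f μ ∈ testDensities J Y := by
  obtain ⟨c, c', hc, hx⟩ := h.exists_charts
  obtain ⟨K, hK, h0⟩ := hμ.1
  obtain ⟨s, ρ, hρ, hρ1, hρ2, hρt, hρs⟩ := exists_partition I hK (fun x => (c x).open_source)
    fun x _ => mem_iUnion.2 ⟨x, hx x⟩
  rw [eq_sum_weight hK.isClosed (fun i => (hρ i).continuous) hρ1 hρ2 hρs h0,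
    ← pushforwardₗ_apply, map_sum]
  refine Submodule.sum_mem _ fun x _ => ?_
  have hK' : IsCompact (K ∩ tsupport (ρ x)) := hK.inter_right (isClosed_tsupport _)
  have hKc : K ∩ tsupport (ρ x) ⊆ (c x).source := inter_subset_right.trans (hρt x)
  obtain ⟨g, hg, hgc, hgt, heq⟩ := exists_eq_ofChart (hc x).mem
    (weight_mem_testDensities hμ (hρ x) (hρ1 x)) hK' hKc
    (SupportedOn.weight h0 (hρ x).continuous (hρ1 x))
  rw [pushforwardₗ_apply, heq,
    (hc x).pushforward_ofChart h.measurePreserving h.contMDiff.continuous hg hgc]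
  refine (hc x).fibreIntegral_mem hg hgc (hgt.trans ?_)
  rw [image_extend_eq I _ hKc]
  exact inter_subset_left

/-- Integration over the fibres as a linear map between the spaces of test densities. -/
def integrate (h : IsCircleFibration I J ℓ f a) : testDensities I X →ₗ[ℂ] testDensities J Y :=
  ((pushforwardₗ f).domRestrict (testDensities I X)).codRestrict _ fun μ => h.pushforward_mem μ.2

theorem coe_integrate (h : IsCircleFibration I J ℓ f a) (μ : testDensities I X) :
    (h.integrate μ).1 = pushforward f μ.1 := rfl

/-- Every test density on the base is a push-forward: cut it into pieces supported in adapted charts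
and spread each piece over the fibres with a bump function. -/
theorem integrate_surjective (h : IsCircleFibration I J ℓ f a) :
    Function.Surjective h.integrate := by
  intro η
  obtain ⟨c, c', hc, hx⟩ := h.exists_charts
  obtain ⟨χ, hχ, hχc, hχt, hχ1⟩ := exists_bump
  obtain ⟨K, hK, h0⟩ := η.2.1
  obtain ⟨s, ρ, hρ, hρ1, hρ2, hρt, hρs⟩ := exists_partition J hK (fun x => (c' x).open_source)
    fun y _ => by
      obtain ⟨x, rfl⟩ := h.surjective y
      exact mem_iUnion.2 ⟨x, (hc x).map_mem_source (hx x)⟩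
  have key : ∀ x, ∃ μ : testDensities I X, pushforward f μ.1 = weight (ρ x) η.1 := by
    intro x
    have hK' : IsCompact (K ∩ tsupport (ρ x)) := hK.inter_right (isClosed_tsupport _)
    have hKc : K ∩ tsupport (ρ x) ⊆ (c' x).source := inter_subset_right.trans (hρt x)
    obtain ⟨G, hG, hGc, hGt, heq⟩ := exists_eq_ofChart (hc x).mem'
      (weight_mem_testDensities η.2 (hρ x) (hρ1 x)) hK' hKc
      (SupportedOn.weight h0 (hρ x).continuous (hρ1 x))
    have hGt' : tsupport G ⊆ ((c' x).extend J).target := by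
      refine hGt.trans ?_
      rw [image_extend_eq J _ hKc]
      exact inter_subset_left
    have hlc : HasCompactSupport (lift ℓ χ G) :=
      ((hGc.prod hχc).image ℓ.continuous).of_isClosed_subset (isClosed_tsupport _)
        (tsupport_lift_subset hχc hGc subset_rfl)
    refine ⟨⟨ofChart I (c x) (lift ℓ χ G), ofChart_mem_testDensities (hc x).mem
      (contDiff_lift hχ hG) hlc
      ((hc x).tsupport_lift_subset_target hχc hχt hGc hGt' subset_rfl)⟩, ?_⟩
    rw [(hc x).pushforward_ofChart h.measurePreserving h.contMDiff.continuous
      (contDiff_lift hχ hG) hlc, fibreIntegral_lift hχ1, heq]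
  choose μ hμ using key
  refine ⟨∑ x ∈ s, μ x, Subtype.ext ?_⟩
  rw [map_sum, AddSubmonoidClass.coe_finsetSum,
    eq_sum_weight hK.isClosed (fun i => (hρ i).continuous) hρ1 hρ2 hρs h0]
  exact Finset.sum_congr rfl fun x _ => hμ x

/-- The invariant distribution `v` kills a density with vanishing push-forward if that density is
supported over the domain of an adapted chart: rotations move the pieces of the density into that
chart. -/
theorem apply_eq_zero_of_supportedOn (h : IsCircleFibration I J ℓ f a)
    {e : OpenPartialHomeomorph X H} {e' : OpenPartialHomeomorph Y H'}
    (he : IsFibreChart I J ℓ f a e e') {v : distributions I X}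
    (hv : v ∈ invariantDistributions I a) {μ : testDensities I X} {K : Set X} (hK : IsCompact K)
    (hKe : K ⊆ f ⁻¹' e'.source) (h0 : SupportedOn μ.1 K) (hμ : pushforward f μ.1 = 0) :
    v.1 μ = 0 := by
  have hac : ∀ z, Continuous (a z) := fun z => (h.contMDiff_act z).continuous
  obtain ⟨s, ρ, hρ, hρ1, hρ2, hρt, hρs⟩ := exists_partition I hK (U := fun z => a z ⁻¹' e.source)
    (fun z => e.open_source.preimage (hac z)) fun x hxK => by
      obtain ⟨x', hx', hxx'⟩ := he.exists_mem_source (hKe hxK)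
      obtain ⟨z, rfl⟩ := h.exists_act_eq x x' hxx'.symm
      exact mem_iUnion.2 ⟨z, hx'⟩
  -- The piece `ν z` of `μ` is rotated into the domain of `e` by `z`, which changes neither its
  -- push-forward nor the value of `v`.
  let ν : Circle → testDensities I X := fun z =>
    ⟨weight (ρ z) μ.1, weight_mem_testDensities μ.2 (hρ z) (hρ1 z)⟩
  let ν' : Circle → testDensities I X := fun z =>
    ⟨pushforward (a z) (ν z).1, h.pushforward_act_mem (ν z).2 z⟩
  have hsum : μ = ∑ z ∈ s, ν z := by
    refine Subtype.ext ?_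
    rw [AddSubmonoidClass.coe_finsetSum]
    exact eq_sum_weight hK.isClosed (fun i => (hρ i).continuous) hρ1 hρ2 hρs h0
  have key : ∀ z, ∃ g : E → ℂ, ContDiff ℝ ∞ g ∧ HasCompactSupport g ∧
      tsupport g ⊆ (e.extend I).target ∧ (ν' z).1 = ofChart I e g := by
    intro z
    have hKc : a z '' (K ∩ tsupport (ρ z)) ⊆ e.source :=
      image_subset_iff.2 (inter_subset_right.trans (hρt z))
    obtain ⟨g, hg, hgc, hgt, heq⟩ := exists_eq_ofChart he.mem (ν' z).2
      ((hK.inter_right (isClosed_tsupport _)).image (hac z)) hKc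
      ((SupportedOn.weight h0 (hρ z).continuous (hρ1 z)).pushforward (hac z))
    refine ⟨g, hg, hgc, hgt.trans ?_, heq⟩
    rw [image_extend_eq I _ hKc]
    exact inter_subset_left
  choose g hg hgc hgt heq using key
  have hG : ContDiff ℝ ∞ (∑ z ∈ s, g z) := by
    have := ContDiff.sum (s := s) fun z _ => hg z
    convert this using 1
    ext x
    simp
  have hGQ : tsupport (∑ z ∈ s, g z) ⊆ ⋃ z ∈ s, tsupport (g z) := by
    refine closure_minimal (fun x hx => ?_)
      (s.finite_toSet.isClosed_biUnion fun z _ => isClosed_tsupport (g z))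
    by_contra hne
    refine hx ?_
    rw [Finset.sum_apply]
    refine Finset.sum_eq_zero fun z hz => image_eq_zero_of_notMem_tsupport fun hzx => hne ?_
    exact mem_iUnion₂.2 ⟨z, hz, hzx⟩
  have hGc : HasCompactSupport (∑ z ∈ s, g z) :=
    (s.isCompact_biUnion fun z _ => hgc z).of_isClosed_subset (isClosed_tsupport _) hGQ
  have hGt : tsupport (∑ z ∈ s, g z) ⊆ (e.extend I).target :=
    hGQ.trans (iUnion₂_subset fun z _ => hgt z)
  have hsum' : (∑ z ∈ s, ν' z).1 = ofChart I e (∑ z ∈ s, g z) := by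
    rw [AddSubmonoidClass.coe_finsetSum,
      ofChart_sum s fun z => integrableOn_of_tsupport (hg z).continuous (hgc z) _]
    exact Finset.sum_congr rfl fun z _ => heq z
  have hpush : pushforward f (∑ z ∈ s, ν' z).1 = 0 := by
    rw [AddSubmonoidClass.coe_finsetSum, ← pushforwardₗ_apply, map_sum, ← hμ, hsum,
      AddSubmonoidClass.coe_finsetSum, ← pushforwardₗ_apply, map_sum]
    exact Finset.sum_congr rfl fun z _ => h.pushforward_pushforward_act _ z
  rw [hsum', he.pushforward_ofChart h.measurePreserving h.contMDiff.continuous hG hGc] at hpush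
  have hft := tsupport_fibreIntegral_subset (ℓ := ℓ) hGc subset_rfl
  have hfc := (hGc.image continuous_baseCoord).of_isClosed_subset
    (isClosed_tsupport (fibreIntegral ℓ (∑ z ∈ s, g z))) hft
  have hfs := (contDiff_fibreIntegral (ℓ := ℓ) hG).continuous
  have hzero := ofChart_eq_zero_iff hfs.continuousOn (integrableOn_of_tsupport hfs hfc _) hpush
  have hz : ∀ y, fibreIntegral ℓ (∑ z ∈ s, g z) y = 0 := by
    intro y
    by_cases hy : y ∈ (e'.extend J).target
    · exact hzero hy
    · exact image_eq_zero_of_notMem_tsupport fun hyt =>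
        hy (he.baseCoord_image_subset hGt (hft hyt))
  have hfin : v.1 (∑ z ∈ s, ν' z) = 0 := he.apply_eq_zero hac hv hG hGc hGt hz hsum'
  rw [hsum, map_sum]
  rw [map_sum] at hfin
  rw [← hfin]
  exact Finset.sum_congr rfl fun z _ => (hv z (ν z) (ν' z) rfl).symm

/-- An invariant distribution vanishes on the densities with vanishing push-forward: such a density
is cut into pieces by functions pulled back from the base, which keeps the push-forwards zero. -/
theorem apply_eq_zero_of_integrate_eq_zero (h : IsCircleFibration I J ℓ f a)
    {v : distributions I X} (hv : v ∈ invariantDistributions I a) {μ : testDensities I X}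
    (hμ : h.integrate μ = 0) : v.1 μ = 0 := by
  obtain ⟨c, c', hc, hx⟩ := h.exists_charts
  obtain ⟨K, hK, h0⟩ := μ.2.1
  have hf := h.contMDiff.continuous
  have hμ0 : pushforward f μ.1 = 0 := congrArg Subtype.val hμ
  obtain ⟨s, ρ, hρ, hρ1, hρ2, hρt, hρs⟩ := exists_partition J (hK.image hf)
    (fun x => (c' x).open_source) fun y _ => by
      obtain ⟨x, rfl⟩ := h.surjective y
      exact mem_iUnion.2 ⟨x, (hc x).map_mem_source (hx x)⟩
  -- A partition of unity on the base, pulled back to the total space.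
  have hρf : ∀ x, ContMDiff I 𝓘(ℝ, ℝ) ∞ (ρ x ∘ f) := fun x => (hρ x).comp h.contMDiff
  have hρf1 : ∀ x x', ‖(ρ x ∘ f) x'‖ ≤ 1 := fun x x' => hρ1 x (f x')
  let ν : X → testDensities I X := fun x =>
    ⟨weight (ρ x ∘ f) μ.1, weight_mem_testDensities μ.2 (hρf x) (hρf1 x)⟩
  have hsum : μ = ∑ x ∈ s, ν x := by
    refine Subtype.ext ?_
    rw [AddSubmonoidClass.coe_finsetSum]
    exact eq_sum_weight hK.isClosed (fun x => (hρf x).continuous) hρf1 (fun x => hρ2 (f x))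
      (fun x hxK => hρs (f x) ⟨x, hxK, rfl⟩) h0
  rw [hsum, map_sum]
  refine Finset.sum_eq_zero fun x _ => ?_
  refine h.apply_eq_zero_of_supportedOn (hc x) hv (hK.inter_right (isClosed_tsupport (ρ x ∘ f)))
    ?_ (SupportedOn.weight h0 (hρf x).continuous (hρf1 x)) ?_
  · refine inter_subset_right.trans ((tsupport_comp_subset_preimage _ hf).trans ?_)
    exact preimage_mono (hρt x)
  · refine VectorMeasure.ext fun B hB => ?_
    rw [pushforward_apply hf _ hB]
    refine weight_comp_preimage_eq_zero hf (hρ x).continuous (hρ1 x) hB fun B' hB' _ => ?_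
    rw [← pushforward_apply hf _ hB', hμ0]
    rfl

/-- The transpose of the integration over the fibres preserves continuity. -/
theorem comp_integrate_mem (h : IsCircleFibration I J ℓ f a) (u : distributions J Y) :
    u.1.comp h.integrate ∈ distributions I X := by
  obtain ⟨c, c', hc, hx⟩ := h.exists_charts
  refine mem_distributions_of_cover (c := c) (fun x => (hc x).mem) (fun x => ⟨x, hx x⟩)
    fun x K hKt hK => ?_
  have hK' : IsCompact (baseCoord ℓ '' K) := hK.image continuous_baseCoord
  obtain ⟨N, C, hNC⟩ := boundedOn_of_mem_distributions u.2 (hc x).mem'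
    ((hc x).baseCoord_image_subset hKt) hK'
  refine ⟨N, C * (2 * Real.pi * (1 + ‖(ℓ : (E' × ℝ) →L[ℝ] E)‖) ^ N), fun μ g r hg hgK hμ hr => ?_⟩
  have hgc : HasCompactSupport g := hK.of_isClosed_subset (isClosed_tsupport g) hgK
  have h1 : (h.integrate μ).1 = ofChart J (c' x) (fibreIntegral ℓ g) := by
    rw [coe_integrate, hμ,
      (hc x).pushforward_ofChart h.measurePreserving h.contMDiff.continuous hg hgc]
  refine (hNC (h.integrate μ) (fibreIntegral ℓ g) _ (contDiff_fibreIntegral hg)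
    (tsupport_fibreIntegral_subset hK hgK) h1 fun k hk y =>
      norm_iteratedFDeriv_fibreIntegral_le hg hk (hr k hk) y).trans (le_of_eq ?_)
  ring

/-- A functional on the test densities of the base is continuous if its composition with the
integration over the fibres is, because `lift` is a continuous local right inverse of the latter. -/
theorem mem_distributions_of_comp_integrate (h : IsCircleFibration I J ℓ f a)
    {u : testDensities J Y →ₗ[ℂ] ℂ} (hu : u.comp h.integrate ∈ distributions I X) :
    u ∈ distributions J Y := by
  obtain ⟨c, c', hc, hx⟩ := h.exists_charts
  obtain ⟨χ, hχ, hχc, hχt, hχ1⟩ := exists_bump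
  refine mem_distributions_of_cover (c := c') (fun x => (hc x).mem') (fun y => ?_)
    fun x K hKt hK => ?_
  · obtain ⟨x, rfl⟩ := h.surjective y
    exact ⟨x, (hc x).map_mem_source (hx x)⟩
  have hL : IsCompact (ℓ '' (K ×ˢ tsupport χ)) := (hK.prod hχc).image ℓ.continuous
  have hLt : ℓ '' (K ×ˢ tsupport χ) ⊆ ((c x).extend I).target := by
    rw [(hc x).target_eq]
    exact image_mono (prod_mono hKt hχt)
  obtain ⟨N, C, hNC⟩ := boundedOn_of_mem_distributions hu (hc x).mem hLt hL
  obtain ⟨D, hD0, hD⟩ := exists_norm_iteratedFDeriv_lift_le (ℓ := ℓ) hχ hχc hK N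
  refine ⟨N, C * D, fun η G r hG hGK hη hr => ?_⟩
  have hlt := tsupport_lift_subset (ℓ := ℓ) hχc hK hGK
  have hlc : HasCompactSupport (lift ℓ χ G) := hL.of_isClosed_subset (isClosed_tsupport _) hlt
  let μ : testDensities I X := ⟨ofChart I (c x) (lift ℓ χ G),
    ofChart_mem_testDensities (hc x).mem (contDiff_lift hχ hG) hlc (hlt.trans hLt)⟩
  have hμη : h.integrate μ = η := by
    refine Subtype.ext ?_
    rw [coe_integrate, (hc x).pushforward_ofChart h.measurePreserving h.contMDiff.continuous
      (contDiff_lift hχ hG) hlc, fibreIntegral_lift hχ1, hη]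
  rw [← hμη, mul_assoc]
  exact hNC μ _ _ (contDiff_lift hχ hG) hlt rfl fun k hk => hD G r hG hGK hr k hk

/-- The pull-back of distributions, as the transpose of the integration over the fibres. -/
def pullback (h : IsCircleFibration I J ℓ f a) :
    distributions J Y →ₗ[ℂ] invariantDistributions I a where
  toFun u := ⟨⟨u.1.comp h.integrate, h.comp_integrate_mem u⟩, fun z μ ν hν => by
    have : h.integrate ν = h.integrate μ := by
      refine Subtype.ext ?_
      rw [coe_integrate, coe_integrate, hν, h.pushforward_pushforward_act]
    change u.1 (h.integrate ν) = u.1 (h.integrate μ)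
    rw [this]⟩
  map_add' _ _ := rfl
  map_smul' _ _ := rfl

theorem pullback_apply (h : IsCircleFibration I J ℓ f a) (u : distributions J Y)
    (μ : testDensities I X) : (h.pullback u).1.1 μ = u.1 (h.integrate μ) := rfl

/-- The pull-back is injective because the integration over the fibres is surjective, and its image
consists of all invariant distributions because those vanish on the kernel of the integration. -/
theorem pullback_bijective (h : IsCircleFibration I J ℓ f a) :
    Function.Bijective h.pullback := by
  constructor
  · intro u u' huu
    refine Subtype.ext (LinearMap.ext fun η => ?_)
    obtain ⟨μ, rfl⟩ := h.integrate_surjective η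
    rw [← pullback_apply, ← pullback_apply, huu]
  · intro v
    let σ := Function.surjInv h.integrate_surjective
    have hσ : ∀ η, h.integrate (σ η) = η := Function.surjInv_eq h.integrate_surjective
    have hv : ∀ μ ν, h.integrate μ = h.integrate ν → v.1.1 μ = v.1.1 ν := fun μ ν hμν => by
      have h1 : h.integrate (μ + (-1 : ℂ) • ν) = 0 := by
        have h3 : h.integrate ν + (-1 : ℂ) • h.integrate ν = ((1 : ℂ) + -1) • h.integrate ν := by
          rw [add_smul, one_smul]
        rw [map_add, map_smul, hμν, h3, add_neg_cancel, zero_smul]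
      have h2 := h.apply_eq_zero_of_integrate_eq_zero v.2 h1
      rwa [map_add, map_smul, neg_one_smul, ← sub_eq_add_neg, sub_eq_zero] at h2
    let u : testDensities J Y →ₗ[ℂ] ℂ :=
      { toFun := fun η => v.1.1 (σ η)
        map_add' := fun η η' => by
          rw [← map_add]
          exact hv _ _ (by rw [map_add, hσ, hσ, hσ])
        map_smul' := fun c η => by
          rw [← map_smul]
          exact hv _ _ (by rw [map_smul, hσ, hσ, RingHom.id_apply]) }
    have key : u.comp h.integrate = v.1.1 := LinearMap.ext fun μ => hv _ _ (hσ _)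
    refine ⟨⟨u, h.mem_distributions_of_comp_integrate ?_⟩, ?_⟩
    · rw [key]
      exact v.1.2
    · exact Subtype.ext (Subtype.ext key)

/-- The pull-back identifies the distributions on the base of a circle fibration with the invariant
distributions on its total space. -/
theorem exists_linearEquiv (h : IsCircleFibration I J ℓ f a) :
    ∃ Φ : distributions J Y ≃ₗ[ℂ] invariantDistributions I a,
      ∀ u, IsPullback I J f u (Φ u).1 :=
  ⟨LinearEquiv.ofBijective h.pullback h.pullback_bijective,
    fun _ μ => ⟨h.pushforward_mem μ.2, rfl⟩⟩

end IsCircleFibration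

end CircleFibration

/-! ### Adapted charts of principal circle bundles -/

section ArgChart

theorem isManifold_circle : IsManifold (𝓡 1) ∞ Circle := IsManifold.of_le (n := ω) le_top

theorem lieGroup_circle : LieGroup (𝓡 1) ∞ Circle := LieGroup.of_le (n := ω) le_top

theorem contMDiff_circle_coe : ContMDiff (𝓡 1) 𝓘(ℝ, ℂ) ∞ (fun z : Circle => (z : ℂ)) := by
  have : Fact (Module.finrank ℝ ℂ = 1 + 1) := Complex.finrank_real_complex_fact
  exact contMDiff_coe_sphere

theorem contDiffAt_arg {z : ℂ} (hz : z ∈ Complex.slitPlane) : ContDiffAt ℝ ∞ Complex.arg z := by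
  have h : ContDiffAt ℝ ∞ Complex.log z := (Complex.contDiffAt_log hz).restrict_scalars ℝ
  have h2 := Complex.imCLM.contDiff.contDiffAt.comp z h
  refine h2.congr_of_eventuallyEq (Filter.Eventually.of_forall fun w => ?_)
  exact (Complex.log_im w).symm

/-- The angle `t ∈ (-π, π)` as a coordinate at the points `exp(it) b` of the circle. It is defined
off the point opposite to `b`. -/
def argChart (b : Circle) : OpenPartialHomeomorph Circle ℝ where
  toFun z := Complex.arg (z * b⁻¹ : Circle)
  invFun t := Circle.exp t * b
  source := {z | ((z * b⁻¹ : Circle) : ℂ) ∈ Complex.slitPlane}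
  target := Ioo (-Real.pi) Real.pi
  map_source' z hz := ⟨Complex.neg_pi_lt_arg _,
    lt_of_le_of_ne (Complex.arg_le_pi _) (Complex.mem_slitPlane_iff_arg.1 hz).1⟩
  map_target' t ht := by
    rw [mem_ofPred_eq, mul_inv_cancel_right, Complex.mem_slitPlane_iff_arg,
      Circle.arg_exp ht.1 ht.2.le]
    exact ⟨ht.2.ne, Circle.coe_ne_zero _⟩
  left_inv' z _ := by rw [Circle.exp_arg, inv_mul_cancel_right]
  right_inv' t ht := by rw [mul_inv_cancel_right, Circle.arg_exp ht.1 ht.2.le]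
  open_source := Complex.isOpen_slitPlane.preimage (by fun_prop)
  open_target := isOpen_Ioo
  continuousOn_toFun z hz := by
    have h : Continuous fun z : Circle => ((z * b⁻¹ : Circle) : ℂ) := by fun_prop
    exact ((Complex.continuousAt_arg hz).comp (x := z)
      (f := fun z : Circle => ((z * b⁻¹ : Circle) : ℂ))
      h.continuousAt).continuousWithinAt
  continuousOn_invFun := by fun_prop

theorem mem_argChart_source (b : Circle) : b ∈ (argChart b).source := by
  change ((b * b⁻¹ : Circle) : ℂ) ∈ Complex.slitPlane
  rw [mul_inv_cancel, Circle.coe_one]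
  exact Complex.one_mem_slitPlane

theorem contMDiffOn_argChart (b : Circle) :
    ContMDiffOn (𝓡 1) 𝓘(ℝ, ℝ) ∞ (argChart b) (argChart b).source := by
  intro z hz
  have := lieGroup_circle
  have h1 : ContMDiff (𝓡 1) 𝓘(ℝ, ℂ) ∞ (fun z : Circle => ((z * b⁻¹ : Circle) : ℂ)) :=
    contMDiff_circle_coe.comp (contMDiff_id.mul contMDiff_const)
  exact ((contDiffAt_arg hz).contMDiffAt.comp z (h1 z)).contMDiffWithinAt

theorem contMDiff_argChart_symm (b : Circle) :
    ContMDiff 𝓘(ℝ, ℝ) (𝓡 1) ∞ (argChart b).symm := by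
  have := lieGroup_circle
  exact contMDiff_circleExp.mul contMDiff_const

end ArgChart

section PrincipalBundle

variable {E E' : Type} [NormedAddCommGroup E] [NormedSpace ℝ E]
  [NormedAddCommGroup E'] [NormedSpace ℝ E']
  {H : Type*} [TopologicalSpace H] {I : ModelWithCorners ℝ E H} [I.Boundaryless]
  {H' : Type*} [TopologicalSpace H'] {J : ModelWithCorners ℝ E' H'} [J.Boundaryless]
  {X : Type*} [TopologicalSpace X] [ChartedSpace H X] [IsManifold I ∞ X]
  {Y : Type*} [TopologicalSpace Y] [ChartedSpace H' Y] [IsManifold J ∞ Y]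
  {f : X → Y} {a : Circle → X → X}

namespace IsPrincipalCircleBundle

/-- Every point of the total space of a principal circle bundle is described by a local
trivialization. -/
theorem exists_eq (h : IsPrincipalCircleBundle I J f a) (x : X) :
    ∃ (U : Set Y) (Φ : OpenPartialHomeomorph (Y × Circle) X), IsOpen U ∧ f x ∈ U ∧
      Φ.source = U ×ˢ univ ∧ Φ.target = f ⁻¹' U ∧
      ContMDiffOn (J.prod (𝓡 1)) I ∞ Φ Φ.source ∧
      ContMDiffOn I (J.prod (𝓡 1)) ∞ Φ.symm Φ.target ∧
      (∀ y' ∈ U, ∀ z w : Circle, f (Φ (y', z)) = y' ∧ Φ (y', w * z) = a w (Φ (y', z))) ∧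
      ∀ x', f x' ∈ U → Φ (f x', (Φ.symm x').2) = x' ∧ (Φ.symm x').1 = f x' := by
  obtain ⟨U, Φ, hU, hx, hs, ht, h1, h2, h3⟩ := h (f x)
  refine ⟨U, Φ, hU, hx, hs, ht, h1, h2, h3, fun x' hx' => ?_⟩
  have hx't : x' ∈ Φ.target := by rw [ht]; exact hx'
  have h4 := Φ.right_inv hx't
  have h5 : (Φ.symm x').1 ∈ U := by
    have := Φ.map_target hx't
    rw [hs] at this
    exact this.1
  have h6 := (h3 _ h5 (Φ.symm x').2 1).1
  rw [Prod.mk.eta, h4] at h6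
  refine ⟨?_, h6.symm⟩
  rw [h6, Prod.mk.eta, h4]

theorem contMDiff (h : IsPrincipalCircleBundle I J f a) : ContMDiff I J ∞ f := by
  intro x
  obtain ⟨U, Φ, hU, hx, hs, ht, h1, h2, h3, h4⟩ := h.exists_eq x
  have hxt : Φ.target ∈ nhds x := Φ.open_target.mem_nhds (by rw [ht]; exact hx)
  refine ContMDiffOn.contMDiffAt (s := Φ.target) ?_ hxt
  refine (contMDiff_fst.comp_contMDiffOn h2).congr fun x' hx' => ?_
  rw [ht] at hx'
  exact (h4 x' hx').2.symm

theorem contMDiff_act (h : IsPrincipalCircleBundle I J f a) (z : Circle) :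
    ContMDiff I I ∞ (a z) := by
  intro x
  have := lieGroup_circle
  obtain ⟨U, Φ, hU, hx, hs, ht, h1, h2, h3, h4⟩ := h.exists_eq x
  have hxt : Φ.target ∈ nhds x := Φ.open_target.mem_nhds (by rw [ht]; exact hx)
  refine ContMDiffOn.contMDiffAt (s := Φ.target) ?_ hxt
  have h5 : ContMDiff (J.prod (𝓡 1)) (J.prod (𝓡 1)) ∞ fun q : Y × Circle => (q.1, z * q.2) :=
    contMDiff_fst.prodMk (contMDiff_const.mul contMDiff_snd)
  refine (h1.comp (h5.comp_contMDiffOn h2) fun x' hx' => ?_).congr fun x' hx' => ?_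
  · rw [ht] at hx'
    rw [mem_preimage, hs, Function.comp_apply, (h4 x' hx').2]
    exact ⟨hx', mem_univ _⟩
  · rw [ht] at hx'
    have hx'' : f x' ∈ U := hx'
    rw [Function.comp_apply, Function.comp_apply, (h4 x' hx'').2, (h3 _ hx'' _ _).2,
      (h4 x' hx'').1]

theorem act_act (h : IsPrincipalCircleBundle I J f a) (z w : Circle) (x : X) :
    a z (a w x) = a (z * w) x := by
  obtain ⟨U, Φ, hU, hx, hs, ht, h1, h2, h3, h4⟩ := h.exists_eq x
  rw [← (h4 x hx).1, ← (h3 _ hx _ _).2, ← (h3 _ hx _ _).2, ← (h3 _ hx _ _).2, mul_assoc]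

theorem one_act (h : IsPrincipalCircleBundle I J f a) (x : X) : a 1 x = x := by
  obtain ⟨U, Φ, hU, hx, hs, ht, h1, h2, h3, h4⟩ := h.exists_eq x
  rw [← (h4 x hx).1, ← (h3 _ hx _ _).2, one_mul]

theorem map_act (h : IsPrincipalCircleBundle I J f a) (z : Circle) (x : X) : f (a z x) = f x := by
  obtain ⟨U, Φ, hU, hx, hs, ht, h1, h2, h3, h4⟩ := h.exists_eq x
  conv_lhs => rw [← (h4 x hx).1, ← (h3 _ hx _ _).2, (h3 _ hx _ 1).1]

theorem exists_act_eq (h : IsPrincipalCircleBundle I J f a) (x x' : X) (hxx : f x = f x') :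
    ∃ z, a z x = x' := by
  obtain ⟨U, Φ, hU, hx, hs, ht, h1, h2, h3, h4⟩ := h.exists_eq x
  refine ⟨(Φ.symm x').2 * (Φ.symm x).2⁻¹, ?_⟩
  have h5 := (h3 (f x) hx (Φ.symm x).2 ((Φ.symm x').2 * (Φ.symm x).2⁻¹)).2
  rw [(h4 x hx).1, inv_mul_cancel_right] at h5
  rw [← h5, hxx, (h4 x' (hxx ▸ hx)).1]

theorem surjective (h : IsPrincipalCircleBundle I J f a) : Function.Surjective f := by
  intro y
  obtain ⟨U, Φ, hU, hy, hs, ht, h1, h2, h3⟩ := h y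
  exact ⟨_, (h3 y hy 1 1).1⟩

/-- A local trivialization, a chart of the base and the angular coordinate of the circle combine to
an adapted chart. -/
theorem exists_chart (h : IsPrincipalCircleBundle I J f a) (ℓ : (E' × ℝ) ≃L[ℝ] E) (x : X) :
    ∃ e e', IsFibreChart I J ℓ f a e e' ∧ x ∈ e.source := by
  have := isManifold_circle
  obtain ⟨U, Φ, hU, hx, hs, ht, h1, h2, h3, h4⟩ := h.exists_eq x
  let b : Circle := (Φ.symm x).2
  let e' : OpenPartialHomeomorph Y H' := (chartAt H' (f x)).restr U
  have he' : e' ∈ IsManifold.maximalAtlas J ∞ Y :=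
    restr_mem_maximalAtlas _ (IsManifold.chart_mem_maximalAtlas (f x)) hU
  have hes : e'.source = (chartAt H' (f x)).source ∩ U := by
    rw [OpenPartialHomeomorph.restr_source, hU.interior_eq]
  have heU : e'.source ⊆ U := hes ▸ inter_subset_right
  -- Without boundary the models `I` and `J` are homeomorphisms, so the coordinates can be moved to
  -- the model space `H` of `X`.
  let j : (H' × ℝ) ≃ₜ H :=
    ((J.toHomeomorph.prodCongr (Homeomorph.refl ℝ)).trans ℓ.toHomeomorph).trans I.toHomeomorph.symm
  let e : OpenPartialHomeomorph X H := (Φ.symm ≫ₕ e'.prod (argChart b)).transHomeomorph j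
  have hsrc : ∀ x', x' ∈ e.source ↔ f x' ∈ e'.source ∧ (Φ.symm x').2 ∈ (argChart b).source := by
    intro x'
    have e1 : e.source = Φ.target ∩ Φ.symm ⁻¹' (e'.source ×ˢ (argChart b).source) := rfl
    rw [e1, ht]
    constructor
    · rintro ⟨hx', hp, hq⟩
      rw [(h4 x' hx').2] at hp
      exact ⟨hp, hq⟩
    · rintro ⟨hp, hq⟩
      refine ⟨heU hp, ?_, hq⟩
      rw [(h4 x' (heU hp)).2]
      exact hp
  have happ : ∀ x', e.extend I x' = ℓ (e'.extend J (Φ.symm x').1, argChart b (Φ.symm x').2) := by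
    intro x'
    exact I.toHomeomorph.apply_symm_apply _
  have hsymm : ∀ y t, (e.extend I).symm (ℓ (y, t)) =
      Φ ((e'.extend J).symm y, (argChart b).symm t) := by
    intro y t
    change Φ ((e'.prod (argChart b)).symm (j.symm (I.symm (ℓ (y, t))))) = _
    have : j.symm (I.symm (ℓ (y, t))) = (J.symm y, t) := by
      rw [Homeomorph.symm_apply_eq]
      change I.symm (ℓ (y, t)) = I.symm (ℓ (J (J.symm y), t))
      rw [J.right_inv (by rw [J.range_eq_univ]; exact mem_univ y)]
    rw [this]
    rfl
  have htgt : (e.extend I).target = ℓ '' ((e'.extend J).target ×ˢ Ioo (-Real.pi) Real.pi) := by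
    ext w
    obtain ⟨⟨y, t⟩, rfl⟩ := ℓ.surjective w
    rw [ℓ.injective.mem_set_image]
    constructor
    · intro hw
      have hw1 := (e.extend I).map_target hw
      rw [e.extend_source, hsrc] at hw1
      have hw2 := (e.extend I).right_inv hw
      rw [happ] at hw2
      have hw3 := ℓ.injective hw2
      have hx' : f ((e.extend I).symm (ℓ (y, t))) ∈ U := heU hw1.1
      rw [(h4 _ hx').2] at hw3
      obtain ⟨hw4, hw5⟩ := Prod.mk.inj hw3
      refine ⟨?_, ?_⟩
      · rw [← hw4]
        exact (e'.extend J).map_source (by rw [e'.extend_source]; exact hw1.1)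
      · change t ∈ _
        rw [← hw5]
        exact (argChart b).map_source hw1.2
    · rintro ⟨hy, htt⟩
      have hy1 := (e'.extend J).map_target hy
      rw [e'.extend_source] at hy1
      have hΦ : ((e'.extend J).symm y, (argChart b).symm t) ∈ Φ.source := by
        rw [hs]
        exact ⟨heU hy1, mem_univ _⟩
      have hxs : (e.extend I).symm (ℓ (y, t)) ∈ e.source := by
        rw [hsymm, hsrc, Φ.left_inv hΦ, (h3 _ (heU hy1) _ 1).1]
        exact ⟨hy1, (argChart b).map_target htt⟩
      rw [← e.extend_source (I := I)] at hxs
      have := (e.extend I).map_source hxs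
      rwa [hsymm, happ, Φ.left_inv hΦ, (e'.extend J).right_inv hy, (argChart b).right_inv htt]
        at this
  refine ⟨e, e', ⟨?_, he', htgt, ?_, ?_⟩, ?_⟩
  · refine mem_maximalAtlas_of_contMDiffOn ?_ ?_
    · have hm : ∀ x' ∈ e.source, x' ∈ Φ.target := fun x' hx' => by
        rw [ht]
        exact heU ((hsrc x').1 hx').1
      have hA : ContMDiffOn I 𝓘(ℝ, E') ∞ (fun x' => e'.extend J (Φ.symm x').1) e.source := by
        refine (e'.contMDiffOn_extend he').comp (contMDiff_fst.comp_contMDiffOn (h2.mono hm))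
          fun x' hx' => ?_
        have := (hsrc x').1 hx'
        change (Φ.symm x').1 ∈ e'.source
        rw [(h4 x' (heU this.1)).2]
        exact this.1
      have hB : ContMDiffOn I 𝓘(ℝ, ℝ) ∞ (fun x' => argChart b (Φ.symm x').2) e.source :=
        (contMDiffOn_argChart b).comp (contMDiff_snd.comp_contMDiffOn (h2.mono hm))
          fun x' hx' => ((hsrc x').1 hx').2
      have hC := ℓ.contDiff.contMDiff.comp_contMDiffOn (hA.prodMk_space hB)
      exact hC.congr fun x' _ => happ x'
    · have hA : ContMDiffOn 𝓘(ℝ, E) J ∞ (fun w => (e'.extend J).symm (ℓ.symm w).1)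
          (e.extend I).target := by
        have h5 := contMDiffOn_extend_symm he'
        rw [← e'.extend_target'] at h5
        refine h5.comp (contDiff_fst.comp ℓ.symm.contDiff).contMDiff.contMDiffOn fun w hw => ?_
        rw [htgt] at hw
        obtain ⟨q, hq, rfl⟩ := hw
        change (ℓ.symm (ℓ q)).1 ∈ (e'.extend J).target
        rw [ℓ.symm_apply_apply]
        exact hq.1
      have hB : ContMDiffOn 𝓘(ℝ, E) (𝓡 1) ∞ (fun w => (argChart b).symm (ℓ.symm w).2)
          (e.extend I).target :=
        ((contMDiff_argChart_symm b).comp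
          (contDiff_snd.comp ℓ.symm.contDiff).contMDiff).contMDiffOn
      refine (h1.comp (hA.prodMk hB) fun w hw => ?_).congr fun w hw => ?_
      · rw [mem_preimage, hs]
        rw [htgt] at hw
        obtain ⟨q, hq, rfl⟩ := hw
        refine ⟨heU ?_, mem_univ _⟩
        rw [← e'.extend_source (I := J), ℓ.symm_apply_apply]
        exact (e'.extend J).map_target hq.1
      · obtain ⟨⟨y, t⟩, rfl⟩ := ℓ.surjective w
        rw [hsymm, Function.comp_apply, ℓ.symm_apply_apply]
  · intro y hy t _
    have hy1 := (e'.extend J).map_target hy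
    rw [e'.extend_source] at hy1
    rw [hsymm, (h3 _ (heU hy1) _ 1).1]
  · intro y hy t s _ _
    have hy1 := (e'.extend J).map_target hy
    rw [e'.extend_source] at hy1
    rw [hsymm, hsymm, ← (h3 _ (heU hy1) _ _).2]
    change Φ (_, Circle.exp s * (Circle.exp t * b)) = Φ (_, Circle.exp (t + s) * b)
    rw [Circle.exp_add, ← mul_assoc, mul_comm (Circle.exp s)]
  · rw [hsrc, hes]
    exact ⟨⟨mem_chart_source H' (f x), hx⟩, mem_argChart_source b⟩

/-- A principal circle bundle is a circle fibration. -/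
theorem isCircleFibration [MeasureSpace E] [MeasureSpace E']
    (h : IsPrincipalCircleBundle I J f a) {ℓ : (E' × ℝ) ≃L[ℝ] E} (hℓ : MeasurePreserving ℓ) :
    IsCircleFibration I J ℓ f a where
  measurePreserving := hℓ
  contMDiff := h.contMDiff
  contMDiff_act := h.contMDiff_act
  act_act := h.act_act
  one_act := h.one_act
  map_act := h.map_act
  exists_act_eq := h.exists_act_eq
  surjective := h.surjective
  exists_chart := h.exists_chart ℓ

end IsPrincipalCircleBundle

end PrincipalBundle

/-! ### A volume-preserving rearrangement of coordinates -/

section Rearrange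

/-- With `A` for the coordinates of the manifold and `κ : ℝ ≃ C` for those of the circle, the
coordinates of base and fibre of the circle bundle over `Q` are a rearrangement of those of `S × S`,
which preserves the product measures. -/
theorem exists_measurePreserving_equiv (A C : Type) [NormedAddCommGroup A] [NormedSpace ℝ A]
    [MeasureSpace A] [SFinite (volume : Measure A)] [NormedAddCommGroup C] [NormedSpace ℝ C]
    [MeasureSpace C] [SFinite (volume : Measure C)] (κ : ℝ ≃L[ℝ] C) (hκ : MeasurePreserving κ) :
    ∃ ℓ : (((A × A) × C) × ℝ) ≃L[ℝ] ((A × C) × (A × C)), MeasurePreserving ℓ := by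
  let ℓ : (((A × A) × C) × ℝ) ≃L[ℝ] ((A × C) × (A × C)) :=
    ((((ContinuousLinearEquiv.prodAssoc ℝ A A C).prodCongr (.refl ℝ ℝ)).trans
      (ContinuousLinearEquiv.prodAssoc ℝ A (A × C) ℝ)).trans
      ((ContinuousLinearEquiv.refl ℝ A).prodCongr
        (ContinuousLinearEquiv.prodComm ℝ (A × C) ℝ))).trans
      ((ContinuousLinearEquiv.prodAssoc ℝ A ℝ (A × C)).symm.trans
        (((ContinuousLinearEquiv.refl ℝ A).prodCongr κ).prodCongr (.refl ℝ (A × C))))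
  refine ⟨ℓ, ?_⟩
  have h1 := (measurePreserving_prodAssoc (volume : Measure A) (volume : Measure A)
    (volume : Measure C)).prod (MeasurePreserving.id (volume : Measure ℝ))
  have h2 := measurePreserving_prodAssoc (volume : Measure A) (volume : Measure (A × C))
    (volume : Measure ℝ)
  have h3 := (MeasurePreserving.id (volume : Measure A)).prod
    (Measure.measurePreserving_swap (μ := (volume : Measure (A × C))) (ν := (volume : Measure ℝ)))
  have h4 := (measurePreserving_prodAssoc (volume : Measure A) (volume : Measure ℝ)
    (volume : Measure (A × C))).symm MeasurableEquiv.prodAssoc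
  have h5 := ((MeasurePreserving.id (volume : Measure A)).prod hκ).prod
    (MeasurePreserving.id (volume : Measure (A × C)))
  exact h5.comp (h4.comp (h3.comp (h2.comp h1)))

theorem exists_measurePreserving_real :
    ∃ κ : ℝ ≃L[ℝ] EuclideanSpace ℝ (Fin 1), MeasurePreserving κ :=
  ⟨(OrthonormalBasis.singleton (Fin 1) ℝ).repr.toContinuousLinearEquiv,
    (OrthonormalBasis.singleton (Fin 1) ℝ).measurePreserving_repr⟩

end Rearrange

/-! ### The total space of a circle bundle given by local coordinates -/

namespace CircleBundleCore

variable {B : Type*} [TopologicalSpace B] {P : B → Type*} (c : CircleBundleCore P)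

/-- The local trivialization over `dom i` as a homeomorphism between open sets. -/
def trivHomeomorph (i : c.ι) :
    @OpenPartialHomeomorph (TotalSpace Circle P) (B × Circle) c.topology _ :=
  c.chartedSpaceCore.openPartialHomeomorph (c.triv i) (mem_range_self i)

theorem continuous_proj :
    letI := c.topology
    Continuous (TotalSpace.proj : TotalSpace Circle P → B) := by
  let := c.topology
  rw [continuous_iff_continuousAt]
  intro x
  have h := (c.trivHomeomorph (c.idx x.proj)).continuousAt (x := x) (c.mem_dom x.proj)
  exact continuousAt_fst.comp h

theorem t2Space [T2Space B] : @T2Space (TotalSpace Circle P) c.topology := by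
  let := c.topology
  refine ⟨fun x y hxy => ?_⟩
  by_cases hp : x.proj = y.proj
  · let e := c.trivHomeomorph (c.idx x.proj)
    have hx : x ∈ e.source := c.mem_dom x.proj
    have hy : y ∈ e.source := by
      change y.proj ∈ c.dom (c.idx x.proj)
      rw [← hp]
      exact c.mem_dom x.proj
    obtain ⟨U, V, hU, hV, hxU, hyV, hd⟩ := t2_separation fun h => hxy (e.injOn hx hy h)
    refine ⟨_, _, e.isOpen_inter_preimage hU, e.isOpen_inter_preimage hV, ⟨hx, hxU⟩, ⟨hy, hyV⟩, ?_⟩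
    exact (hd.preimage e).mono inter_subset_right inter_subset_right
  · obtain ⟨U, V, hU, hV, hxU, hyV, hd⟩ := t2_separation hp
    exact ⟨_, _, hU.preimage c.continuous_proj, hV.preimage c.continuous_proj, hxU, hyV,
      hd.preimage _⟩

/-- Countably many local trivializations cover the total space. -/
theorem secondCountableTopology [SecondCountableTopology B] :
    @SecondCountableTopology (TotalSpace Circle P) c.topology := by
  let := c.topology
  let : ChartedSpace (B × Circle) (TotalSpace Circle P) := c.chartedSpaceCore.toChartedSpace
  obtain ⟨s, hs, hU⟩ := TopologicalSpace.countable_cover_nhds (f := fun b => c.dom (c.idx b))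
    fun b => (c.isOpen_dom _).mem_nhds (c.mem_dom b)
  refine ChartedSpace.secondCountable_of_countable_cover (B × Circle)
    (s := (fun b => c.trivHomeomorph (c.idx b) |>.symm (b, 1)) '' s) ?_ (hs.image _)
  rw [eq_univ_iff_forall] at hU ⊢
  intro x
  obtain ⟨b, hb, hxb⟩ := mem_iUnion₂.1 (hU x.proj)
  refine mem_iUnion₂.2 ⟨_, ⟨b, hb, rfl⟩, ?_⟩
  exact hxb

variable {EB : Type*} [NormedAddCommGroup EB] [NormedSpace ℝ EB] {HB : Type*} [TopologicalSpace HB]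
  (IB : ModelWithCorners ℝ EB HB) [ChartedSpace HB B] [IsManifold IB ∞ B]

/-- The local trivializations are diffeomorphisms. -/
theorem contMDiffOn_triv (h : ∀ i j, ContMDiffOn IB (𝓡 1) ∞ (c.trans i j) (c.dom i ∩ c.dom j))
    (i : c.ι) :
    letI := c.topology
    letI := c.charted HB
    ContMDiffOn (IB.prod (𝓡 1)) (IB.prod (𝓡 1)) ∞ (c.trivHomeomorph i)
      (c.trivHomeomorph i).source ∧
    ContMDiffOn (IB.prod (𝓡 1)) (IB.prod (𝓡 1)) ∞ (c.trivHomeomorph i).symm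
      (c.trivHomeomorph i).target := by
  let := c.topology
  let := c.charted HB
  have := isManifold_circle
  have := c.isManifold IB h
  let t := c.trivHomeomorph i
  have hat : ∀ q : B × Circle, (t ≫ₕ chartAt (ModelProd HB (EuclideanSpace ℝ (Fin 1))) q) ∈
      IsManifold.maximalAtlas (IB.prod (𝓡 1)) ∞ (TotalSpace Circle P) := fun q =>
    IsManifold.subset_maximalAtlas (mem_image2_of_mem
      (mem_iUnion₂.2 ⟨c.triv i, mem_range_self i, rfl⟩) (chart_mem_atlas _ q))
  constructor
  · intro x hx
    let φ := chartAt (ModelProd HB (EuclideanSpace ℝ (Fin 1))) (t x)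
    have hφ := mem_chart_source (ModelProd HB (EuclideanSpace ℝ (Fin 1))) (t x)
    have hs : (t ≫ₕ φ).source = t.source ∩ t ⁻¹' φ.source := rfl
    have h1 := contMDiffOn_of_mem_maximalAtlas (hat (t x))
    have h2 : ContMDiffOn _ _ ∞ φ.symm φ.target := contMDiffOn_symm_of_mem_maximalAtlas
      (I := IB.prod (𝓡 1)) (IsManifold.chart_mem_maximalAtlas (t x))
    have h3 := (h2.comp h1 fun y hy => φ.map_source hy.2).congr (f₁ := t)
      fun y hy => (φ.left_inv hy.2).symm
    exact ((h3 x ⟨hx, hφ⟩).contMDiffAt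
      ((t ≫ₕ φ).open_source.mem_nhds ⟨hx, hφ⟩)).contMDiffWithinAt
  · intro q hq
    let φ := chartAt (ModelProd HB (EuclideanSpace ℝ (Fin 1))) q
    have hφ := mem_chart_source (ModelProd HB (EuclideanSpace ℝ (Fin 1))) q
    have h1 := contMDiffOn_symm_of_mem_maximalAtlas (hat q)
    have h2 : ContMDiffOn _ _ ∞ φ φ.source := contMDiffOn_of_mem_maximalAtlas
      (I := IB.prod (𝓡 1)) (IsManifold.chart_mem_maximalAtlas q)
    have h3 := (h1.comp (h2.mono inter_subset_left) (s := φ.source ∩ t.target)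
      fun y hy => ?_).congr (f₁ := t.symm) fun y hy => ?_
    · exact ((h3 q ⟨hφ, hq⟩).contMDiffAt
        ((φ.open_source.inter t.open_target).mem_nhds ⟨hφ, hq⟩)).contMDiffWithinAt
    · refine ⟨φ.map_source hy.1, ?_⟩
      change φ.symm (φ y) ∈ t.target
      rw [φ.left_inv hy.1]
      exact hy.2
    · change t.symm y = t.symm (φ.symm (φ y))
      rw [φ.left_inv hy.1]

end CircleBundleCore

/-! ### The circle bundles of a Hermitian line bundle -/

section LineBundle

variable {M : Type*} [TopologicalSpace M] (L : M → Type*) [TopologicalSpace (TotalSpace ℂ L)]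
  [∀ x, NormedAddCommGroup (L x)] [∀ x, InnerProductSpace ℂ (L x)]
  [FiberBundle ℂ L] [VectorBundle ℂ ℂ L]

instance [T2Space M] : T2Space (S L) := (circleCore L).t2Space

instance [T2Space M] : T2Space (Q L) := (tensorCore L).t2Space

instance [SecondCountableTopology M] : SecondCountableTopology (S L) :=
  (circleCore L).secondCountableTopology

instance [SecondCountableTopology M] : SecondCountableTopology (Q L) :=
  (tensorCore L).secondCountableTopology

/-- The local trivialization `z u_e ↦ z` of `S`. -/
def trivS (e : Triv L) : OpenPartialHomeomorph (S L) (M × Circle) :=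
  (circleCore L).trivHomeomorph e

/-- The local trivialization `z u_e ⊗ u_e'⁻¹ ↦ z` of `Q`. -/
def trivQ (e : Triv L × Triv L) : OpenPartialHomeomorph (Q L) ((M × M) × Circle) :=
  (tensorCore L).trivHomeomorph e

variable {L}

theorem trivS_symm_apply {e : Triv L} {x : M} (hx : x ∈ e.1.baseSet) (z : Circle) :
    (trivS L e).symm (x, z) =
      ⟨x, ⟨(z : ℂ) • unitFrame e x, by
        rw [norm_smul, norm_unitFrame e hx, Circle.norm_coe, mul_one]⟩⟩ :=
  (circleCore L).triv_symm_apply e hx z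

theorem trivQ_symm_apply {e : Triv L × Triv L} {p : M × M}
    (hp : p ∈ e.1.1.baseSet ×ˢ e.2.1.baseSet) (z : Circle) :
    (trivQ L e).symm (p, z) =
      ⟨p, (tensorCoord (unitFrame e.1 p.1) (norm_unitFrame e.1 hp.1) (unitFrame_spans e.1 hp.1)
        (unitFrame e.2 p.2) (norm_unitFrame e.2 hp.2) (unitFrame_spans e.2 hp.2)).symm z⟩ :=
  (tensorCore L).triv_symm_apply e hp z

theorem rotate_trivS_symm {e : Triv L} {x : M} (hx : x ∈ e.1.baseSet) (w z : Circle) :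
    rotate w ((trivS L e).symm (x, z)) = (trivS L e).symm (x, w * z) := by
  rw [trivS_symm_apply hx, trivS_symm_apply hx]
  refine congrArg (TotalSpace.mk x) (Subtype.ext ?_)
  change (w : ℂ) • (z : ℂ) • unitFrame e x = ((w * z : Circle) : ℂ) • unitFrame e x
  rw [smul_smul, Circle.coe_mul]

/-- In local trivializations the map `S × S → Q` is `(α, β) ↦ α β⁻¹`. -/
theorem toQ_trivS_symm {e e' : Triv L} {x x' : M} (hx : x ∈ e.1.baseSet) (hx' : x' ∈ e'.1.baseSet)
    (z w : Circle) :
    toQ L ((trivS L e).symm (x, z), (trivS L e').symm (x', w)) =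
      (trivQ L (e, e')).symm ((x, x'), z * w⁻¹) := by
  rw [trivS_symm_apply hx, trivS_symm_apply hx', trivQ_symm_apply (p := (x, x')) ⟨hx, hx'⟩]
  refine congrArg (TotalSpace.mk (x, x')) (Subtype.ext ?_)
  change ((z : ℂ) • unitFrame e x) ⊗ₜ[ℂ] innerSL ℂ ((w : ℂ) • unitFrame e' x') =
    (((z * w⁻¹ : Circle) : ℂ) • unitFrame e x) ⊗ₜ[ℂ] innerSL ℂ (unitFrame e' x')
  rw [map_smulₛₗ, TensorProduct.tmul_smul, TensorProduct.smul_tmul', smul_smul, Circle.coe_mul,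
    Circle.coe_inv_eq_conj, mul_comm]

variable (M) in
/-- The change of coordinates `((p, p'), γ; β) ↦ ((p, γ β), (p', β))`, which turns the quotient
`γ = α β⁻¹` of the circle coordinates `α`, `β` into a coordinate. -/
def mulHomeomorph : ((M × M) × Circle) × Circle ≃ₜ (M × Circle) × (M × Circle) where
  toFun q := ((q.1.1.1, q.1.2 * q.2), (q.1.1.2, q.2))
  invFun r := (((r.1.1, r.2.1), r.1.2 * r.2.2⁻¹), r.2.2)
  left_inv q := by simp
  right_inv r := by simp
  continuous_toFun := by fun_prop
  continuous_invFun := by fun_prop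

variable (L) in
/-- The local trivialization of `S × S → Q` given by local trivializations of `L`: a point of `Q`
with circle coordinate `γ` and an element `β` of the circle go to the pair of points with circle
coordinates `γ β` and `β`. -/
def trivToQ (e : Triv L × Triv L) : OpenPartialHomeomorph (Q L × Circle) (S L × S L) :=
  ((trivQ L e).prod (.refl Circle)).trans
    ((mulHomeomorph M).toOpenPartialHomeomorph.trans ((trivS L e.1).prod (trivS L e.2)).symm)

theorem trivToQ_source (e : Triv L × Triv L) :
    (trivToQ L e).source = (trivQ L e).source ×ˢ univ := by
  ext ⟨q, z⟩
  constructor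
  · rintro ⟨⟨h, -⟩, -⟩
    exact ⟨h, mem_univ _⟩
  · rintro ⟨h, -⟩
    exact ⟨⟨h, mem_univ _⟩, mem_univ _, ⟨h.1, mem_univ _⟩, ⟨h.2, mem_univ _⟩⟩

theorem trivToQ_target (e : Triv L × Triv L) :
    (trivToQ L e).target = toQ L ⁻¹' (trivQ L e).source := by
  ext ⟨s, s'⟩
  constructor
  · rintro ⟨⟨h, -⟩, -⟩
    exact h
  · rintro ⟨h, h'⟩
    exact ⟨⟨⟨h, h'⟩, mem_univ _⟩, ⟨⟨h, h'⟩, mem_univ _⟩, mem_univ _⟩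

theorem trivToQ_apply (e : Triv L × Triv L) (q : Q L) (z : Circle) :
    trivToQ L e (q, z) = ((trivS L e.1).symm (q.proj.1, (trivQ L e q).2 * z),
      (trivS L e.2).symm (q.proj.2, z)) := rfl

section Smooth

variable {E : Type*} [NormedAddCommGroup E] [NormedSpace ℝ E]
  {H : Type*} [TopologicalSpace H] (I : ModelWithCorners ℝ E H) [ChartedSpace H M]
  [IsManifold I ∞ M] [VectorBundle ℝ ℂ L] [ContMDiffVectorBundle ∞ ℂ L I]

theorem contMDiffOn_trivS (e : Triv L) :
    ContMDiffOn (I.prod (𝓡 1)) (I.prod (𝓡 1)) ∞ (trivS L e) (trivS L e).source ∧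
      ContMDiffOn (I.prod (𝓡 1)) (I.prod (𝓡 1)) ∞ (trivS L e).symm (trivS L e).target :=
  (circleCore L).contMDiffOn_triv I (contMDiffOn_phase_cocycle I) e

theorem contMDiffOn_trivQ (e : Triv L × Triv L) :
    ContMDiffOn ((I.prod I).prod (𝓡 1)) ((I.prod I).prod (𝓡 1)) ∞ (trivQ L e)
        (trivQ L e).source ∧
      ContMDiffOn ((I.prod I).prod (𝓡 1)) ((I.prod I).prod (𝓡 1)) ∞ (trivQ L e).symm
        (trivQ L e).target := by
  refine (tensorCore L).contMDiffOn_triv (I.prod I) (fun e e' => ?_) e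
  have := lieGroup_circle
  exact ((contMDiffOn_phase_cocycle I e.1 e'.1).comp contMDiffOn_fst
      fun p hp => ⟨hp.1.1, hp.2.1⟩).mul
    ((contMDiffOn_phase_cocycle I e.2 e'.2).comp contMDiffOn_snd
      fun p hp => ⟨hp.1.2, hp.2.2⟩).inv

theorem contMDiff_mulHomeomorph :
    ContMDiff (((I.prod I).prod (𝓡 1)).prod (𝓡 1)) ((I.prod (𝓡 1)).prod (I.prod (𝓡 1))) ∞
      (mulHomeomorph M) := by
  have := lieGroup_circle
  exact ((contMDiff_fst.comp (contMDiff_fst.comp contMDiff_fst)).prodMk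
    ((contMDiff_snd.comp contMDiff_fst).mul contMDiff_snd)).prodMk
    ((contMDiff_snd.comp (contMDiff_fst.comp contMDiff_fst)).prodMk contMDiff_snd)

theorem contMDiff_mulHomeomorph_symm :
    ContMDiff ((I.prod (𝓡 1)).prod (I.prod (𝓡 1))) (((I.prod I).prod (𝓡 1)).prod (𝓡 1)) ∞
      (mulHomeomorph M).symm := by
  have := lieGroup_circle
  exact (((contMDiff_fst.comp contMDiff_fst).prodMk (contMDiff_fst.comp contMDiff_snd)).prodMk
    ((contMDiff_snd.comp contMDiff_fst).mul (contMDiff_snd.comp contMDiff_snd).inv)).prodMk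
    (contMDiff_snd.comp contMDiff_snd)

/-- The map `S × S → Q` is a principal circle bundle for the conjugation action. -/
theorem isPrincipalCircleBundle_toQ :
    IsPrincipalCircleBundle ((I.prod (𝓡 1)).prod (I.prod (𝓡 1))) ((I.prod I).prod (𝓡 1))
      (toQ L) (conjAction L) := by
  intro q
  let e : Triv L × Triv L := (tensorCore L).idx q.proj
  have hq : q ∈ (trivQ L e).source := (tensorCore L).mem_dom q.proj
  refine ⟨(trivQ L e).source, trivToQ L e, (trivQ L e).open_source, hq, trivToQ_source e,
    trivToQ_target e, ?_, ?_, fun q' hq' z w => ⟨?_, ?_⟩⟩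
  · have h1 := (contMDiffOn_trivQ I e).1.prodMap
      (contMDiffOn_id (I := 𝓡 1) (s := (univ : Set Circle)))
    have h2 := (contMDiffOn_trivS I e.1).2.prodMap (contMDiffOn_trivS I e.2).2
    rw [trivToQ_source]
    refine h2.comp ((contMDiff_mulHomeomorph I).comp_contMDiffOn h1) ?_
    rintro ⟨q', z⟩ ⟨hq', -⟩
    exact ⟨⟨hq'.1, mem_univ _⟩, ⟨hq'.2, mem_univ _⟩⟩
  · have h1 := (contMDiffOn_trivS I e.1).1.prodMap (contMDiffOn_trivS I e.2).1
    have h2 := (contMDiffOn_trivQ I e).2.prodMap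
      (contMDiffOn_id (I := 𝓡 1) (s := (univ : Set Circle)))
    rw [trivToQ_target]
    refine h2.comp ((contMDiff_mulHomeomorph_symm I).comp_contMDiffOn (h1.mono ?_)) ?_
    · rintro ⟨s, s'⟩ h
      exact h
    · rintro ⟨s, s'⟩ h
      exact ⟨⟨h, mem_univ _⟩, mem_univ _⟩
  · rw [trivToQ_apply, toQ_trivS_symm hq'.1 hq'.2, mul_inv_cancel_right]
    exact (trivQ L e).left_inv hq'
  · rw [trivToQ_apply, trivToQ_apply]
    refine Prod.ext ?_ (rotate_trivS_symm hq'.2 w z).symm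
    change _ = rotate w _
    rw [rotate_trivS_symm hq'.1, mul_left_comm]

end Smooth

end LineBundle

/-! ### Distributions on the circle bundles -/

/-- The product of Haar measures on normed spaces is a Haar measure, stated for `volume` so that it
can serve as an instance for the iterated products that occur as model spaces. -/
theorem isAddHaarMeasure_volume_prod (A B : Type) [NormedAddCommGroup A] [MeasureSpace A]
    [BorelSpace A] [SecondCountableTopology A] [(volume : Measure A).IsAddHaarMeasure]
    [SFinite (volume : Measure A)] [NormedAddCommGroup B] [MeasureSpace B] [BorelSpace B]
    [SecondCountableTopology B] [(volume : Measure B).IsAddHaarMeasure]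
    [SFinite (volume : Measure B)] : (volume : Measure (A × B)).IsAddHaarMeasure :=
  Measure.prod.instIsAddHaarMeasure volume volume

section LineBundle

variable {M : Type*} [TopologicalSpace M] [SecondCountableTopology M] (L : M → Type*)
  [TopologicalSpace (TotalSpace ℂ L)] [∀ x, NormedAddCommGroup (L x)]
  [∀ x, InnerProductSpace ℂ (L x)] [FiberBundle ℂ L] [VectorBundle ℂ ℂ L]

section SigmaCompact

variable {E : Type*} [NormedAddCommGroup E] [NormedSpace ℝ E] [FiniteDimensional ℝ E]
  {H : Type*} [TopologicalSpace H] (I : ModelWithCorners ℝ E H) [ChartedSpace H M]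

include I

theorem sigmaCompactSpace_S_prod_S : SigmaCompactSpace (S L × S L) := by
  have : LocallyCompactSpace (S L × S L) :=
    Manifold.locallyCompact_of_finiteDimensional ((I.prod (𝓡 1)).prod (I.prod (𝓡 1)))
  infer_instance

theorem sigmaCompactSpace_Q : SigmaCompactSpace (Q L) := by
  have : LocallyCompactSpace (Q L) :=
    Manifold.locallyCompact_of_finiteDimensional ((I.prod I).prod (𝓡 1))
  infer_instance

end SigmaCompact

variable {n : ℕ} [T2Space M] [ChartedSpace (EuclideanSpace ℝ (Fin n)) M] [IsManifold (𝓡 n) ∞ M]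
  [VectorBundle ℝ ℂ L] [ContMDiffVectorBundle ∞ ℂ L (𝓡 n)]

theorem isCircleFibration_toQ
    {ℓ : (((EuclideanSpace ℝ (Fin n) × EuclideanSpace ℝ (Fin n)) × EuclideanSpace ℝ (Fin 1)) × ℝ)
      ≃L[ℝ] (EuclideanSpace ℝ (Fin n) × EuclideanSpace ℝ (Fin 1)) ×
        (EuclideanSpace ℝ (Fin n) × EuclideanSpace ℝ (Fin 1))} (hℓ : MeasurePreserving ℓ) :
    IsCircleFibration (((𝓡 n).prod (𝓡 1)).prod ((𝓡 n).prod (𝓡 1)))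
      (((𝓡 n).prod (𝓡 n)).prod (𝓡 1)) ℓ (toQ L) (conjAction L) :=
  (isPrincipalCircleBundle_toQ (𝓡 n)).isCircleFibration hℓ

theorem exists_linearEquiv_toQ_of_measurePreserving
    {ℓ : (((EuclideanSpace ℝ (Fin n) × EuclideanSpace ℝ (Fin n)) × EuclideanSpace ℝ (Fin 1)) × ℝ)
      ≃L[ℝ] (EuclideanSpace ℝ (Fin n) × EuclideanSpace ℝ (Fin 1)) ×
        (EuclideanSpace ℝ (Fin n) × EuclideanSpace ℝ (Fin 1))} (hℓ : MeasurePreserving ℓ) :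
    ∃ Φ : distributions (((𝓡 n).prod (𝓡 n)).prod (𝓡 1)) (Q L) ≃ₗ[ℂ]
        invariantDistributions (((𝓡 n).prod (𝓡 1)).prod ((𝓡 n).prod (𝓡 1))) (conjAction L),
      ∀ u, IsPullback (((𝓡 n).prod (𝓡 1)).prod ((𝓡 n).prod (𝓡 1)))
        (((𝓡 n).prod (𝓡 n)).prod (𝓡 1)) (toQ L) u (Φ u).1 := by
  have := sigmaCompactSpace_S_prod_S L (𝓡 n)
  have := sigmaCompactSpace_Q L (𝓡 n)
  have := isAddHaarMeasure_volume_prod (EuclideanSpace ℝ (Fin n)) (EuclideanSpace ℝ (Fin 1))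
  have := isAddHaarMeasure_volume_prod (EuclideanSpace ℝ (Fin n)) (EuclideanSpace ℝ (Fin n))
  have := isAddHaarMeasure_volume_prod (EuclideanSpace ℝ (Fin n) × EuclideanSpace ℝ (Fin 1))
    (EuclideanSpace ℝ (Fin n) × EuclideanSpace ℝ (Fin 1))
  have := isAddHaarMeasure_volume_prod (EuclideanSpace ℝ (Fin n) × EuclideanSpace ℝ (Fin n))
    (EuclideanSpace ℝ (Fin 1))
  exact (isCircleFibration_toQ L hℓ).exists_linearEquiv

theorem exists_measurePreserving_euclidean (n : ℕ) :
    ∃ ℓ : (((EuclideanSpace ℝ (Fin n) × EuclideanSpace ℝ (Fin n)) × EuclideanSpace ℝ (Fin 1)) × ℝ)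
      ≃L[ℝ] (EuclideanSpace ℝ (Fin n) × EuclideanSpace ℝ (Fin 1)) ×
        (EuclideanSpace ℝ (Fin n) × EuclideanSpace ℝ (Fin 1)), MeasurePreserving ℓ := by
  obtain ⟨κ, hκ⟩ := exists_measurePreserving_real
  exact exists_measurePreserving_equiv (EuclideanSpace ℝ (Fin n))
    (EuclideanSpace ℝ (Fin 1)) κ hκ

/-- The pull-back under `S × S → Q` identifies the distributions on `Q` with the invariant
distributions on `S × S`. -/
theorem exists_linearEquiv_toQ :
    ∃ Φ : distributions (((𝓡 n).prod (𝓡 n)).prod (𝓡 1)) (Q L) ≃ₗ[ℂ]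
        invariantDistributions (((𝓡 n).prod (𝓡 1)).prod ((𝓡 n).prod (𝓡 1))) (conjAction L),
      ∀ u, IsPullback (((𝓡 n).prod (𝓡 1)).prod ((𝓡 n).prod (𝓡 1)))
        (((𝓡 n).prod (𝓡 n)).prod (𝓡 1)) (toQ L) u (Φ u).1 := by
  obtain ⟨ℓ, hℓ⟩ := exists_measurePreserving_euclidean n
  exact exists_linearEquiv_toQ_of_measurePreserving L hℓ

end LineBundle

end

end CircleDist

theorem proposition18p6p2004p1 {n : ℕ} {M : Type*} [TopologicalSpace M] [T2Space M]
    [SecondCountableTopology M] [ChartedSpace (EuclideanSpace ℝ (Fin n)) M] [IsManifold (𝓡 n) ∞ M]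
    (L : M → Type*) [TopologicalSpace (Bundle.TotalSpace ℂ L)]
    [∀ x, NormedAddCommGroup (L x)] [∀ x, InnerProductSpace ℂ (L x)]
    [FiberBundle ℂ L] [VectorBundle ℂ ℂ L] [VectorBundle ℝ ℂ L]
    [ContMDiffVectorBundle ∞ ℂ L (𝓡 n)]
    (hL : CircleDist.IsSmoothMetric L (𝓡 n)) :
    CircleDist.IsPrincipalCircleBundle
        (((𝓡 n).prod (𝓡 1)).prod ((𝓡 n).prod (𝓡 1))) (((𝓡 n).prod (𝓡 n)).prod (𝓡 1))
        (CircleDist.toQ L) (CircleDist.conjAction L) ∧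
      ∃ Φ : CircleDist.distributions (((𝓡 n).prod (𝓡 n)).prod (𝓡 1)) (CircleDist.Q L) ≃ₗ[ℂ]
          CircleDist.invariantDistributions (((𝓡 n).prod (𝓡 1)).prod ((𝓡 n).prod (𝓡 1)))
            (CircleDist.conjAction L),
        ∀ u, CircleDist.IsPullback
          (((𝓡 n).prod (𝓡 1)).prod ((𝓡 n).prod (𝓡 1))) (((𝓡 n).prod (𝓡 n)).prod (𝓡 1))
          (CircleDist.toQ L) u (Φ u).1 :=
  ⟨CircleDist.isPrincipalCircleBundle_toQ (𝓡 n), CircleDist.exists_linearEquiv_toQ L⟩
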